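/- **Setting.** Let $A\subset\mathbb{Z}^n_{\ge 0}$ be finite and non-empty, and let $N=\mathrm{conv}(A)+\mathbb{R}^n_{\ge 0}$. Let $I\subset\{1,\dots,n\}$, $\bar I=\{1,\dots,n\}\setminus I$, and let $\pi_I:N\to N^I\subset\mathbb{R}^{\bar I}$ be the coordinate projection along $\mathbb{R}^I$ onto its image. For $b\in N^I$ let $N_b=\pi_I^{-1}(b)$; this polyhedron is called trivial if it is a shifted copy of the orthant $\mathbb{R}^I_{\ge0}$. *Lattice volume.* The lattice volume $\mathrm{Vol}$ on a $k$-dimensional rational subspace $U$ is the volume form for which $U/(U\cap\mathbb{Z}^n)$ has volume $k!$. *$V$-faces.* A face $\Gamma$ of $N$ is a $V$-face if it lies in a coordinate subspace $\mathbb{R}^J$ with $|J|=\dim\Gamma+1$ and in no coordinate subspace of dimension $\dim\Gamma$. It is a $V_I$-face if $I\subset J$ is the smallest set such that the projection of $\Gamma$ along $\mathbb{R}^I$ is bounded. Let $m_\Gamma$ be the lattice distance from $0$ to the affine span of $\Gamma$ in $\mathbb{R}^J$. The same terms are used for faces of $N^I\subset\mathbb{R}^{\bar I}$. A face $B$ of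 $N^I$ contributes if it is a bounded $V$-face of $N^I$ and $m\mid m_B$. *Dual fans.* Let $U_\Gamma$ be the vector space generated by the differences of points of $\Gamma$. The dual fan $[\Gamma]^d$ is the weighted fan of codimension $d$ in $U_\Gamma^*$ supported at all $v$ whose support face $\Gamma^v$ is bounded of dimension $d$, with weight $\mathrm{Vol}(\Gamma^v)$ at $v$. Put $\langle\Gamma\rangle=\sum_{d\ge0}(-1)^{d-1}[\Gamma]^d$, and let $\pi:U_\Gamma^*\to(\mathbb{R}^I)^*$ be the restriction of linear functions to $\mathbb{R}^I\subset U_\Gamma$. Let $L$ be the lattice in $U_\Gamma^*$ dual to $U_\Gamma\cap\mathbb{Z}^n$. The direct image $\pi_*$ of weighted fans sends a cone $Q$ with linear span $W$ to $|(\pi(W)\cap\pi(L))/\pi(W\cap L)|\cdot\pi(Q)$ if $\dim\pi(Q)=\dim Q$, and to $0$ otherwise. Weighted fans of dimension $r$ are identified if their weights differ only on a set of dimension less than $r$. *Tropical nearby monodromy eigenvalues.* A positive integer $m$ is a tautological denominator for $N$ if $m=1$ or $m$ divides one of the non-zero numbers among $\min_{x\in N}x_i$, $i=1,\dots,n$.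 For coprime integers $k$ and $m>0$ with $m$ non-tautological, $s=\exp(2\pi ik/m)$ is a tropical nearby monodromy eigenvalue (t.n.e.) of $N$ in codimension $d\le|I|$ at $(\mathbb{C}\setminus0)^I$ if the codimension $d$ component of $$\Phi_{m,I}=\sum_{\Gamma\subset N\text{ a }V_I\text{-face},\ m\mid m_\Gamma}\pi_*\langle\Gamma\rangle$$ is a non-zero weighted fan in $(\mathbb{R}^I)^*$. **Statement.** Assume $|\bar I|=2$, and let $s=\exp(2\pi ik/m)$ with $k$ and $m>0$ coprime and $m$ not a tautological denominator for $N$. Then $s$ is a t.n.e. of $N$ in codimension $0$ or $1$ at $(\mathbb{C}\setminus 0)^I$ if and only if none of the following four cases takes place: 1. no face of $N^I$ contributes; 2. $N^I$ has exactly one bounded edge $B$, this edge has exactly one interior lattice point $p$, both end points of $B$ are $V$-vertices, $B$ and both its end points contribute, and $N_p$ is trivial; 3. the only contributing faces are one vertex $a$ and its adjacent edge $B$, the edge $B$ has lattice length $1$, and $N_b$ is trivial for the other end point $b\neq a$ of $B$; 4. the only contributing faces are two distinct vertices $a_1,a_2$ and two distinct edges $B_1,B_2$ such that, for $j=1,2$,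 $B_j$ is adjacent to $a_j$ and has lattice length $1$, and $N_{b_j}$ is trivial for the other end point $b_j\ne a_j$ of $B_j$. -/

import Mathlib

open scoped Nat

noncomputable section

namespace TropicalMonodromy

section Polyhedra

/-- The Newton polyhedron `conv(A) + ℝ^ι_{≥0}` of a finite set `A` of exponents. -/
def newtonPolyhedron {ι : Type*} (A : Finset (ι → ℕ)) : Set (ι → ℝ) :=
  {x | ∃ y ∈ convexHull ℝ ((fun (a : ι → ℕ) (i : ι) => (a i : ℝ)) '' (A : Set (ι → ℕ))),
    ∀ i, y i ≤ x i}

/-- Points with integer coordinates. -/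
def IsLatticePoint {ι : Type*} (x : ι → ℝ) : Prop :=
  ∃ z : ι → ℤ, ∀ i, x i = (z i : ℝ)

/-- The dimension of (the affine span of) a set. -/
def dim {ι : Type*} (F : Set (ι → ℝ)) : ℕ :=
  Module.finrank ℝ (vectorSpan ℝ F)

/-- Non-empty faces of a polyhedron (all faces of a polyhedron are exposed). -/
def IsFace {ι : Type*} (P F : Set (ι → ℝ)) : Prop :=
  F.Nonempty ∧ IsExposed ℝ P F

/-- `F` is contained in the coordinate subspace of the coordinates in `J`. -/
def InCoordSubspace {ι : Type*} (J : Finset ι) (F : Set (ι → ℝ)) : Prop :=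
  ∀ x ∈ F, ∀ i, i ∉ J → x i = 0

/-- The coordinate projection along `ℝ^I`. -/
def projAlong {ι : Type*} (I : Finset ι) (x : ι → ℝ) : {i // i ∉ I} → ℝ :=
  fun i => x i

/-- `Γ` is a `V_I`-face of `N`, contained in the coordinate subspace `ℝ^J`,
`|J| = dim Γ + 1`. Here `I ⊆ J` is the smallest set such that the projection of `Γ` along `ℝ^I`
is bounded. The field `not_convenient` excludes the faces that span a whole coordinate subspace:
such a face would be at lattice distance `0` from the origin. It is equivalent to the uniqueness
of `J`. For `I = ∅` these are exactly the bounded `V`-faces. -/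
structure IsVFace {ι : Type*} (I J : Finset ι) (N Γ : Set (ι → ℝ)) : Prop where
  face : IsFace N Γ
  subset : InCoordSubspace J Γ
  card_eq : J.card = dim Γ + 1
  not_convenient : ∀ K : Finset ι, InCoordSubspace K Γ → K.card ≠ dim Γ
  bounded_proj : IsLeast {K : Finset ι | K ⊆ J ∧ Bornology.IsBounded (projAlong K '' Γ)} I

/-- The lattice distance to `0` in `ℝ^J` of a set `Γ ⊆ ℝ^J` whose affine span is a rational
hyperplane of `ℝ^J`: the non-negative value on `Γ` of a primitive integer covector which is
constant on `Γ`. (The set below is then a singleton.) -/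
def latticeDist {ι : Type*} (J : Finset ι) (Γ : Set (ι → ℝ)) : ℕ :=
  sInf {m : ℕ | ∃ l : ι → ℤ, J.gcd l = 1 ∧ ∀ x ∈ Γ, ∑ i ∈ J, (l i : ℝ) * x i = (m : ℝ)}

/-- The inclusion `ℤ^ι → ℝ^ι`. -/
def intToReal (ι : Type*) : (ι → ℤ) →ₗ[ℤ] (ι → ℝ) :=
  ((Int.castAddHom ℝ).compLeft ι).toIntLinearMap

/-- The lattice `U ∩ ℤ^ι`. -/
def integerPoints {ι : Type*} (U : Submodule ℝ (ι → ℝ)) : Submodule ℤ (ι → ℤ) :=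
  (U.restrictScalars ℤ).comap (intToReal ι)

/-- The lattice volume of a lattice polytope `F` of dimension `k`: the volume form on the affine
span of `F` for which the fundamental parallelepiped of the lattice of integer vectors parallel to
`F` has volume `k!`. (It does not depend on the chosen lattice basis and base point.) -/
def latticeVolume {ι : Type*} [Fintype ι] (F : Set (ι → ℝ)) : ℝ :=
  open Classical in
  if h : F.Nonempty then
    ((Module.finrank ℤ (integerPoints (vectorSpan ℝ F)))! : ℝ) *
      (MeasureTheory.volume
        {t : Fin (Module.finrank ℤ (integerPoints (vectorSpan ℝ F))) → ℝ |
          h.some + ∑ j, t j • intToReal ι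
            (Module.finBasis ℤ (integerPoints (vectorSpan ℝ F)) j : ι → ℤ) ∈ F}).toReal
  else 0

end Polyhedra

section Fans

/-- The value at `x` of the weight function of a formal linear combination of cones. Weighted
fans are represented by such combinations of (relatively open) cones of the same dimension. -/
def weightAt {V : Type*} (f : Set V →₀ ℝ) (x : V) : ℝ :=
  f.sum fun P c => P.indicator (fun _ => c) x

/-- A combination of cones of codimension `d` represents the zero weighted fan, if its weight
function vanishes away from a set of codimension greater than `d`. -/
def IsZeroFan {V : Type*} [AddCommGroup V] [Module ℝ V] (d : ℕ) (f : Set V →₀ ℝ) : Prop :=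
  ∃ S : Finset (Submodule ℝ V),
    (∀ W ∈ S, Module.finrank ℝ W + d < Module.finrank ℝ V) ∧
    ∀ x : V, weightAt f x ≠ 0 → ∃ W ∈ S, x ∈ W

/-- For a subspace `W` of `V`, a lattice `L` in `V` and a linear map `p`, the lattice index
`|(p(W) ∩ p(L)) / p(W ∩ L)|`. -/
def latticeIndex {V V' : Type*} [AddCommGroup V] [Module ℝ V] [AddCommGroup V'] [Module ℝ V']
    (L : AddSubgroup V) (p : V →ₗ[ℝ] V') (W : Submodule ℝ V) : ℕ :=
  ((W.toAddSubgroup ⊓ L).map p.toAddMonoidHom).relIndex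
    ((W.map p).toAddSubgroup ⊓ L.map p.toAddMonoidHom)

/-- The direct image of weighted fans: a cone `P` with the vector span `W` is sent to `0` if
`dim p(P) < dim P`, and to `p(P)` with the weight `|(p(W) ∩ p(L)) / p(W ∩ L)|` otherwise. -/
def pushforward {V V' : Type*} [AddCommGroup V] [Module ℝ V] [AddCommGroup V'] [Module ℝ V']
    (L : AddSubgroup V) (p : V →ₗ[ℝ] V') (f : Set V →₀ ℝ) : Set V' →₀ ℝ :=
  f.sum fun P c =>
    if Module.finrank ℝ ((Submodule.span ℝ P).map p) = Module.finrank ℝ (Submodule.span ℝ P) then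
      Finsupp.single (p '' P) (c * (latticeIndex L p (Submodule.span ℝ P) : ℝ))
    else 0

/-- The space `U_Γ^*` dual to the space `U_Γ` generated by differences of points of `Γ`. -/
abbrev DualSpace {ι : Type*} (Γ : Set (ι → ℝ)) : Type _ :=
  Module.Dual ℝ (vectorSpan ℝ Γ)

/-- The lattice in `U_Γ^*` dual to `U_Γ ∩ ℤ^ι`. -/
def dualLattice {ι : Type*} (Γ : Set (ι → ℝ)) : AddSubgroup (DualSpace Γ) where
  carrier := {v | ∀ u : vectorSpan ℝ Γ, IsLatticePoint (u : ι → ℝ) → ∃ z : ℤ, v u = (z : ℝ)}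
  zero_mem' := fun _ _ => ⟨0, by simp⟩
  add_mem' := by
    intro v w hv hw u hu
    obtain ⟨a, ha⟩ := hv u hu
    obtain ⟨b, hb⟩ := hw u hu
    exact ⟨a + b, by simp [ha, hb]⟩
  neg_mem' := by
    intro v hv u hu
    obtain ⟨a, ha⟩ := hv u hu
    exact ⟨-a, by simp [ha]⟩

/-- The support face `Γ^v` of `v ∈ U_Γ^*`: the points of `Γ` at which `v` is minimal. -/
def supportFace {ι : Type*} (Γ : Set (ι → ℝ)) (v : DualSpace Γ) : Set (ι → ℝ) :=
  {x | x ∈ Γ ∧ ∀ u : vectorSpan ℝ Γ, x + (u : ι → ℝ) ∈ Γ → 0 ≤ v u}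

/-- The (relatively open) cone of all `v ∈ U_Γ^*` with the support face `F`. -/
def normalCone {ι : Type*} (Γ F : Set (ι → ℝ)) : Set (DualSpace Γ) :=
  {v | supportFace Γ v = F}

/-- The `d`-th dual fan `[Γ]^d`: the weight of `v ∈ U_Γ^*` is the lattice volume of the support
face `Γ^v` if this face is bounded and `d`-dimensional. -/
def dualFan {ι : Type*} [Fintype ι] (Γ : Set (ι → ℝ)) (d : ℕ) : Set (DualSpace Γ) →₀ ℝ :=
  ∑ᶠ F ∈ {F : Set (ι → ℝ) | IsFace Γ F ∧ Bornology.IsBounded F ∧ dim F = d},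
    Finsupp.single (normalCone Γ F) (latticeVolume F)

/-- The codimension `d` component `(-1)^(d-1) [Γ]^d` of the class `⟨Γ⟩`, `d ≥ 0`. -/
def charClass {ι : Type*} [Fintype ι] (Γ : Set (ι → ℝ)) (d : ℕ) : Set (DualSpace Γ) →₀ ℝ :=
  ((-1 : ℝ) ^ (d + 1)) • dualFan Γ d

/-- The natural projection `U_Γ^* → (ℝ^I)^*`, the restriction of linear functions to `ℝ^I ⊆ U_Γ`,
written in the coordinates of `(ℝ^I)^*`. (For a `V_I`-face `Γ`, the inclusion holds and all the
basis vectors `e_i`, `i ∈ I`, are in `U_Γ`.) -/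
def restrictDual {ι : Type*} [DecidableEq ι] (I : Finset ι) (Γ : Set (ι → ℝ)) :
    DualSpace Γ →ₗ[ℝ] (I → ℝ) :=
  open Classical in
  LinearMap.pi fun i : I =>
    if h : (Pi.single (i : ι) (1 : ℝ) : ι → ℝ) ∈ vectorSpan ℝ Γ then
      Module.Dual.eval ℝ (vectorSpan ℝ Γ) ⟨Pi.single (i : ι) (1 : ℝ), h⟩
    else 0

/-- The codimension `d` component, `d ≤ |I|`, of the fan `Φ_{m,I} = ∑ π_* ⟨Γ⟩`, the sum over all
`V_I`-faces `Γ` of `N` whose lattice distance to `0` is divisible by `m`. The direct image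
preserves the dimension of fans, so the component of codimension `d` in `(ℝ^I)^*` comes from the
component of `⟨Γ⟩` of codimension `d + dim Γ - |I|` in `U_Γ^*`. -/
def tropicalClass {ι : Type*} [Fintype ι] [DecidableEq ι] (N : Set (ι → ℝ)) (I : Finset ι)
    (m d : ℕ) : Set (I → ℝ) →₀ ℝ :=
  ∑ᶠ Γ ∈ {Γ : Set (ι → ℝ) | ∃ J : Finset ι, IsVFace I J N Γ ∧ m ∣ latticeDist J Γ},
    pushforward (dualLattice Γ) (restrictDual I Γ) (charClass Γ (d + dim Γ - I.card))

end Fans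

section Eigenvalues

/-- Tautological denominators: the divisors of the multiplicities of the prime factors of a
non-degenerate germ `f`, `f(0) = 0`, with the Newton polyhedron `N`. Such a germ is a monomial
times a germ without multiple factors and without monomial factors, so the multiplicities are `1`
and the non-zero ones of the minimal values `a_i` of the coordinates on `N`. -/
def IsTautologicalDenominator {ι : Type*} (N : Set (ι → ℝ)) (m : ℕ) : Prop :=
  m = 1 ∨ ∃ (i : ι) (a : ℕ), 0 < a ∧ IsLeast ((fun x : ι → ℝ => x i) '' N) (a : ℝ) ∧ m ∣ a

/-- `s` is a tropical nearby monodromy eigenvalue of `N` in codimension `d` at the coordinate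
torus `(ℂ∖0)^I`. -/
def IsTropicalNearbyEigenvalue {ι : Type*} [Fintype ι] [DecidableEq ι] (N : Set (ι → ℝ))
    (I : Finset ι) (d : ℕ) (s : ℂ) : Prop :=
  ∃ (k : ℤ) (m : ℕ), 0 < m ∧ IsCoprime k (m : ℤ) ∧
    s = Complex.exp (2 * (Real.pi : ℂ) * Complex.I * (k : ℂ) / (m : ℂ)) ∧
    ¬ IsTautologicalDenominator N m ∧ d ≤ I.card ∧ ¬ IsZeroFan d (tropicalClass N I m d)

/-- A face `B` of `P` contributes the eigenvalues with the denominator `m`, if it is a bounded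
`V`-face whose lattice distance to `0` is divisible by `m`. -/
def Contributes {ι : Type*} (P : Set (ι → ℝ)) (m : ℕ) (B : Set (ι → ℝ)) : Prop :=
  ∃ J : Finset ι, IsVFace ∅ J P B ∧ m ∣ latticeDist J B

/-- Bounded edges of a polyhedron. -/
def IsBoundedEdge {ι : Type*} (P E : Set (ι → ℝ)) : Prop :=
  IsFace P E ∧ Bornology.IsBounded E ∧ dim E = 1

/-- The fiber `N_b` of `N` over the point `b` of the projection of `N` along `ℝ^I` is trivial,
i.e. is a shifted copy of the positive orthant of `ℝ^I`. -/
def HasTrivialFiber {ι : Type*} (N : Set (ι → ℝ)) (I : Finset ι) (b : {i // i ∉ I} → ℝ) : Prop :=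
  ∃ c : ι → ℝ, {x | x ∈ N ∧ projAlong I x = b} =
    {x | projAlong I x = b ∧ ∀ i ∈ I, c i ≤ x i}

end Eigenvalues

end TropicalMonodromy

end

/-!
# Tropical nearby monodromy eigenvalues over a polygon

Every Newton polyhedron is `orthantHull C I = conv(C) + ℝ^I_{≥0}`, and so are its faces, the set `C`
being replaced with the set of minimizers of a linear function in `C`. As a consequence, the
`V_I`-faces of `N` are the preimages of the contributing faces of the projection `P` of `N` along
`ℝ^I`, with the same lattice distance to the origin (`isVFace_liftFace_iff`, `vFaces_eq_image`). As
`P` is a polygon, a contributing face is a vertex on a coordinate axis, or a bounded edge.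

The weight of `Φ_{m,I}` at `v` is then a sum over the contributing faces (`weightAt_tropicalClass`).
It vanishes unless all coordinates of `v` are positive. Denote by `φ_b(v)` the lattice length of
the face of the fiber `N_b` at which `v` is minimal (`fiberLength`).

* A vertex `a` adds `-1` in codimension `0` and `φ_a(v)` in codimension `1`.
* An edge with the lattice points `b_0, …, b_L` adds `L` in codimension `0` and
  `-∑_{k<L} (φ_{b_k}(v) + φ_{b_{k+1}}(v))` in codimension `1` (`exists_generic_edge_zero`,
  `exists_generic_edge_one`).

For the edges, the linear functions with the restriction `v` to `ℝ^I` form a line. The faces at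
which the functions on this line are minimal, and which are not contained in one fiber, cover the
edge: over every unit interval of the edge there is exactly one of them, because the lower convex
hull of finitely many points has one chord over the interval (`exists_supporting_chord`). If such a
face is a segment, then its lattice length times the lattice index in the direct image is the length
of its projection to the edge. If it is a polygon, then it is a union of trapezoids between its
sections over the lattice points of the edge, so that its lattice area is the sum of the terms
above (`volume_of_trapezoids`, `exists_sections_of_polygon`).

In codimension `0`, the class vanishes if and only if the total lattice length of the contributing
edges is the number of the contributing vertices (`isZeroFan_zero_iff`). There is at most one
contributing vertex on each axis, and if `m` divides the lattice distance to a vertex, then it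
divides the one to its adjacent bounded edge. If both axes have contributing vertices on the same
edge, then this edge is the only bounded one. This leaves four configurations
(`classification_of_sum_eq_zero`). In each of them the terms `φ` for the vertices cancel in
codimension `1`, and what remains is a combination, with negative coefficients, of the numbers
`φ_b(v) ≥ 0` for the lattice points `b` from the statement. It vanishes for generic `v` if and only
if all these fibers `N_b` are trivial (`hasTrivialFiber_iff`): if two positive functions had different
minimal points on a fiber, then on a generic segment between these functions there would be one
with an edge as the minimal face (`exists_least_of_unique_minimizers`).
-/

namespace TropicalMonodromy

/-! ### Polyhedra with a coordinate recession cone -/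

section OrthantHull

variable {ι : Type*} [Fintype ι]

/-- The polyhedron `conv(C) + ℝ^I_{≥0}`. -/
def orthantHull (C : Set (ι → ℝ)) (I : Set ι) : Set (ι → ℝ) :=
  {x | ∃ y ∈ convexHull ℝ C, (∀ i ∈ I, y i ≤ x i) ∧ ∀ i ∉ I, y i = x i}

/-- The points of `Γ` at which the linear function `x ↦ h ⬝ᵥ x` is minimal. -/
def minFace (Γ : Set (ι → ℝ)) (h : ι → ℝ) : Set (ι → ℝ) :=
  {x | x ∈ Γ ∧ ∀ y ∈ Γ, h ⬝ᵥ x ≤ h ⬝ᵥ y}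

omit [Fintype ι] in
lemma orthantHull_empty (C : Set (ι → ℝ)) : orthantHull C ∅ = convexHull ℝ C := by
  ext x
  constructor
  · rintro ⟨y, hy, -, h⟩
    have : y = x := funext fun i => h i (by simp)
    exact this ▸ hy
  · intro hx
    exact ⟨x, hx, by simp, by simp⟩

omit [Fintype ι] in
lemma convexHull_subset_orthantHull (C : Set (ι → ℝ)) (I : Set ι) :
    convexHull ℝ C ⊆ orthantHull C I :=
  fun x hx => ⟨x, hx, fun _ _ => le_rfl, fun _ _ => rfl⟩

omit [Fintype ι] in
lemma subset_orthantHull (C : Set (ι → ℝ)) (I : Set ι) : C ⊆ orthantHull C I :=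
  (subset_convexHull ℝ C).trans (convexHull_subset_orthantHull C I)

omit [Fintype ι] in
lemma orthantHull_nonempty {C : Set (ι → ℝ)} (I : Set ι) (h : C.Nonempty) :
    (orthantHull C I).Nonempty :=
  h.mono (subset_orthantHull C I)

omit [Fintype ι] in
lemma nonempty_of_orthantHull {C : Set (ι → ℝ)} {I : Set ι} (h : (orthantHull C I).Nonempty) :
    C.Nonempty := by
  obtain ⟨x, y, hy, -⟩ := h
  exact convexHull_nonempty_iff.1 ⟨y, hy⟩

omit [Fintype ι] in
lemma convex_orthantHull (C : Set (ι → ℝ)) (I : Set ι) : Convex ℝ (orthantHull C I) := by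
  rintro x ⟨y, hy, h1, h2⟩ x' ⟨y', hy', h1', h2'⟩ a b ha hb hab
  refine ⟨a • y + b • y', convex_convexHull ℝ C hy hy' ha hb hab, fun i hi => ?_, fun i hi => ?_⟩
  · simp only [Pi.add_apply, Pi.smul_apply, smul_eq_mul]
    gcongr
    · exact h1 i hi
    · exact h1' i hi
  · simp [h2 i hi, h2' i hi]

omit [Fintype ι] in
/-- An orthant hull is closed under moving up along the coordinates in `I`. -/
lemma orthantHull_up {C : Set (ι → ℝ)} {I : Set ι} {x z : ι → ℝ} (hx : x ∈ orthantHull C I)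
    (h1 : ∀ i ∈ I, x i ≤ z i) (h2 : ∀ i ∉ I, x i = z i) : z ∈ orthantHull C I := by
  obtain ⟨y, hy, g1, g2⟩ := hx
  exact ⟨y, hy, fun i hi => (g1 i hi).trans (h1 i hi), fun i hi => (g2 i hi).trans (h2 i hi)⟩

omit [Fintype ι] in
lemma orthantHull_add_single [DecidableEq ι] {C : Set (ι → ℝ)} {I : Set ι} {x : ι → ℝ}
    (hx : x ∈ orthantHull C I) {i : ι} (hi : i ∈ I) {s : ℝ} (hs : 0 ≤ s) :
    x + Pi.single i s ∈ orthantHull C I := by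
  refine orthantHull_up hx (fun j _ => ?_) (fun j hj => ?_)
  · by_cases h : j = i
    · subst h; simp [hs]
    · simp [h]
  · have : j ≠ i := fun h => hj (h ▸ hi)
    simp [this]

/-- A linear function is at least its minimal value on the generators of a convex hull. -/
lemma le_dotProduct_of_mem_convexHull {C : Set (ι → ℝ)} {h : ι → ℝ} {c : ℝ}
    (hc : ∀ a ∈ C, c ≤ h ⬝ᵥ a) {x : ι → ℝ} (hx : x ∈ convexHull ℝ C) : c ≤ h ⬝ᵥ x := by
  have hconv : Convex ℝ {x : ι → ℝ | c ≤ h ⬝ᵥ x} := by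
    intro x hx y hy a b ha hb hab
    simp only [Set.mem_ofPred_eq, dotProduct_add, dotProduct_smul, smul_eq_mul] at *
    calc c = a * c + b * c := by rw [← add_mul, hab, one_mul]
      _ ≤ _ := by gcongr
  exact convexHull_min (s := C) (fun a ha => hc a ha) hconv hx

lemma dotProduct_const_of_mem_convexHull {C : Set (ι → ℝ)} {h : ι → ℝ} {c : ℝ}
    (hc : ∀ a ∈ C, h ⬝ᵥ a = c) {x : ι → ℝ} (hx : x ∈ convexHull ℝ C) : h ⬝ᵥ x = c := by
  apply le_antisymm
  · have := le_dotProduct_of_mem_convexHull (C := C) (h := -h) (c := -c)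
      (fun a ha => by simp [hc a ha]) hx
    simpa using this
  · exact le_dotProduct_of_mem_convexHull (fun a ha => (hc a ha).ge) hx

/-- The points of a convex hull at which a linear function attains its minimal value over the
generators are in the convex hull of the generators at which it does. -/
lemma mem_convexHull_of_dotProduct_eq {C : Set (ι → ℝ)} {h : ι → ℝ} {c : ℝ}
    (hc : ∀ a ∈ C, c ≤ h ⬝ᵥ a) {x : ι → ℝ} (hx : x ∈ convexHull ℝ C) (hxc : h ⬝ᵥ x = c) :
    x ∈ convexHull ℝ {a ∈ C | h ⬝ᵥ a = c} := by
  classical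
  rw [convexHull_eq_union_convexHull_finite_subsets] at hx
  simp only [Set.mem_iUnion] at hx
  obtain ⟨t, htC, hx⟩ := hx
  rw [Finset.mem_convexHull'] at hx
  obtain ⟨w, hw0, hw1, hwx⟩ := hx
  have hsum : ∑ y ∈ t, w y * (h ⬝ᵥ y - c) = 0 := by
    have : h ⬝ᵥ x = ∑ y ∈ t, w y * (h ⬝ᵥ y) := by
      rw [← hwx, dotProduct_sum]
      simp
    simp_rw [mul_sub]
    rw [Finset.sum_sub_distrib, ← this, ← Finset.sum_mul, hw1, hxc]
    ring
  have hz := (Finset.sum_eq_zero_iff_of_nonneg (fun y hy =>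
    mul_nonneg (hw0 y hy) (sub_nonneg.2 (hc y (htC hy))))).1 hsum
  have hsub : ∀ y ∈ t, w y ≠ 0 → y ∈ {a ∈ C | h ⬝ᵥ a = c} := by
    intro y hy hwy
    refine ⟨htC hy, ?_⟩
    have := (mul_eq_zero.1 (hz y hy)).resolve_left hwy
    linarith
  rw [← hwx]
  have hfil : ∑ y ∈ t, w y • y = ∑ y ∈ t with w y ≠ 0, w y • y := by
    rw [Finset.sum_filter_of_ne]
    intro y _ hy h0
    exact hy (by simp [h0])
  have hfil1 : ∑ y ∈ t with w y ≠ 0, w y = 1 := by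
    rw [Finset.sum_filter_of_ne, hw1]
    intro y _ hy; exact hy
  rw [hfil]
  refine (convex_convexHull ℝ _).sum_mem (fun y hy => hw0 y (Finset.mem_filter.1 hy).1) hfil1
    (fun y hy => subset_convexHull ℝ _ ?_)
  exact hsub y (Finset.mem_filter.1 hy).1 (Finset.mem_filter.1 hy).2

/-- Moving up along non-negative coordinates of `h` does not decrease `h`, and increases it, unless
the move is along the zero coordinates of `h`. -/
lemma dotProduct_le_of_up {I : Set ι} {h x y : ι → ℝ} (h0 : ∀ i ∈ I, 0 ≤ h i)
    (h1 : ∀ i ∈ I, y i ≤ x i) (h2 : ∀ i ∉ I, y i = x i) : h ⬝ᵥ y ≤ h ⬝ᵥ x := by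
  unfold dotProduct
  refine Finset.sum_le_sum fun i _ => ?_
  by_cases hi : i ∈ I
  · exact mul_le_mul_of_nonneg_left (h1 i hi) (h0 i hi)
  · rw [h2 i hi]

lemma eq_of_dotProduct_eq_of_up {I : Set ι} {h x y : ι → ℝ} (h0 : ∀ i ∈ I, 0 ≤ h i)
    (h1 : ∀ i ∈ I, y i ≤ x i) (h2 : ∀ i ∉ I, y i = x i) (he : h ⬝ᵥ y = h ⬝ᵥ x) (i : ι)
    (hi : ¬ (i ∈ I ∧ h i = 0)) : y i = x i := by
  by_cases hiI : i ∈ I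
  · have hne : h i ≠ 0 := fun h' => hi ⟨hiI, h'⟩
    unfold dotProduct at he
    have := (Finset.sum_eq_sum_iff_of_le (fun j _ => by
      by_cases hj : j ∈ I
      · exact mul_le_mul_of_nonneg_left (h1 j hj) (h0 j hj)
      · rw [h2 j hj])).1 he i (Finset.mem_univ i)
    exact mul_left_cancel₀ hne this
  · exact h2 i hiI

/-- The face of an orthant hull on which `h ≥ 0` is minimal is again an orthant hull: of the
generators minimizing `h`, along the coordinates on which `h` vanishes. -/
lemma minFace_orthantHull {C : Set (ι → ℝ)} {I : Set ι} {h : ι → ℝ} (hC : C.Finite)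
    (h0 : ∀ i ∈ I, 0 ≤ h i) :
    minFace (orthantHull C I) h = orthantHull (minFace C h) {i ∈ I | h i = 0} := by
  rcases C.eq_empty_or_nonempty with rfl | hne
  · ext x
    constructor
    · rintro ⟨⟨y, hy, -⟩, -⟩
      simp at hy
    · rintro ⟨y, hy, -⟩
      simp [minFace] at hy
  obtain ⟨a₀, ha₀, hmin⟩ := Set.exists_min_image C (fun a => h ⬝ᵥ a) hC hne
  have hCmin : minFace C h = {a ∈ C | h ⬝ᵥ a = h ⬝ᵥ a₀} := by
    ext a
    constructor
    · rintro ⟨ha, hh⟩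
      exact ⟨ha, le_antisymm (hh a₀ ha₀) (hmin a ha)⟩
    · rintro ⟨ha, hh⟩
      exact ⟨ha, fun b hb => by rw [hh]; exact hmin b hb⟩
  have hle : ∀ x ∈ orthantHull C I, h ⬝ᵥ a₀ ≤ h ⬝ᵥ x := by
    rintro x ⟨y, hy, h1, h2⟩
    exact (le_dotProduct_of_mem_convexHull hmin hy).trans (dotProduct_le_of_up h0 h1 h2)
  rw [hCmin]
  ext x
  constructor
  · rintro ⟨⟨y, hy, h1, h2⟩, hx⟩
    have e1 : h ⬝ᵥ x ≤ h ⬝ᵥ a₀ := hx a₀ (subset_orthantHull C I ha₀)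
    have e2 := le_dotProduct_of_mem_convexHull hmin hy
    have e3 := dotProduct_le_of_up h0 h1 h2
    refine ⟨y, mem_convexHull_of_dotProduct_eq hmin hy (by linarith), fun i hi => h1 i hi.1,
      fun i hi => eq_of_dotProduct_eq_of_up h0 h1 h2 (by linarith) i hi⟩
  · rintro ⟨y, hy, h1, h2⟩
    have hyx : h ⬝ᵥ y = h ⬝ᵥ x := by
      unfold dotProduct
      refine Finset.sum_congr rfl fun i _ => ?_
      by_cases hi : i ∈ {i ∈ I | h i = 0}
      · rw [hi.2]; simp
      · rw [h2 i hi]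
    have hy0 : h ⬝ᵥ y = h ⬝ᵥ a₀ := dotProduct_const_of_mem_convexHull (fun a ha => ha.2) hy
    refine ⟨⟨y, convexHull_mono (fun a ha => ha.1) hy, fun i hi => ?_, fun i hi =>
      h2 i fun h' => hi h'.1⟩, fun z hz => ?_⟩
    · by_cases hi' : i ∈ {i ∈ I | h i = 0}
      · exact h1 i hi'
      · exact (h2 i hi').le
    · rw [← hyx, hy0]; exact hle z hz

lemma nonneg_of_minFace_nonempty {C : Set (ι → ℝ)} {I : Set ι} {h : ι → ℝ}
    (hne : (minFace (orthantHull C I) h).Nonempty) : ∀ i ∈ I, 0 ≤ h i := by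
  classical
  intro i hi
  obtain ⟨x, hx, hmin⟩ := hne
  have := hmin _ (orthantHull_add_single hx hi zero_le_one)
  simpa [dotProduct_add] using this

lemma minFace_nonempty_of_finite {C : Set (ι → ℝ)} (h : ι → ℝ) (hC : C.Finite)
    (hne : C.Nonempty) : (minFace C h).Nonempty := by
  obtain ⟨a₀, ha₀, hmin⟩ := Set.exists_min_image C (fun a => h ⬝ᵥ a) hC hne
  exact ⟨a₀, ha₀, hmin⟩

lemma minFace_orthantHull_nonempty {C : Set (ι → ℝ)} {I : Set ι} {h : ι → ℝ} (hC : C.Finite)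
    (hne : C.Nonempty) (h0 : ∀ i ∈ I, 0 ≤ h i) : (minFace (orthantHull C I) h).Nonempty := by
  rw [minFace_orthantHull hC h0]
  exact orthantHull_nonempty _ (minFace_nonempty_of_finite h hC hne)

omit [Fintype ι] in
lemma isBounded_eval_image_orthantHull {C : Set (ι → ℝ)} {I : Set ι} (hC : C.Finite)
    (hne : C.Nonempty) (i : ι) :
    Bornology.IsBounded ((fun x => x i) '' orthantHull C I) ↔ i ∉ I := by
  classical
  constructor
  · intro hb hi
    obtain ⟨a, ha⟩ := hne
    obtain ⟨R, hR⟩ := hb.exists_norm_le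
    have hmem := orthantHull_add_single (subset_orthantHull C I ha) hi
      (s := |R| + |a i| + 1) (by positivity)
    have h1 := hR _ ⟨_, hmem, rfl⟩
    simp only [Pi.add_apply, Pi.single_eq_same, Real.norm_eq_abs] at h1
    have := le_abs_self (a i + (|R| + |a i| + 1))
    have := neg_abs_le (a i)
    have := le_abs_self R
    linarith
  · intro hi
    have hsub : (fun x => x i) '' orthantHull C I ⊆ (fun x => x i) '' convexHull ℝ C := by
      rintro _ ⟨x, ⟨y, hy, -, h2⟩, rfl⟩
      exact ⟨y, hy, h2 i hi⟩
    refine Bornology.IsBounded.subset (IsCompact.isBounded ?_) hsub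
    exact (hC.isCompact_convexHull ℝ).image (continuous_apply i)

omit [Fintype ι] in
/-- The recession coordinates of an orthant hull are recovered from its bounded projections. -/
lemma isBounded_projAlong_orthantHull {C : Set (ι → ℝ)} {I : Set ι} (hC : C.Finite)
    (hne : C.Nonempty) (K : Finset ι) :
    Bornology.IsBounded (projAlong K '' orthantHull C I) ↔ I ⊆ K := by
  rw [← Bornology.forall_isBounded_image_eval_iff]
  constructor
  · intro h i hi
    by_contra hiK
    have := h ⟨i, hiK⟩
    rw [Set.image_image] at this
    exact (isBounded_eval_image_orthantHull hC hne i).1 this hi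
  · intro h i
    rw [Set.image_image]
    exact (isBounded_eval_image_orthantHull hC hne i).2 fun hi => i.2 (h hi)

omit [Fintype ι] in
lemma isBounded_orthantHull {C : Set (ι → ℝ)} {I : Set ι} (hC : C.Finite)
    (hne : C.Nonempty) : Bornology.IsBounded (orthantHull C I) ↔ I = ∅ := by
  rw [← Bornology.forall_isBounded_image_eval_iff, Set.eq_empty_iff_forall_notMem]
  exact forall_congr' fun i => isBounded_eval_image_orthantHull hC hne i

/-- Faces are the sets where a linear function is minimal. -/
lemma isFace_iff {Γ F : Set (ι → ℝ)} :
    IsFace Γ F ↔ F.Nonempty ∧ ∃ h : ι → ℝ, F = minFace Γ h := by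
  classical
  have key : ∀ (l : (ι → ℝ) →ₗ[ℝ] ℝ) (x : ι → ℝ), l x = (fun i => l (Pi.single i 1)) ⬝ᵥ x := by
    intro l x
    conv_lhs => rw [pi_eq_sum_univ' x, map_sum]
    simp only [map_smul, smul_eq_mul, dotProduct]
    refine Finset.sum_congr rfl fun i _ => ?_
    rw [mul_comm]
  constructor
  · rintro ⟨hne, hF⟩
    refine ⟨hne, ?_⟩
    obtain ⟨l, hl⟩ := hF hne
    refine ⟨-fun i => l (Pi.single i 1), ?_⟩
    rw [hl]
    ext x
    simp only [minFace, neg_dotProduct, Set.mem_ofPred_eq, neg_le_neg_iff]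
    have hk : ∀ x, l x = (fun i => l (Pi.single i 1)) ⬝ᵥ x := key l.toLinearMap
    simp_rw [← hk]
  · rintro ⟨hne, h, rfl⟩
    refine ⟨hne, fun _ => ?_⟩
    refine ⟨-(LinearMap.toContinuousLinearMap (dotProductBilin ℝ ℝ h)), ?_⟩
    ext x
    simp [minFace, dotProductBilin]

/-- Bounded faces of an orthant hull: they are polytopes spanned by generators, and are
supported by functions which are positive on the orthant. -/
lemma bounded_face_orthantHull {C : Set (ι → ℝ)} {I : Set ι} {h : ι → ℝ} (hC : C.Finite)
    (hne : (minFace (orthantHull C I) h).Nonempty)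
    (hb : Bornology.IsBounded (minFace (orthantHull C I) h)) :
    (∀ i ∈ I, 0 < h i) := by
  have h0 := nonneg_of_minFace_nonempty hne
  rw [minFace_orthantHull hC h0] at hb hne
  rw [isBounded_orthantHull (hC.subset fun a ha => ha.1) (nonempty_of_orthantHull hne)] at hb
  intro i hi
  refine lt_of_le_of_ne (h0 i hi) fun h' => ?_
  have : i ∈ {i ∈ I | h i = 0} := ⟨hi, h'.symm⟩
  rw [hb] at this
  exact this

lemma minFace_orthantHull_of_pos {C : Set (ι → ℝ)} {I : Set ι} {h : ι → ℝ} (hC : C.Finite)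
    (h0 : ∀ i ∈ I, 0 < h i) :
    minFace (orthantHull C I) h = convexHull ℝ (minFace C h) := by
  rw [minFace_orthantHull hC fun i hi => (h0 i hi).le, ← orthantHull_empty]
  congr 1
  ext i
  simp only [Set.mem_ofPred_eq, Set.mem_empty_iff_false, iff_false, not_and]
  exact fun hi => (h0 i hi).ne'

lemma isBounded_minFace_of_pos {C : Set (ι → ℝ)} {I : Set ι} {h : ι → ℝ} (hC : C.Finite)
    (h0 : ∀ i ∈ I, 0 < h i) : Bornology.IsBounded (minFace (orthantHull C I) h) := by
  rw [minFace_orthantHull_of_pos hC h0]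
  exact (Set.Finite.isCompact_convexHull ℝ (hC.subset fun a (ha : a ∈ minFace C h) => ha.1)).isBounded

lemma minFace_inter (Γ : Set (ι → ℝ)) (C : Set (ι → ℝ)) (h : ι → ℝ) (hCΓ : C ⊆ Γ)
    (hne : (minFace Γ h ∩ C).Nonempty) : minFace C h = C ∩ minFace Γ h := by
  obtain ⟨x₀, hx₀, hx₀C⟩ := hne
  ext x
  constructor
  · rintro ⟨hx, hmin⟩
    exact ⟨hx, hCΓ hx, fun y hy => (hmin x₀ hx₀C).trans (hx₀.2 y hy)⟩
  · rintro ⟨hx, hmin⟩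
    exact ⟨hx, fun y hy => hmin.2 y (hCΓ hy)⟩

lemma face_inter_generators {C : Set (ι → ℝ)} {I : Set ι} {h : ι → ℝ} (hC : C.Finite)
    (hne : (minFace (orthantHull C I) h).Nonempty) :
    minFace C h = C ∩ minFace (orthantHull C I) h := by
  refine minFace_inter _ _ _ (subset_orthantHull C I) ?_
  have h0 := nonneg_of_minFace_nonempty hne
  rw [minFace_orthantHull hC h0] at hne ⊢
  obtain ⟨a, ha⟩ := nonempty_of_orthantHull hne
  exact ⟨a, subset_orthantHull _ _ ha, ha.1⟩

/-- An orthant hull of a finite set has finitely many faces. -/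
lemma finite_faces {C : Set (ι → ℝ)} {I : Set ι} (hC : C.Finite) :
    {F | IsFace (orthantHull C I) F}.Finite := by
  have hfin : (Set.image2 (fun D K => orthantHull D K) (𝒫 C) (𝒫 (Set.univ : Set ι))).Finite :=
    Set.Finite.image2 _ hC.finite_subsets (Set.toFinite _)
  refine hfin.subset ?_
  intro F hF
  obtain ⟨hne, h, rfl⟩ := isFace_iff.1 hF
  refine ⟨minFace C h, fun a ha => ha.1, {i ∈ I | h i = 0}, fun _ _ => trivial, ?_⟩
  exact (minFace_orthantHull hC (nonneg_of_minFace_nonempty hne)).symm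

end OrthantHull

/-! ### Dual fans and direct images -/

section DualSpace

variable {ι : Type*} [Fintype ι]

/-- The restriction of the linear function `x ↦ h ⬝ᵥ x` to the space `U_Γ`. -/
def dualOf (Γ : Set (ι → ℝ)) (h : ι → ℝ) : DualSpace Γ :=
  (dotProductBilin ℝ ℝ h).comp (vectorSpan ℝ Γ).subtype

@[simp]
lemma dualOf_apply (Γ : Set (ι → ℝ)) (h : ι → ℝ) (u : vectorSpan ℝ Γ) :
    dualOf Γ h u = h ⬝ᵥ (u : ι → ℝ) := rfl

lemma exists_eq_dualOf (Γ : Set (ι → ℝ)) (v : DualSpace Γ) : ∃ h, v = dualOf Γ h := by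
  classical
  obtain ⟨l, hl⟩ := LinearMap.exists_extend v
  refine ⟨fun i => l (Pi.single i 1), ?_⟩
  ext u
  rw [← hl, dualOf_apply, LinearMap.comp_apply, Submodule.subtype_apply]
  conv_lhs => rw [pi_eq_sum_univ' (u : ι → ℝ), map_sum]
  simp only [map_smul, smul_eq_mul, dotProduct]
  refine Finset.sum_congr rfl fun i _ => ?_
  rw [mul_comm]

lemma supportFace_dualOf (Γ : Set (ι → ℝ)) (h : ι → ℝ) :
    supportFace Γ (dualOf Γ h) = minFace Γ h := by
  ext x
  constructor
  · rintro ⟨hx, hmin⟩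
    refine ⟨hx, fun y hy => ?_⟩
    have := hmin ⟨y - x, vsub_mem_vectorSpan ℝ hy hx⟩ (by simpa using hy)
    simpa [dotProduct_sub] using this
  · rintro ⟨hx, hmin⟩
    refine ⟨hx, fun u hu => ?_⟩
    have := hmin _ hu
    simpa [dotProduct_add] using this

/-- The linear functions on `U_Γ` which are constant on `F`. -/
def faceAnnihilator (Γ F : Set (ι → ℝ)) : Submodule ℝ (DualSpace Γ) :=
  ((vectorSpan ℝ F).comap (vectorSpan ℝ Γ).subtype).dualAnnihilator

omit [Fintype ι] in
lemma mem_faceAnnihilator {Γ F : Set (ι → ℝ)} {w : DualSpace Γ} :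
    w ∈ faceAnnihilator Γ F ↔ ∀ u : vectorSpan ℝ Γ, (u : ι → ℝ) ∈ vectorSpan ℝ F → w u = 0 := by
  simp [faceAnnihilator, Submodule.mem_dualAnnihilator]

lemma finrank_faceAnnihilator {Γ F : Set (ι → ℝ)} (hF : F ⊆ Γ) :
    dim F + Module.finrank ℝ (faceAnnihilator Γ F) = dim Γ := by
  have h1 := Subspace.finrank_add_finrank_dualAnnihilator_eq
    ((vectorSpan ℝ F).comap (vectorSpan ℝ Γ).subtype)
  have h2 := (Submodule.comapSubtypeEquivOfLe (vectorSpan_mono ℝ hF)).finrank_eq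
  unfold dim faceAnnihilator
  rw [← h1, h2]

/-- The normal cone of a bounded face `F` is open in the space of functions constant on `F`. -/
lemma span_normalCone {C : Set (ι → ℝ)} {I : Set ι} (hC : C.Finite) {F : Set (ι → ℝ)}
    (hF : IsFace (orthantHull C I) F) (hb : Bornology.IsBounded F) :
    Submodule.span ℝ (normalCone (orthantHull C I) F) = faceAnnihilator (orthantHull C I) F := by
  set Γ := orthantHull C I
  obtain ⟨hne, h, rfl⟩ := isFace_iff.1 hF
  have hpos := bounded_face_orthantHull hC hne hb
  apply le_antisymm
  · rw [Submodule.span_le]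
    intro v hv
    obtain ⟨g, rfl⟩ := exists_eq_dualOf Γ v
    have hv' : minFace Γ g = minFace Γ h := by rw [← supportFace_dualOf]; exact hv
    rw [SetLike.mem_coe, mem_faceAnnihilator]
    rintro ⟨u, hu⟩ huF
    simp only [dualOf_apply] at huF ⊢
    have hle : vectorSpan ℝ (minFace Γ h) ≤ LinearMap.ker (dotProductBilin ℝ ℝ g) := by
      rw [vectorSpan_def, Submodule.span_le]
      rintro _ ⟨x, hx, y, hy, rfl⟩
      rw [← hv'] at hx hy
      simp only [vsub_eq_sub, SetLike.mem_coe, LinearMap.mem_ker]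
      change g ⬝ᵥ (x - y) = 0
      rw [dotProduct_sub, sub_eq_zero]
      exact le_antisymm (hx.2 y hy.1) (hy.2 x hx.1)
    exact hle huF
  · intro w hw
    obtain ⟨g, rfl⟩ := exists_eq_dualOf Γ w
    -- `h + ε g` has the same support face as `h` for small `ε`
    have hev1 : ∀ᶠ ε : ℝ in nhdsWithin 0 (Set.Ioi 0), ∀ i ∈ (Finset.univ : Finset ι), i ∈ I →
        0 < (h + ε • g) i := by
      rw [Filter.eventually_all_finset]
      intro i _
      rw [Filter.eventually_imp_distrib_left]
      intro hi
      have hc : Continuous fun ε : ℝ => (h + ε • g) i := by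
        simp only [Pi.add_apply, Pi.smul_apply, smul_eq_mul]; fun_prop
      have h0 : (0 : ℝ) < (h + (0 : ℝ) • g) i := by simpa using hpos i hi
      exact (hc.continuousAt.eventually (lt_mem_nhds h0)).filter_mono nhdsWithin_le_nhds
    have hCF := face_inter_generators hC hne
    obtain ⟨a₀, ha₀⟩ : (minFace C h).Nonempty := by
      obtain ⟨x, hx⟩ := hne
      have : C.Nonempty := nonempty_of_orthantHull ⟨x, hx.1⟩
      exact minFace_nonempty_of_finite h hC this
    have hev2 : ∀ᶠ ε : ℝ in nhdsWithin 0 (Set.Ioi 0), ∀ a ∈ hC.toFinset, a ∉ minFace C h →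
        (h + ε • g) ⬝ᵥ a₀ < (h + ε • g) ⬝ᵥ a := by
      rw [Filter.eventually_all_finset]
      intro a ha
      rw [Filter.eventually_imp_distrib_left]
      intro haF
      have hlt : h ⬝ᵥ a₀ < h ⬝ᵥ a := by
        by_contra hcon
        exact haF ⟨hC.mem_toFinset.1 ha, fun b hb => (not_lt.1 hcon).trans (ha₀.2 b hb)⟩
      have hc : Continuous fun ε : ℝ => (h + ε • g) ⬝ᵥ a - (h + ε • g) ⬝ᵥ a₀ := by
        simp only [add_dotProduct, smul_dotProduct, smul_eq_mul]; fun_prop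
      have h0 : (0 : ℝ) < (h + (0 : ℝ) • g) ⬝ᵥ a - (h + (0 : ℝ) • g) ⬝ᵥ a₀ := by
        simpa using hlt
      filter_upwards [(hc.continuousAt.eventually (lt_mem_nhds h0)).filter_mono
        nhdsWithin_le_nhds] with ε hε
      linarith
    obtain ⟨ε, ⟨h1, h2⟩, hε⟩ := ((hev1.and hev2).and self_mem_nhdsWithin).exists
    have hε' : (0 : ℝ) < ε := hε
    have hgconst : ∀ a ∈ minFace C h, g ⬝ᵥ a = g ⬝ᵥ a₀ := by
      intro a ha
      rw [hCF] at ha ha₀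
      have := mem_faceAnnihilator.1 hw ⟨a - a₀, vsub_mem_vectorSpan ℝ ha.2.1 ha₀.2.1⟩
        (vsub_mem_vectorSpan ℝ ha.2 ha₀.2)
      simpa [dotProduct_sub, sub_eq_zero] using this
    have hsame : minFace C (h + ε • g) = minFace C h := by
      have hval : ∀ a ∈ minFace C h, (h + ε • g) ⬝ᵥ a = (h + ε • g) ⬝ᵥ a₀ := by
        intro a ha
        simp only [add_dotProduct, smul_dotProduct, hgconst a ha]
        rw [le_antisymm (ha.2 a₀ ha₀.1) (ha₀.2 a ha.1)]
      have hmin : ∀ b ∈ C, (h + ε • g) ⬝ᵥ a₀ ≤ (h + ε • g) ⬝ᵥ b := by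
        intro b hb
        by_cases hbF : b ∈ minFace C h
        · exact (hval b hbF).ge
        · exact (h2 b (hC.mem_toFinset.2 hb) hbF).le
      ext a
      constructor
      · rintro ⟨ha, hamin⟩
        by_contra hcon
        exact absurd (hamin a₀ ha₀.1) (not_le.2 (h2 a (hC.mem_toFinset.2 ha) hcon))
      · intro ha
        exact ⟨ha.1, fun b hb => (hval a ha).trans_le (hmin b hb)⟩
    have hmem : dualOf Γ (h + ε • g) ∈ normalCone Γ (minFace Γ h) := by
      change supportFace _ _ = _
      rw [supportFace_dualOf, minFace_orthantHull_of_pos hC fun i hi => h1 i (Finset.mem_univ i) hi,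
        minFace_orthantHull_of_pos hC hpos, hsame]
    have hmem0 : dualOf Γ h ∈ normalCone Γ (minFace Γ h) := supportFace_dualOf Γ h
    have heq : dualOf Γ g = ε⁻¹ • (dualOf Γ (h + ε • g) - dualOf Γ h) := by
      ext u
      simp [add_dotProduct, hε'.ne']
    rw [heq]
    exact Submodule.smul_mem _ _ (Submodule.sub_mem _ (Submodule.subset_span hmem)
      (Submodule.subset_span hmem0))

/-- The bounded faces of dimension `d`. -/
def boundedFaces (Γ : Set (ι → ℝ)) (d : ℕ) : Set (Set (ι → ℝ)) :=
  {F | IsFace Γ F ∧ Bornology.IsBounded F ∧ dim F = d}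

lemma finite_boundedFaces {C : Set (ι → ℝ)} {I : Set ι} (hC : C.Finite) (d : ℕ) :
    (boundedFaces (orthantHull C I) d).Finite :=
  (finite_faces hC).subset fun _ hF => hF.1

end DualSpace

section Weights

lemma weightAt_finset_sum {V α : Type*} (s : Finset α) (f : α → Set V →₀ ℝ) (x : V) :
    weightAt (∑ a ∈ s, f a) x = ∑ a ∈ s, weightAt (f a) x := by
  unfold weightAt
  rw [Finsupp.sum_finsetSum_index]
  · intro P
    by_cases h : x ∈ P <;> simp [h]
  · intro P b c
    by_cases h : x ∈ P <;> simp [h]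

open Classical in
lemma weightAt_single {V : Type*} (P : Set V) (c : ℝ) (x : V) :
    weightAt (Finsupp.single P c) x = if x ∈ P then c else 0 := by
  unfold weightAt
  rw [Finsupp.sum_single_index]
  · rfl
  · by_cases h : x ∈ P <;> simp [h]

lemma weightAt_zero {V : Type*} (x : V) : weightAt (0 : Set V →₀ ℝ) x = 0 := by
  simp [weightAt]

variable {V V' : Type*} [AddCommGroup V] [Module ℝ V] [AddCommGroup V'] [Module ℝ V']

lemma pushforward_finset_sum {α : Type*} (L : AddSubgroup V) (p : V →ₗ[ℝ] V') (s : Finset α)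
    (f : α → Set V →₀ ℝ) :
    pushforward L p (∑ a ∈ s, f a) = ∑ a ∈ s, pushforward L p (f a) := by
  unfold pushforward
  rw [Finsupp.sum_finsetSum_index]
  · intro P
    split_ifs <;> simp
  · intro P b c
    split_ifs
    · rw [add_mul, Finsupp.single_add]
    · simp

open Classical in
lemma pushforward_single (L : AddSubgroup V) (p : V →ₗ[ℝ] V') (P : Set V) (c : ℝ) :
    pushforward L p (Finsupp.single P c) =
      if Module.finrank ℝ ((Submodule.span ℝ P).map p) = Module.finrank ℝ (Submodule.span ℝ P) then
        Finsupp.single (p '' P) (c * (latticeIndex L p (Submodule.span ℝ P) : ℝ)) else 0 := by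
  unfold pushforward
  rw [Finsupp.sum_single_index]
  split_ifs <;> simp

open Classical in
/-- The weight function of the direct image of a dual fan, as a sum over faces. -/
lemma weightAt_pushforward_charClass {ι : Type*} [Fintype ι] {C : Set (ι → ℝ)} {I : Set ι}
    (hC : C.Finite) (d : ℕ) (L : AddSubgroup (DualSpace (orthantHull C I)))
    (p : DualSpace (orthantHull C I) →ₗ[ℝ] V') (x : V') :
    weightAt (pushforward L p (charClass (orthantHull C I) d)) x =
      (-1 : ℝ) ^ (d + 1) * ∑ F ∈ (finite_boundedFaces (I := I) hC d).toFinset,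
        if Module.finrank ℝ ((faceAnnihilator (orthantHull C I) F).map p) =
            Module.finrank ℝ (faceAnnihilator (orthantHull C I) F) ∧
          x ∈ p '' normalCone (orthantHull C I) F then
        latticeVolume F * (latticeIndex L p (faceAnnihilator (orthantHull C I) F) : ℝ) else 0 := by
  have h1 : charClass (orthantHull C I) d =
      ∑ F ∈ (finite_boundedFaces (I := I) hC d).toFinset,
        Finsupp.single (normalCone (orthantHull C I) F) ((-1 : ℝ) ^ (d + 1) * latticeVolume F) := by
    unfold charClass dualFan
    have := finsum_mem_eq_finite_toFinset_sum
      (fun F => Finsupp.single (normalCone (orthantHull C I) F) (latticeVolume F))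
      (finite_boundedFaces (I := I) hC d)
    unfold boundedFaces at this
    rw [this, Finset.smul_sum]
    refine Finset.sum_congr rfl fun F _ => ?_
    rw [Finsupp.smul_single, smul_eq_mul]
  rw [h1, pushforward_finset_sum, weightAt_finset_sum, Finset.mul_sum]
  refine Finset.sum_congr rfl fun F hF => ?_
  have hF' := (Set.Finite.mem_toFinset _).1 hF
  rw [pushforward_single, span_normalCone hC hF'.1 hF'.2.1]
  split_ifs with h2 h3 h3
  · rw [weightAt_single, if_pos h3.2]; ring
  · rw [weightAt_single, if_neg fun h => h3 ⟨h2, h⟩]; simp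
  · exact absurd h3.1 h2
  · simp [weightAt_zero]

end Weights

/-! ### Lattice bases and lattice volumes -/

section Lattice

variable {ι : Type*} [Fintype ι]

omit [Fintype ι] in
@[simp]
lemma intToReal_apply (z : ι → ℤ) (i : ι) : intToReal ι z i = (z i : ℝ) := rfl

lemma intToReal_dotProduct (l z : ι → ℤ) :
    intToReal ι l ⬝ᵥ intToReal ι z = ((l ⬝ᵥ z : ℤ) : ℝ) := by
  simp [dotProduct]

omit [Fintype ι] in
lemma intToReal_injective : Function.Injective (intToReal ι) := by
  intro x y h
  ext i
  have := congrFun h i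
  simpa using this

omit [Fintype ι] in
lemma isLatticePoint_iff {x : ι → ℝ} : IsLatticePoint x ↔ ∃ z : ι → ℤ, x = intToReal ι z :=
  exists_congr fun _ => ⟨fun h => funext h, fun h i => congrFun h i⟩

/-- A non-zero integer vector is a positive multiple of a primitive one, which takes the value `1`
at some integer covector. -/
lemma exists_primitive (z : ι → ℤ) (hz : z ≠ 0) :
    ∃ (f l : ι → ℤ) (g : ℤ), 0 < g ∧ z = g • f ∧ l ⬝ᵥ f = 1 := by
  classical
  -- the values at `z` of the integer covectors form an ideal; its generator is the gcd of the
  -- coordinates of `z`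
  let J : Ideal ℤ := LinearMap.range (dotProductBilin ℤ ℤ z)
  obtain ⟨g₀, hg₀⟩ := (IsPrincipalIdealRing.principal J).principal
  have hmem : ∀ l : ι → ℤ, g₀ ∣ l ⬝ᵥ z := by
    intro l
    have : l ⬝ᵥ z ∈ J := ⟨l, dotProduct_comm z l⟩
    rw [hg₀] at this
    exact Ideal.mem_span_singleton.1 this
  obtain ⟨l₀, hl₀⟩ : ∃ l : ι → ℤ, l ⬝ᵥ z = g₀ := by
    have : g₀ ∈ J := by rw [hg₀]; exact Submodule.mem_span_singleton_self g₀
    obtain ⟨l, hl⟩ := this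
    exact ⟨l, (dotProduct_comm l z).trans hl⟩
  have hg0 : g₀ ≠ 0 := by
    intro h
    apply hz
    ext i
    have := hmem (Pi.single i 1)
    rw [h, zero_dvd_iff] at this
    simpa using this
  obtain ⟨g, hg, hgpos, l, hl⟩ : ∃ g : ℤ, (∀ l : ι → ℤ, g ∣ l ⬝ᵥ z) ∧ 0 < g ∧
      ∃ l : ι → ℤ, l ⬝ᵥ z = g := by
    rcases lt_or_gt_of_ne hg0 with h | h
    · exact ⟨-g₀, fun l => (neg_dvd).2 (hmem l), by omega, -l₀, by simp [hl₀]⟩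
    · exact ⟨g₀, hmem, h, l₀, hl₀⟩
  have hi : ∀ i, g ∣ z i := fun i => by simpa using hg (Pi.single i 1)
  choose f hf using hi
  refine ⟨f, l, g, hgpos, funext hf, ?_⟩
  have hzf : z = g • f := funext hf
  rw [hzf, dotProduct_smul, smul_eq_mul] at hl
  have := mul_left_cancel₀ hgpos.ne' (hl.trans (mul_one g).symm)
  exact this

/-- Integer vectors `w` with dual integer covectors `l` are a lattice basis of the vector space
which they span. -/
noncomputable def dualSystemBasis {k : ℕ} {w l : Fin k → ι → ℤ}
    (hd : ∀ i j, l i ⬝ᵥ w j = if i = j then 1 else 0) {U : Submodule ℝ (ι → ℝ)}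
    (hU : U = Submodule.span ℝ (Set.range fun j => intToReal ι (w j))) :
    Module.Basis (Fin k) ℤ (integerPoints U) :=
  have hw : ∀ j, w j ∈ integerPoints U := fun j => by
    change intToReal ι (w j) ∈ U
    rw [hU]; exact Submodule.subset_span ⟨j, rfl⟩
  Module.Basis.mk (v := fun j => (⟨w j, hw j⟩ : integerPoints U))
    (by
      rw [Fintype.linearIndependent_iff]
      intro c hc i
      have h1 := congrArg (fun z : integerPoints U => l i ⬝ᵥ (z : ι → ℤ)) hc
      simp only [Submodule.coe_sum, Submodule.coe_smul, dotProduct_sum, dotProduct_smul, hd,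
        Submodule.coe_zero, dotProduct_zero] at h1
      simpa using h1)
    (by
      rintro ⟨z, hz⟩ -
      have hz' : intToReal ι z ∈ U := hz
      rw [hU, Submodule.mem_span_range_iff_exists_fun] at hz'
      obtain ⟨c, hc⟩ := hz'
      have hci : ∀ i, c i = ((l i ⬝ᵥ z : ℤ) : ℝ) := by
        intro i
        rw [← intToReal_dotProduct, ← hc, dotProduct_sum]
        simp [intToReal_dotProduct, hd]
      have : (⟨z, hz⟩ : integerPoints U) = ∑ i, (l i ⬝ᵥ z) • (⟨w i, hw i⟩ : integerPoints U) := by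
        apply Subtype.ext
        apply intToReal_injective
        rw [← hc]
        simp only [hci, Submodule.coe_sum, Submodule.coe_smul, map_sum, map_smul]
        refine Finset.sum_congr rfl fun i _ => ?_
        ext; simp
      rw [this]
      exact Submodule.sum_mem _ fun i _ => Submodule.smul_mem _ _ (Submodule.subset_span ⟨i, rfl⟩))

lemma dualSystemBasis_apply {k : ℕ} {w l : Fin k → ι → ℤ}
    (hd : ∀ i j, l i ⬝ᵥ w j = if i = j then 1 else 0) {U : Submodule ℝ (ι → ℝ)}
    (hU : U = Submodule.span ℝ (Set.range fun j => intToReal ι (w j))) (j : Fin k) :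
    ((dualSystemBasis hd hU j : integerPoints U) : ι → ℤ) = w j := by
  unfold dualSystemBasis
  rw [Module.Basis.mk_apply]

lemma finrank_of_dualSystem {k : ℕ} {w l : Fin k → ι → ℤ}
    (hd : ∀ i j, l i ⬝ᵥ w j = if i = j then 1 else 0) {U : Submodule ℝ (ι → ℝ)}
    (hU : U = Submodule.span ℝ (Set.range fun j => intToReal ι (w j))) :
    Module.finrank ℝ U = k := by
  have hli : LinearIndependent ℝ (fun j => intToReal ι (w j)) := by
    rw [Fintype.linearIndependent_iff]
    intro c hc i
    have h1 := congrArg (fun z : ι → ℝ => intToReal ι (l i) ⬝ᵥ z) hc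
    simpa [dotProduct_sum, intToReal_dotProduct, hd] using h1
  rw [hU, finrank_span_eq_card hli, Fintype.card_fin]

/-- The lattice volume can be computed in any lattice basis and from any base point. -/
lemma latticeVolume_eq {k : ℕ} {w l : Fin k → ι → ℤ}
    (hd : ∀ i j, l i ⬝ᵥ w j = if i = j then 1 else 0) {F : Set (ι → ℝ)}
    (hU : vectorSpan ℝ F = Submodule.span ℝ (Set.range fun j => intToReal ι (w j)))
    {x₀ : ι → ℝ} (hx₀ : x₀ ∈ F) :
    latticeVolume F = (k ! : ℝ) *
      (MeasureTheory.volume {t : Fin k → ℝ | x₀ + ∑ j, t j • intToReal ι (w j) ∈ F}).toReal := by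
  classical
  have hne : F.Nonempty := ⟨x₀, hx₀⟩
  set b := dualSystemBasis hd hU with hb
  have hk : Module.finrank ℤ (integerPoints (vectorSpan ℝ F)) = k := by
    rw [Module.finrank_eq_card_basis b, Fintype.card_fin]
  have hbw : ∀ j, ((b j : integerPoints (vectorSpan ℝ F)) : ι → ℤ) = w j :=
    dualSystemBasis_apply hd hU
  unfold latticeVolume
  rw [dif_pos hne]
  generalize hb' : Module.finBasis ℤ (integerPoints (vectorSpan ℝ F)) = b'
  clear hb'
  revert b'
  rw [hk]
  intro b'
  congr 2
  obtain ⟨s, hs⟩ : ∃ s : Fin k → ℝ, ∑ j, s j • intToReal ι (w j) = hne.some - x₀ := by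
    have : hne.some - x₀ ∈ vectorSpan ℝ F := vsub_mem_vectorSpan ℝ hne.some_mem hx₀
    rw [hU] at this
    exact (Submodule.mem_span_range_iff_exists_fun ℝ).1 this
  set M : Matrix (Fin k) (Fin k) ℤ := b.toMatrix b' with hM
  have hdet : IsUnit M.det := by
    have h1 : b.toMatrix b' * b'.toMatrix b = 1 := b.toMatrix_mul_toMatrix_flip b'
    exact Matrix.isUnit_det_of_right_inverse h1
  set f : (Fin k → ℝ) →ₗ[ℝ] (Fin k → ℝ) := Matrix.toLin' (M.map (Int.cast : ℤ → ℝ)) with hf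
  have hfdet : LinearMap.det f = (M.det : ℝ) := by
    rw [hf, LinearMap.det_toLin', ← Int.cast_det]
  have hb'w : ∀ j, intToReal ι ((b' j : integerPoints (vectorSpan ℝ F)) : ι → ℤ) =
      ∑ i, (M i j : ℝ) • intToReal ι (w i) := by
    intro j
    have h1 : ∑ i, M i j • b i = b' j := b.sum_toMatrix_smul_self b' j
    rw [← h1]
    simp only [Submodule.coe_sum, Submodule.coe_smul, map_sum, map_smul, hbw]
    refine Finset.sum_congr rfl fun i _ => ?_
    ext; simp
  have hset : {t : Fin k → ℝ | hne.some + ∑ j, t j •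
        intToReal ι ((b' j : integerPoints (vectorSpan ℝ F)) : ι → ℤ) ∈ F} =
      f ⁻¹' ((fun t => t + s) ⁻¹' {t : Fin k → ℝ | x₀ + ∑ j, t j • intToReal ι (w j) ∈ F}) := by
    ext t
    simp only [Set.mem_ofPred_eq, Set.mem_preimage]
    have : hne.some + ∑ j, t j • intToReal ι ((b' j : integerPoints (vectorSpan ℝ F)) : ι → ℤ) =
        x₀ + ∑ j, (f t + s) j • intToReal ι (w j) := by
      have e1 : ∑ j, t j • intToReal ι ((b' j : integerPoints (vectorSpan ℝ F)) : ι → ℤ) =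
          ∑ i, (f t) i • intToReal ι (w i) := by
        simp_rw [hb'w, Finset.smul_sum]
        rw [Finset.sum_comm]
        refine Finset.sum_congr rfl fun i _ => ?_
        rw [hf, Matrix.toLin'_apply, Matrix.mulVec, dotProduct, Finset.sum_smul]
        refine Finset.sum_congr rfl fun j _ => ?_
        rw [smul_smul, mul_comm]; rfl
      rw [e1]
      simp only [Pi.add_apply, add_smul, Finset.sum_add_distrib, hs]
      abel
    rw [this]
  rw [hset, MeasureTheory.Measure.addHaar_preimage_linearMap, MeasureTheory.measure_preimage_add_right,
    hfdet]
  · rcases Int.isUnit_iff.1 hdet with h | h <;> simp [h]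
  · rw [hfdet]
    rcases Int.isUnit_iff.1 hdet with h | h <;> simp [h]

omit [Fintype ι] in
lemma dim_singleton (x : ι → ℝ) : dim {x} = 0 := by
  simp [dim, vectorSpan_singleton]

lemma latticeVolume_singleton (x : ι → ℝ) : latticeVolume {x} = 1 := by
  rw [latticeVolume_eq (k := 0) (w := Fin.elim0) (l := Fin.elim0) (fun i => i.elim0)
    (by rw [vectorSpan_singleton]; simp [Set.range_eq_empty]) (Set.mem_singleton x)]
  simp [MeasureTheory.volume_pi]

omit [Fintype ι] in
lemma vectorSpan_segment_add (x u : ι → ℝ) {c : ℝ} (hc : c ≠ 0) :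
    vectorSpan ℝ (segment ℝ x (x + c • u)) = Submodule.span ℝ {u} := by
  rw [← convexHull_pair, ← direction_affineSpan, affineSpan_convexHull, direction_affineSpan,
    vectorSpan_pair, vsub_eq_sub, sub_add_cancel_left, ← neg_smul]
  exact Submodule.span_singleton_smul_eq (IsUnit.mk0 _ (neg_ne_zero.2 hc)) u

/-- The lattice length of a segment with a rational direction. -/
lemma dim_latticeVolume_segment {u l : ι → ℤ} (hl : l ⬝ᵥ u = 1) (x : ι → ℝ) {c : ℝ} (hc : 0 < c) :
    dim (segment ℝ x (x + c • intToReal ι u)) = 1 ∧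
    latticeVolume (segment ℝ x (x + c • intToReal ι u)) = c := by
  have hd : ∀ i j : Fin 1, (fun _ : Fin 1 => l) i ⬝ᵥ (fun _ : Fin 1 => u) j =
      if i = j then 1 else 0 := by
    intro i j
    rw [Subsingleton.elim i j]; simp [hl]
  have hU : vectorSpan ℝ (segment ℝ x (x + c • intToReal ι u)) =
      Submodule.span ℝ (Set.range fun j : Fin 1 => intToReal ι ((fun _ : Fin 1 => u) j)) := by
    rw [vectorSpan_segment_add _ _ hc.ne', Set.range_const]
  refine ⟨finrank_of_dualSystem hd hU, ?_⟩
  rw [latticeVolume_eq hd hU (left_mem_segment ℝ _ _)]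
  have hset : {t : Fin 1 → ℝ | x + ∑ j, t j • intToReal ι u ∈ segment ℝ x (x + c • intToReal ι u)} =
      Set.pi Set.univ fun _ => Set.Icc 0 c := by
    ext t
    simp only [Set.mem_ofPred_eq, Finset.univ_unique, Fin.default_eq_zero, Finset.sum_singleton,
      Set.mem_univ_pi]
    rw [segment_eq_image']
    have hu : ∀ a b : ℝ, x + a • intToReal ι u = x + b • intToReal ι u → a = b := by
      intro a b hab
      have h1 := congrArg (fun z => intToReal ι l ⬝ᵥ z) (add_left_cancel hab)
      simpa [dotProduct_smul, intToReal_dotProduct, hl] using h1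
    constructor
    · rintro ⟨θ, ⟨h0, h1⟩, hθ⟩ i
      rw [Subsingleton.elim i 0]
      have h2 : θ * c = t 0 := by
        apply hu
        rw [← hθ]
        simp [mul_smul]
      rw [← h2]
      constructor
      · positivity
      · nlinarith
    · intro h
      obtain ⟨h0, h1⟩ := h 0
      refine ⟨t 0 / c, ⟨by positivity, (div_le_one hc).2 h1⟩, ?_⟩
      simp only [add_sub_cancel_left, smul_smul]
      rw [div_mul_cancel₀ _ hc.ne']
  rw [hset, MeasureTheory.volume_pi_pi]
  simp [hc.le]

end Lattice

/-! ### Areas of unions of trapezoids -/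

section Area

open MeasureTheory

lemma lintegral_Ico_affine (a δ p q : ℝ) (hδ : 0 < δ) (hp : 0 ≤ p) (hq : 0 ≤ q) :
    ∫⁻ β in Set.Ico a (a + δ), ENNReal.ofReal (p + (β - a) / δ * (q - p)) =
      ENNReal.ofReal (δ * (p + q) / 2) := by
  have hcont : Continuous fun β : ℝ => p + (β - a) / δ * (q - p) := by fun_prop
  rw [← ofReal_integral_eq_lintegral_ofReal]
  · congr 1
    rw [integral_Ico_eq_integral_Ioc, ← intervalIntegral.integral_of_le (by linarith)]
    rw [intervalIntegral.integral_eq_sub_of_hasDerivAt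
      (f := fun β => p * β + (β - a) ^ 2 / (2 * δ) * (q - p))]
    · field_simp
      ring
    · intro β _
      have h1 : HasDerivAt (fun β : ℝ => p * β) p β := by
        simpa using (hasDerivAt_id β).const_mul p
      have h2 : HasDerivAt (fun β : ℝ => (β - a) ^ 2) (2 * (β - a)) β := by
        simpa using ((hasDerivAt_id β).sub_const a).fun_pow 2
      have h3 := h1.fun_add ((h2.div_const (2 * δ)).mul_const (q - p))
      have h4 : p + (β - a) / δ * (q - p) = p + 2 * (β - a) / (2 * δ) * (q - p) := by
        rw [mul_div_mul_left _ _ two_ne_zero]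
      rw [h4]
      exact h3
    · exact hcont.intervalIntegrable _ _
  · exact (hcont.continuousOn.integrableOn_Icc (a := a) (b := a + δ)).mono_set
      Set.Ico_subset_Icc_self
  · refine (ae_restrict_iff' measurableSet_Ico).2 (Filter.Eventually.of_forall fun β hβ => ?_)
    have h1 : 0 ≤ (β - a) / δ := div_nonneg (by linarith [hβ.1]) hδ.le
    have h2 : (β - a) / δ ≤ 1 := (div_le_one hδ).2 (by linarith [hβ.2])
    change 0 ≤ p + (β - a) / δ * (q - p)
    nlinarith

/-- The area of a plane set cut by equidistant parallel lines into trapezoids. -/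
lemma volume_of_trapezoids {K : Set (Fin 2 → ℝ)} (hK : MeasurableSet K) (N : ℕ) (β₀ δ : ℝ)
    (hδ : 0 < δ) (lo hi : ℕ → ℝ) (hle : ∀ k ≤ N, lo k ≤ hi k)
    (hin : ∀ k < N, ∀ θ ∈ Set.Icc (0 : ℝ) 1, ∀ α : ℝ, ![α, β₀ + (k + θ) * δ] ∈ K ↔
      (1 - θ) * lo k + θ * lo (k + 1) ≤ α ∧ α ≤ (1 - θ) * hi k + θ * hi (k + 1))
    (hout : ∀ α β, ![α, β] ∈ K → β₀ ≤ β ∧ β ≤ β₀ + N * δ) :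
    (volume K).toReal =
      ∑ k ∈ Finset.range N, δ * ((hi k - lo k) + (hi (k + 1) - lo (k + 1))) / 2 := by
  have hmp := (volume_preserving_finTwoArrow ℝ).symm
  rw [← hmp.measure_preimage hK.nullMeasurableSet, Measure.volume_eq_prod,
    Measure.prod_apply_symm (hmp.measurable hK)]
  set S : ℝ → ENNReal := fun β => volume ((fun α => (α, β)) ⁻¹'
    ((MeasurableEquiv.finTwoArrow (α := ℝ)).symm ⁻¹' K)) with hS
  have hSmem : ∀ α β, α ∈ ((fun α => (α, β)) ⁻¹'
    ((MeasurableEquiv.finTwoArrow (α := ℝ)).symm ⁻¹' K)) ↔ ![α, β] ∈ K := fun α β => Iff.rfl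
  have hpiece : ∀ n ≤ N, ∫⁻ β in Set.Ico β₀ (β₀ + n * δ), S β =
      ENNReal.ofReal
        (∑ k ∈ Finset.range n, δ * ((hi k - lo k) + (hi (k + 1) - lo (k + 1))) / 2) := by
    intro n
    induction n with
    | zero => intro _; simp
    | succ n ih =>
      intro hn
      have hdisj : Disjoint (Set.Ico β₀ (β₀ + n * δ)) (Set.Ico (β₀ + n * δ) (β₀ + n * δ + δ)) := by
        rw [Set.disjoint_left]
        intro x hx hx'
        exact absurd hx.2 (not_lt.2 hx'.1)
      have hunion : Set.Ico β₀ (β₀ + ((n + 1 : ℕ) : ℝ) * δ) =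
          Set.Ico β₀ (β₀ + n * δ) ∪ Set.Ico (β₀ + n * δ) (β₀ + n * δ + δ) := by
        rw [Set.Ico_union_Ico_eq_Ico]
        · congr 1; push_cast; ring
        · have : (0 : ℝ) ≤ n * δ := by positivity
          linarith
        · linarith
      have hp : 0 ≤ hi n - lo n := sub_nonneg.2 (hle n (by omega))
      have hq : 0 ≤ hi (n + 1) - lo (n + 1) := sub_nonneg.2 (hle (n + 1) hn)
      rw [hunion, lintegral_union measurableSet_Ico hdisj, ih (by omega), Finset.sum_range_succ,
        ENNReal.ofReal_add]
      · congr 1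
        rw [← lintegral_Ico_affine (β₀ + n * δ) δ _ _ hδ hp hq]
        refine setLIntegral_congr_fun measurableSet_Ico fun β hβ => ?_
        have h1 : 0 ≤ (β - (β₀ + n * δ)) / δ := div_nonneg (by linarith [hβ.1]) hδ.le
        have h2 : (β - (β₀ + n * δ)) / δ ≤ 1 := (div_le_one hδ).2 (by linarith [hβ.2])
        have h3 := hin n (by omega) _ ⟨h1, h2⟩
        have h4 : β₀ + (n + (β - (β₀ + n * δ)) / δ) * δ = β := by field_simp; ring
        rw [h4] at h3
        have h5 : ((fun α => (α, β)) ⁻¹' ((MeasurableEquiv.finTwoArrow (α := ℝ)).symm ⁻¹' K)) =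
            Set.Icc _ _ := Set.ext fun α => (hSmem α β).trans (h3 α)
        simp only [hS]
        rw [h5, Real.volume_Icc]
        congr 1
        ring
      · refine Finset.sum_nonneg fun k hk => ?_
        have hk' := Finset.mem_range.1 hk
        have := sub_nonneg.2 (hle k (by omega))
        have := sub_nonneg.2 (hle (k + 1) (by omega))
        positivity
      · positivity
  have htot : ∫⁻ β, S β = ∫⁻ β in Set.Ico β₀ (β₀ + N * δ), S β := by
    rw [setLIntegral_congr Ico_ae_eq_Icc, ← lintegral_indicator measurableSet_Icc]
    congr 1
    ext β
    by_cases h : β ∈ Set.Icc β₀ (β₀ + N * δ)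
    · rw [Set.indicator_of_mem h]
    · rw [Set.indicator_of_notMem h]
      simp only [hS]
      convert measure_empty (μ := volume)
      ext α
      simp only [Set.mem_empty_iff_false, iff_false]
      exact fun hα => h (hout α β ((hSmem α β).1 hα))
  rw [htot, hpiece N le_rfl, ENNReal.toReal_ofReal]
  refine Finset.sum_nonneg fun k hk => ?_
  have hk' := Finset.mem_range.1 hk
  have := sub_nonneg.2 (hle k (by omega))
  have := sub_nonneg.2 (hle (k + 1) (by omega))
  positivity

end Area

/-! ### Lattice polygons and their sections -/

section Polygons

variable {ι : Type*} [Fintype ι]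

lemma vectorSpan_convexHull {E : Type*} [AddCommGroup E] [Module ℝ E] (D : Set E) :
    vectorSpan ℝ (convexHull ℝ D) = vectorSpan ℝ D := by
  rw [← direction_affineSpan, affineSpan_convexHull, direction_affineSpan]

lemma mem_segment_add_smul {E : Type*} [AddCommGroup E] [Module ℝ E] {x u y : E} {c : ℝ} :
    y ∈ segment ℝ x (x + c • u) ↔ ∃ θ ∈ Set.Icc (0 : ℝ) 1, x + (θ * c) • u = y := by
  rw [segment_eq_image']
  simp [smul_smul]

/-- The vector space of a lattice polygon has a lattice basis `u, f` (with the dual integer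
covectors `l, m`), such that `u` is in the kernel of a given covector `τ` and `τ ⬝ᵥ f > 0`. -/
lemma exists_dualSystem_of_dim_eq_two {D : Set (ι → ℝ)} (hD : ∀ a ∈ D, IsLatticePoint a)
    (hdim : dim (convexHull ℝ D) = 2) (τ : ι → ℤ) {a b : ι → ℝ} (ha : a ∈ D) (hb : b ∈ D)
    (hab : intToReal ι τ ⬝ᵥ a ≠ intToReal ι τ ⬝ᵥ b) :
    ∃ u f l m : ι → ℤ, l ⬝ᵥ u = 1 ∧ l ⬝ᵥ f = 0 ∧ m ⬝ᵥ u = 0 ∧ m ⬝ᵥ f = 1 ∧ τ ⬝ᵥ u = 0 ∧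
      0 < τ ⬝ᵥ f ∧ vectorSpan ℝ (convexHull ℝ D) =
        Submodule.span ℝ (Set.range fun j : Fin 2 => intToReal ι (![u, f] j)) := by
  rw [dim, vectorSpan_convexHull] at hdim
  rw [vectorSpan_convexHull]
  obtain ⟨za, rfl⟩ := isLatticePoint_iff.1 (hD a ha)
  obtain ⟨zb, rfl⟩ := isLatticePoint_iff.1 (hD b hb)
  set f' := zb - za with hf'
  have hf'U : intToReal ι f' ∈ vectorSpan ℝ D := by
    rw [hf', map_sub]; exact vsub_mem_vectorSpan ℝ hb ha
  have hτf' : τ ⬝ᵥ f' ≠ 0 := by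
    rw [intToReal_dotProduct, intToReal_dotProduct] at hab
    rw [hf', dotProduct_sub, sub_ne_zero]
    exact fun h => hab (by rw [h])
  obtain ⟨x, hx, hxf⟩ : ∃ x ∈ D, x - intToReal ι za ∉ Submodule.span ℝ {intToReal ι f'} := by
    by_contra! hcon
    have hle : vectorSpan ℝ D ≤ Submodule.span ℝ {intToReal ι f'} := by
      rw [vectorSpan_eq_span_vsub_set_right ℝ ha, Submodule.span_le]
      rintro _ ⟨x, hx, rfl⟩
      exact hcon x hx
    have := Submodule.finrank_mono hle
    have h1 := finrank_span_le_card (R := ℝ) ({intToReal ι f'} : Set (ι → ℝ))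
    simp at h1
    omega
  obtain ⟨zx, rfl⟩ := isLatticePoint_iff.1 (hD x hx)
  -- `u'` spans the kernel of `τ` in the vector space of the polygon
  set u' := (τ ⬝ᵥ f') • (zx - za) - (τ ⬝ᵥ (zx - za)) • f' with hu'
  have hu'U : intToReal ι u' ∈ vectorSpan ℝ D := by
    rw [hu', map_sub, map_smul, map_smul, map_sub, ← Int.cast_smul_eq_zsmul ℝ,
      ← Int.cast_smul_eq_zsmul ℝ]
    exact Submodule.sub_mem _ (Submodule.smul_mem _ _ (vsub_mem_vectorSpan ℝ hx ha))
      (Submodule.smul_mem _ _ hf'U)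
  have hu'0 : u' ≠ 0 := by
    intro h
    apply hxf
    rw [Submodule.mem_span_singleton]
    refine ⟨(τ ⬝ᵥ (zx - za) : ℤ) / (τ ⬝ᵥ f' : ℤ), ?_⟩
    have h1 : (τ ⬝ᵥ f') • (zx - za) = (τ ⬝ᵥ (zx - za)) • f' := sub_eq_zero.1 h
    have h2 := congrArg (intToReal ι) h1
    rw [map_smul, map_smul, map_sub, ← Int.cast_smul_eq_zsmul ℝ, ← Int.cast_smul_eq_zsmul ℝ] at h2
    have h3 : ((τ ⬝ᵥ f' : ℤ) : ℝ) ≠ 0 := by exact_mod_cast hτf'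
    rw [div_eq_inv_mul, mul_smul, ← h2, smul_smul, inv_mul_cancel₀ h3, one_smul]
  have hτu' : τ ⬝ᵥ u' = 0 := by
    rw [hu', dotProduct_sub, dotProduct_smul, dotProduct_smul, smul_eq_mul, smul_eq_mul]; ring
  obtain ⟨u, l, g, hg, hgu, hlu⟩ := exists_primitive u' hu'0
  have hτu : τ ⬝ᵥ u = 0 := by
    rw [hgu, dotProduct_smul, smul_eq_mul] at hτu'
    exact (mul_eq_zero.1 hτu').resolve_left hg.ne'
  have huU : intToReal ι u ∈ vectorSpan ℝ D := by
    rw [hgu, map_smul, ← Int.cast_smul_eq_zsmul ℝ] at hu'U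
    exact (Submodule.smul_mem_iff _ (by exact_mod_cast hg.ne')).1 hu'U
  -- correct `f'` by a multiple of `u`, so that `l` vanishes on it
  set f'' := f' - (l ⬝ᵥ f') • u with hf''
  have hτf'' : τ ⬝ᵥ f'' = τ ⬝ᵥ f' := by
    rw [hf'', dotProduct_sub, dotProduct_smul, hτu]; simp
  have hlf'' : l ⬝ᵥ f'' = 0 := by
    rw [hf'', dotProduct_sub, dotProduct_smul, hlu]; simp
  have hf''U : intToReal ι f'' ∈ vectorSpan ℝ D := by
    rw [hf'', map_sub, map_smul, ← Int.cast_smul_eq_zsmul ℝ]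
    exact Submodule.sub_mem _ hf'U (Submodule.smul_mem _ _ huU)
  obtain ⟨f₀, m₀, g', hg', hgf, hmf⟩ := exists_primitive f'' (fun h => hτf' (by
    rw [← hτf'', h, dotProduct_zero]))
  have hlf₀ : l ⬝ᵥ f₀ = 0 := by
    rw [hgf, dotProduct_smul, smul_eq_mul] at hlf''
    exact (mul_eq_zero.1 hlf'').resolve_left hg'.ne'
  have hτf₀ : τ ⬝ᵥ f₀ ≠ 0 := by
    intro h
    rw [← hτf'', hgf, dotProduct_smul, h] at hτf'
    simp at hτf'
  have hf₀U : intToReal ι f₀ ∈ vectorSpan ℝ D := by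
    rw [hgf, map_smul, ← Int.cast_smul_eq_zsmul ℝ] at hf''U
    exact (Submodule.smul_mem_iff _ (by exact_mod_cast hg'.ne')).1 hf''U
  obtain ⟨f, m₁, hlf, hm₁f, hτf, hfU⟩ : ∃ f m₁ : ι → ℤ, l ⬝ᵥ f = 0 ∧ m₁ ⬝ᵥ f = 1 ∧ 0 < τ ⬝ᵥ f ∧
      intToReal ι f ∈ vectorSpan ℝ D := by
    rcases lt_or_gt_of_ne hτf₀ with h | h
    · refine ⟨-f₀, -m₀, by simp [hlf₀], by simp [hmf], by simpa using h, ?_⟩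
      rw [map_neg]; exact Submodule.neg_mem _ hf₀U
    · exact ⟨f₀, m₀, hlf₀, hmf, h, hf₀U⟩
  have hmu : (m₁ - (m₁ ⬝ᵥ u) • l) ⬝ᵥ u = 0 := by
    rw [sub_dotProduct, smul_dotProduct, hlu]; simp
  have hmf' : (m₁ - (m₁ ⬝ᵥ u) • l) ⬝ᵥ f = 1 := by
    rw [sub_dotProduct, smul_dotProduct, hlf, hm₁f]; simp
  generalize m₁ - (m₁ ⬝ᵥ u) • l = m at hmu hmf'
  refine ⟨u, f, l, m, hlu, hlf, hmu, hmf', hτu, hτf, ?_⟩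
  have hd : ∀ i j : Fin 2, ![l, m] i ⬝ᵥ ![u, f] j = if i = j then 1 else 0 := by
    intro i j
    fin_cases i <;> fin_cases j <;> simp [hlu, hlf, hmu, hmf']
  symm
  apply Submodule.eq_of_le_of_finrank_eq
  · rw [Submodule.span_le]
    rintro _ ⟨j, rfl⟩
    fin_cases j
    · exact huU
    · exact hfU
  · rw [finrank_of_dualSystem hd rfl, hdim]

/-- If every generator is on one side of the strip `κ ≤ τ ≤ κ + 1`, a point of the convex hull over
this strip is on a segment crossing the strip. -/
lemma exists_crossing {D : Set (ι → ℝ)} {h : ι → ℝ} {κ : ℝ}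
    (hD : ∀ a ∈ D, h ⬝ᵥ a ≤ κ ∨ κ + 1 ≤ h ⬝ᵥ a) {a b : ι → ℝ} (ha : a ∈ D) (hb : b ∈ D)
    (haκ : h ⬝ᵥ a ≤ κ) (hbκ : κ + 1 ≤ h ⬝ᵥ b) {x : ι → ℝ} (hx : x ∈ convexHull ℝ D) {θ : ℝ}
    (hθ : h ⬝ᵥ x = κ + θ) :
    ∃ y ∈ convexHull ℝ D, ∃ z ∈ convexHull ℝ D, h ⬝ᵥ y = κ ∧ h ⬝ᵥ z = κ + 1 ∧
      x = (1 - θ) • y + θ • z := by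
  have hun : D = {a ∈ D | h ⬝ᵥ a ≤ κ} ∪ {a ∈ D | κ + 1 ≤ h ⬝ᵥ a} := by
    ext c
    constructor
    · intro hc
      exact (hD c hc).imp (fun h => ⟨hc, h⟩) fun h => ⟨hc, h⟩
    · rintro (hc | hc) <;> exact hc.1
  have hne1 : {a ∈ D | h ⬝ᵥ a ≤ κ}.Nonempty := ⟨a, ha, haκ⟩
  have hne2 : {a ∈ D | κ + 1 ≤ h ⬝ᵥ a}.Nonempty := ⟨b, hb, hbκ⟩
  rw [hun, convexHull_union hne1 hne2, mem_convexJoin] at hx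
  obtain ⟨y₀, hy₀, z₀, hz₀, hxs⟩ := hx
  have hy₀κ : h ⬝ᵥ y₀ ≤ κ := by
    have := le_dotProduct_of_mem_convexHull (h := -h) (c := -κ)
      (fun a ha => by simpa using ha.2) hy₀
    simpa using this
  have hz₀κ : κ + 1 ≤ h ⬝ᵥ z₀ := le_dotProduct_of_mem_convexHull (fun a ha => ha.2) hz₀
  have hy₀D := convexHull_mono (fun a ha => ha.1 : {a ∈ D | h ⬝ᵥ a ≤ κ} ⊆ D) hy₀
  have hz₀D := convexHull_mono (fun a ha => ha.1 : {a ∈ D | κ + 1 ≤ h ⬝ᵥ a} ⊆ D) hz₀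
  rw [segment_eq_image'] at hxs
  obtain ⟨s, ⟨hs0, hs1⟩, rfl⟩ := hxs
  set w := h ⬝ᵥ z₀ - h ⬝ᵥ y₀ with hw
  have hwpos : 0 < w := by linarith
  have hpt : ∀ c : ℝ, h ⬝ᵥ y₀ ≤ c → c ≤ h ⬝ᵥ z₀ →
      y₀ + ((c - h ⬝ᵥ y₀) / w) • (z₀ - y₀) ∈ convexHull ℝ D ∧
      h ⬝ᵥ (y₀ + ((c - h ⬝ᵥ y₀) / w) • (z₀ - y₀)) = c := by
    intro c h1 h2
    constructor
    · apply (convex_convexHull ℝ D).segment_subset hy₀D hz₀D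
      rw [segment_eq_image']
      exact ⟨_, ⟨div_nonneg (by linarith) hwpos.le, (div_le_one hwpos).2 (by linarith)⟩, rfl⟩
    · rw [dotProduct_add, dotProduct_smul, dotProduct_sub, ← hw, smul_eq_mul,
        div_mul_cancel₀ _ hwpos.ne']
      ring
  obtain ⟨hy, hyκ⟩ := hpt κ hy₀κ (by linarith)
  obtain ⟨hz, hzκ⟩ := hpt (κ + 1) (by linarith) hz₀κ
  refine ⟨_, hy, _, hz, hyκ, hzκ, ?_⟩
  have hs : s = (κ + θ - h ⬝ᵥ y₀) / w := by
    simp only [dotProduct_add, dotProduct_smul, dotProduct_sub, smul_eq_mul] at hθ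
    rw [← hw] at hθ
    rw [eq_div_iff hwpos.ne']; linarith
  rw [hs]
  ext i
  simp only [Pi.add_apply, Pi.smul_apply, Pi.sub_apply, smul_eq_mul]
  field_simp
  ring

/-- The lattice area of a lattice polygon, in terms of the lattice lengths of its sections by the
lattice lines `τ = const`: between two consecutive lattice lines there are no vertices, and the
polygon is a trapezoid there. -/
lemma exists_sections_of_polygon {D : Set (ι → ℝ)} (hfin : D.Finite)
    (hD : ∀ a ∈ D, IsLatticePoint a) (hdim : dim (convexHull ℝ D) = 2) (τ : ι → ℤ) (r : ℤ) (N : ℕ)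
    (hN : 0 < N) (hr : ∀ a ∈ D, (r : ℝ) ≤ intToReal ι τ ⬝ᵥ a ∧ intToReal ι τ ⬝ᵥ a ≤ r + N)
    {a b : ι → ℝ} (ha : a ∈ D) (hb : b ∈ D) (hτa : intToReal ι τ ⬝ᵥ a = r)
    (hτb : intToReal ι τ ⬝ᵥ b = r + N) :
    ∃ u f l m : ι → ℤ, (l ⬝ᵥ u = 1 ∧ l ⬝ᵥ f = 0 ∧ m ⬝ᵥ u = 0 ∧ m ⬝ᵥ f = 1 ∧ τ ⬝ᵥ u = 0 ∧
      0 < τ ⬝ᵥ f ∧ vectorSpan ℝ (convexHull ℝ D) =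
        Submodule.span ℝ (Set.range fun j : Fin 2 => intToReal ι (![u, f] j))) ∧
      ∃ ψ : ℕ → ℝ, (∀ k ≤ N, 0 ≤ ψ k ∧ ∃ x : ι → ℝ,
        {y ∈ convexHull ℝ D | intToReal ι τ ⬝ᵥ y = r + k} =
          segment ℝ x (x + ψ k • intToReal ι u)) ∧
      latticeVolume (convexHull ℝ D) * ((τ ⬝ᵥ f : ℤ) : ℝ) =
        ∑ k ∈ Finset.range N, (ψ k + ψ (k + 1)) := by
  have hNpos : (0 : ℝ) < N := by exact_mod_cast hN
  obtain ⟨u, f, l, m, hlu, hlf, hmu, hmf, hτu, hτf, hU⟩ := exists_dualSystem_of_dim_eq_two hD hdim τ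
    ha hb (by rw [hτa, hτb]; linarith)
  refine ⟨u, f, l, m, ⟨hlu, hlf, hmu, hmf, hτu, hτf, hU⟩, ?_⟩
  have hd : ∀ i j : Fin 2, ![l, m] i ⬝ᵥ ![u, f] j = if i = j then 1 else 0 := by
    intro i j
    fin_cases i <;> fin_cases j <;> simp [hlu, hlf, hmu, hmf]
  set F := convexHull ℝ D with hF
  set q : ℝ := ((τ ⬝ᵥ f : ℤ) : ℝ) with hq
  have hqpos : 0 < q := by rw [hq]; exact_mod_cast hτf
  set T := intToReal ι τ with hT
  have hTu : T ⬝ᵥ intToReal ι u = 0 := by rw [hT, intToReal_dotProduct, hτu]; simp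
  have hTf : T ⬝ᵥ intToReal ι f = q := by rw [hT, intToReal_dotProduct]
  have haF : a ∈ F := subset_convexHull ℝ D ha
  have hbF : b ∈ F := subset_convexHull ℝ D hb
  have hFcomp : IsCompact F := hfin.isCompact_convexHull ℝ
  have hFconv : Convex ℝ F := convex_convexHull ℝ D
  have hcontdot : ∀ h : ι → ℝ, Continuous fun x : ι → ℝ => h ⬝ᵥ x := by
    intro h; unfold dotProduct; fun_prop
  -- coordinates in the affine span of `F`
  have hcoord : ∀ x ∈ F, x = a + (intToReal ι l ⬝ᵥ (x - a)) • intToReal ι u +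
      ((T ⬝ᵥ x - r) / q) • intToReal ι f := by
    intro x hx
    have h1 : x - a ∈ vectorSpan ℝ F := vsub_mem_vectorSpan ℝ hx haF
    rw [hU, Submodule.mem_span_range_iff_exists_fun] at h1
    obtain ⟨c, hc⟩ := h1
    simp only [Fin.sum_univ_two, Matrix.cons_val_zero, Matrix.cons_val_one] at hc
    have h2 : intToReal ι l ⬝ᵥ (x - a) = c 0 := by
      rw [← hc]
      simp [dotProduct_add, dotProduct_smul, intToReal_dotProduct, hlu, hlf]
    have h3 : T ⬝ᵥ x - r = c 1 * q := by
      rw [← hτa, ← dotProduct_sub, ← hc]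
      simp [dotProduct_add, dotProduct_smul, hTu, hTf]
    rw [h2, h3, mul_div_cancel_right₀ _ hqpos.ne', add_assoc, hc]
    abel
  set pt : ℝ → ℝ → ι → ℝ := fun α t => a + α • intToReal ι u + ((t - r) / q) • intToReal ι f with hpt
  have hTpt : ∀ α t, T ⬝ᵥ pt α t = t := by
    intro α t
    simp only [hpt, dotProduct_add, dotProduct_smul, hTu, hTf, hτa, smul_eq_mul]
    rw [div_mul_cancel₀ _ hqpos.ne']; ring
  have hlpt : ∀ α t, intToReal ι l ⬝ᵥ (pt α t - a) = α := by
    intro α t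
    have : pt α t - a = α • intToReal ι u + ((t - r) / q) • intToReal ι f := by
      simp only [hpt]; abel
    rw [this]
    simp [dotProduct_add, dotProduct_smul, intToReal_dotProduct, hlu, hlf]
  have hcoord' : ∀ x ∈ F, x = pt (intToReal ι l ⬝ᵥ (x - a)) (T ⬝ᵥ x) := hcoord
  -- the section of `F` by the line `τ = t`, in the coordinate along `u`
  set Sl : ℝ → Set ℝ := fun t => {α | pt α t ∈ F} with hSl
  have hSlimg : ∀ t, Sl t = (fun x => intToReal ι l ⬝ᵥ (x - a)) '' (F ∩ {x | T ⬝ᵥ x = t}) := by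
    intro t
    ext α
    constructor
    · intro h
      exact ⟨_, ⟨h, hTpt α t⟩, hlpt α t⟩
    · rintro ⟨x, ⟨hx, rfl⟩, rfl⟩
      change pt _ _ ∈ F
      rw [← hcoord' x hx]; exact hx
  have hSlcomp : ∀ t, IsCompact (Sl t) := by
    intro t
    rw [hSlimg]
    refine (hFcomp.inter_right (isClosed_eq (hcontdot T) continuous_const)).image ?_
    exact (hcontdot _).comp (continuous_id.sub continuous_const)
  have hptcomb : ∀ α α' t t' c c' : ℝ, c + c' = 1 →
      pt (c * α + c' * α') (c * t + c' * t') = c • pt α t + c' • pt α' t' := by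
    intro α α' t t' c c' hcc
    have hc : c = 1 - c' := by linarith
    subst hc
    ext i
    simp only [hpt, Pi.add_apply, Pi.smul_apply, smul_eq_mul]
    field_simp
    ring
  have hSlne : ∀ t, (r : ℝ) ≤ t → t ≤ r + N → (Sl t).Nonempty := by
    intro t h1 h2
    have ht : t = (1 - (t - r) / N) * r + (t - r) / N * (r + N) := by field_simp; ring
    have h01 : 0 ≤ (t - r) / N := div_nonneg (by linarith) hNpos.le
    have h02 : (t - r) / N ≤ 1 := (div_le_one hNpos).2 (by linarith)
    rw [hSlimg]
    refine Set.Nonempty.image _ ⟨(1 - (t - r) / N) • a + ((t - r) / N) • b,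
      hFconv haF hbF (by linarith) h01 (by ring), ?_⟩
    change T ⬝ᵥ _ = t
    rw [dotProduct_add, dotProduct_smul, dotProduct_smul, hτa, hτb, smul_eq_mul, smul_eq_mul]
    exact ht.symm
  have hSlconv : ∀ t, Convex ℝ (Sl t) := by
    intro t α hα α' hα' c c' hc hc' hcc
    change pt _ _ ∈ F
    have := hptcomb α α' t t c c' hcc
    rw [← add_mul, hcc, one_mul] at this
    rw [smul_eq_mul, smul_eq_mul, this]
    exact hFconv hα hα' hc hc' hcc
  -- the end points of the sections
  set lo : ℝ → ℝ := fun t => sInf (Sl t) with hlo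
  set hi : ℝ → ℝ := fun t => sSup (Sl t) with hhi
  have hSlIcc : ∀ t, (r : ℝ) ≤ t → t ≤ r + N → Sl t = Set.Icc (lo t) (hi t) := by
    intro t h1 h2
    exact eq_Icc_of_connected_compact ⟨hSlne t h1 h2, (hSlconv t).isPreconnected⟩ (hSlcomp t)
  have hlohi : ∀ t, (r : ℝ) ≤ t → t ≤ r + N → lo t ≤ hi t := by
    intro t h1 h2
    have := hSlne t h1 h2
    rw [hSlIcc t h1 h2, Set.nonempty_Icc] at this
    exact this
  have hkr : ∀ k : ℕ, k ≤ N → (r : ℝ) ≤ r + k ∧ (r : ℝ) + k ≤ r + N := by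
    intro k hk
    have : (k : ℝ) ≤ N := by exact_mod_cast hk
    have : (0 : ℝ) ≤ k := by positivity
    constructor <;> linarith
  refine ⟨fun k => hi (r + k) - lo (r + k), fun k hk => ⟨?_, ?_⟩, ?_⟩
  · have := hlohi (r + k) (hkr k hk).1 (hkr k hk).2
    simpa using this
  · refine ⟨pt (lo (r + k)) (r + k), ?_⟩
    have hle := hlohi (r + k) (hkr k hk).1 (hkr k hk).2
    have hSk := hSlIcc (r + k) (hkr k hk).1 (hkr k hk).2
    have hshift : ∀ c, pt (lo (r + k)) (r + k) + c • intToReal ι u =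
        pt (lo (r + k) + c) (r + k) := by
      intro c
      simp only [hpt, add_smul]; abel
    ext y
    rw [mem_segment_add_smul]
    simp only [hshift]
    constructor
    · rintro ⟨hy, hyk⟩
      have hyl : intToReal ι l ⬝ᵥ (y - a) ∈ Sl (r + k) := by
        rw [hSlimg]; exact ⟨y, ⟨hy, hyk⟩, rfl⟩
      have hyl' := hyl
      rw [hSk] at hyl
      have hyc := hcoord' y hy
      rw [hyk] at hyc
      rw [hyc]
      rcases hle.eq_or_lt with heq | hlt
      · refine ⟨0, by simp, ?_⟩
        have : intToReal ι l ⬝ᵥ (y - a) = lo (r + k) := le_antisymm (heq ▸ hyl.2) hyl.1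
        simp [this]
      · refine ⟨(intToReal ι l ⬝ᵥ (y - a) - lo (r + k)) / (hi (r + k) - lo (r + k)),
          ⟨div_nonneg (by linarith [hyl.1]) (by linarith),
            (div_le_one (by linarith)).2 (by linarith [hyl.2])⟩, ?_⟩
        have : hi (r + k) - lo (r + k) ≠ 0 := by linarith
        rw [div_mul_cancel₀ _ this]; congr 1; ring
    · rintro ⟨θ, ⟨h0, h1⟩, rfl⟩
      refine ⟨?_, hTpt _ _⟩
      change lo (r + k) + θ * (hi (r + k) - lo (r + k)) ∈ Sl (r + k)
      rw [hSk]
      constructor <;> nlinarith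
  -- in the coordinates of the basis `u, f` the lines `τ = r + k` cut `F` into trapezoids of
  -- height `1 / q`
  · have hptcont : Continuous fun t : Fin 2 → ℝ => a + ∑ j, t j • intToReal ι (![u, f] j) := by
      fun_prop
    rw [latticeVolume_eq hd hU haF, volume_of_trapezoids
      (K := {t : Fin 2 → ℝ | a + ∑ j, t j • intToReal ι (![u, f] j) ∈ F}) (N := N) (β₀ := 0) (δ := q⁻¹)
      (lo := fun k => lo (r + k)) (hi := fun k => hi (r + k))
      (hFcomp.isClosed.preimage hptcont).measurableSet (by positivity)]
    · rw [Finset.mul_sum, Finset.sum_mul]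
      refine Finset.sum_congr rfl fun k _ => ?_
      rw [Nat.factorial_two]
      push_cast
      field_simp
    · intro k hk
      exact hlohi (r + k) (hkr k hk).1 (hkr k hk).2
    · intro k hk θ hθ α
      have hmem : (![α, 0 + (k + θ) * q⁻¹] ∈ {t : Fin 2 → ℝ |
          a + ∑ j, t j • intToReal ι (![u, f] j) ∈ F}) ↔ α ∈ Sl (r + k + θ) := by
        have : a + ∑ j, (![α, 0 + (k + θ) * q⁻¹] : Fin 2 → ℝ) j • intToReal ι (![u, f] j) =
            pt α (r + k + θ) := by
          simp only [Fin.sum_univ_two, Matrix.cons_val_zero, Matrix.cons_val_one, hpt]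
          rw [← add_assoc]
          congr 2
          rw [div_eq_mul_inv]; ring
        change _ ∈ F ↔ _
        rw [this]; rfl
      rw [hmem]
      have hk0 := hSlIcc (r + k) (hkr k hk.le).1 (hkr k hk.le).2
      have hk1 := hSlIcc (r + (k + 1 : ℕ)) (hkr (k + 1) hk).1 (hkr (k + 1) hk).2
      have hcast : ((k + 1 : ℕ) : ℝ) = k + 1 := by push_cast; ring
      have hle0 := hlohi (r + k) (hkr k hk.le).1 (hkr k hk.le).2
      have hle1 := hlohi (r + (k + 1 : ℕ)) (hkr (k + 1) hk).1 (hkr (k + 1) hk).2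
      have hht : (1 - θ) * (r + k) + θ * (r + (k + 1 : ℕ)) = (r : ℝ) + k + θ := by
        rw [hcast]; ring
      constructor
      · intro hα
        -- there are no lattice points strictly between two consecutive lattice lines
        have hside : ∀ c ∈ D, T ⬝ᵥ c ≤ (r : ℝ) + k ∨ (r : ℝ) + k + 1 ≤ T ⬝ᵥ c := by
          intro c hc
          obtain ⟨z, rfl⟩ := isLatticePoint_iff.1 (hD c hc)
          rw [hT, intToReal_dotProduct]
          rcases le_or_gt (τ ⬝ᵥ z) (r + k) with h | h
          · left; exact_mod_cast h
          · right; exact_mod_cast h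
        obtain ⟨y, hy, z, hz, hyk, hzk, hxyz⟩ := exists_crossing hside ha hb
          (by rw [hτa]; exact (hkr k hk.le).1) (by
            rw [hτb, add_assoc, ← hcast]; exact (hkr (k + 1) hk).2) hα (hTpt _ _)
        have h1 : intToReal ι l ⬝ᵥ (y - a) ∈ Sl (r + k) := by
          rw [hSlimg]; exact ⟨y, ⟨hy, hyk⟩, rfl⟩
        have h2 : intToReal ι l ⬝ᵥ (z - a) ∈ Sl (r + (k + 1 : ℕ)) := by
          rw [hSlimg]; exact ⟨z, ⟨hz, by rw [hcast, ← add_assoc]; exact hzk⟩, rfl⟩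
        rw [hk0] at h1
        rw [hk1] at h2
        have h3 : α = (1 - θ) * (intToReal ι l ⬝ᵥ (y - a)) + θ * (intToReal ι l ⬝ᵥ (z - a)) := by
          rw [← hlpt α (r + k + θ), hxyz]
          have : (1 - θ) • y + θ • z - a = (1 - θ) • (y - a) + θ • (z - a) := by
            ext i
            simp only [Pi.add_apply, Pi.smul_apply, Pi.sub_apply, smul_eq_mul]; ring
          rw [this, dotProduct_add, dotProduct_smul, dotProduct_smul, smul_eq_mul, smul_eq_mul]
        rw [h3]
        have hθ1 : 0 ≤ 1 - θ := by linarith [hθ.2]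
        constructor
        · exact add_le_add (mul_le_mul_of_nonneg_left h1.1 hθ1)
            (mul_le_mul_of_nonneg_left h2.1 hθ.1)
        · exact add_le_add (mul_le_mul_of_nonneg_left h1.2 hθ1)
            (mul_le_mul_of_nonneg_left h2.2 hθ.1)
      · intro hα
        have hθ1 : 0 ≤ 1 - θ := by linarith [hθ.2]
        have hcomb : ∀ α₀ ∈ Sl (r + k), ∀ α₁ ∈ Sl (r + (k + 1 : ℕ)),
            (1 - θ) * α₀ + θ * α₁ ∈ Sl (r + k + θ) := by
          intro α₀ h0 α₁ h1
          change pt _ _ ∈ F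
          rw [← hht, hptcomb _ _ _ _ _ _ (by ring)]
          exact hFconv h0 h1 hθ1 hθ.1 (by ring)
        have hmlo := hcomb (lo (r + k)) (by rw [hk0]; exact ⟨le_rfl, hle0⟩) (lo (r + (k + 1 : ℕ)))
          (by rw [hk1]; exact ⟨le_rfl, hle1⟩)
        have hmhi := hcomb (hi (r + k)) (by rw [hk0]; exact ⟨hle0, le_rfl⟩) (hi (r + (k + 1 : ℕ)))
          (by rw [hk1]; exact ⟨hle1, le_rfl⟩)
        exact (hSlconv (r + k + θ)).ordConnected.out hmlo hmhi hα
    · intro α β hαβ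
      have hmem : a + ∑ j, (![α, β] : Fin 2 → ℝ) j • intToReal ι (![u, f] j) =
          pt α (r + β * q) := by
        simp only [Fin.sum_univ_two, Matrix.cons_val_zero, Matrix.cons_val_one, hpt]
        rw [← add_assoc, add_sub_cancel_left, mul_div_cancel_right₀ _ hqpos.ne']
      have hF' : pt α (r + β * q) ∈ F := by rw [← hmem]; exact hαβ
      have h1 := le_dotProduct_of_mem_convexHull (fun c hc => (hr c hc).1) hF'
      have h2 := le_dotProduct_of_mem_convexHull (h := -T) (c := -(r + N))
        (fun c hc => by rw [neg_dotProduct, neg_le_neg_iff]; exact (hr c hc).2) hF'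
      rw [neg_dotProduct, neg_le_neg_iff, hTpt] at h2
      rw [hTpt] at h1
      constructor
      · by_contra! h
        nlinarith
      · rw [zero_add, ← div_eq_mul_inv, le_div_iff₀ hqpos]
        linarith

end Polygons

/-! ### Restriction of linear functions and polyhedra over an edge -/

section Restriction

variable {ι : Type*} [Fintype ι] [DecidableEq ι]

omit [Fintype ι] in
lemma single_mem_vectorSpan_orthantHull {C : Set (ι → ℝ)} {I : Set ι} (hC : C.Nonempty) {i : ι}
    (hi : i ∈ I) : (Pi.single i 1 : ι → ℝ) ∈ vectorSpan ℝ (orthantHull C I) := by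
  obtain ⟨a, ha⟩ := hC
  have ha' := subset_orthantHull C I ha
  have := vsub_mem_vectorSpan ℝ (orthantHull_add_single ha' hi zero_le_one) ha'
  simpa using this

lemma mem_vectorSpan_orthantHull_of_support {C : Set (ι → ℝ)} {I : Set ι} (hC : C.Nonempty)
    {x : ι → ℝ} (hx : ∀ i ∉ I, x i = 0) : x ∈ vectorSpan ℝ (orthantHull C I) := by
  rw [pi_eq_sum_univ' x]
  refine Submodule.sum_mem _ fun i _ => ?_
  by_cases hi : i ∈ I
  · refine Submodule.smul_mem _ _ ?_
    convert single_mem_vectorSpan_orthantHull hC hi using 1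
  · rw [hx i hi, zero_smul]; exact Submodule.zero_mem _

lemma restrictDual_dualOf {C : Set (ι → ℝ)} {I : Finset ι} (hC : C.Nonempty) (h : ι → ℝ) :
    restrictDual I (orthantHull C I) (dualOf (orthantHull C I) h) = fun i : I => h i := by
  ext i
  unfold restrictDual
  rw [LinearMap.pi_apply, dif_pos (single_mem_vectorSpan_orthantHull hC (Finset.mem_coe.2 i.2))]
  simp [Module.Dual.eval_apply]

/-- The extension of a function on `I` by zero. -/
def extendZero (I : Finset ι) : (I → ℝ) →ₗ[ℝ] (ι → ℝ) where
  toFun v i := if h : i ∈ I then v ⟨i, h⟩ else 0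
  map_add' v w := by ext i; by_cases h : i ∈ I <;> simp [h]
  map_smul' c v := by ext i; by_cases h : i ∈ I <;> simp [h]

omit [Fintype ι] in
@[simp]
lemma extendZero_coe (I : Finset ι) (v : I → ℝ) (i : I) : extendZero I v i = v i := by
  simp [extendZero]

omit [Fintype ι] in
lemma extendZero_of_mem {I : Finset ι} (v : I → ℝ) {i : ι} (hi : i ∈ I) :
    extendZero I v i = v ⟨i, hi⟩ := by
  simp [extendZero, hi]

omit [Fintype ι] in
lemma extendZero_of_notMem {I : Finset ι} (v : I → ℝ) {i : ι} (hi : i ∉ I) :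
    extendZero I v i = 0 := by
  simp [extendZero, hi]

/-- The direct image of a normal cone consists of the restrictions of the linear functions
minimal at the face. -/
lemma mem_restrictDual_image_normalCone {C : Set (ι → ℝ)} {I : Finset ι} (hC : C.Nonempty)
    {F : Set (ι → ℝ)} {v : I → ℝ} :
    v ∈ restrictDual I (orthantHull C I) '' normalCone (orthantHull C I) F ↔
      ∃ h : ι → ℝ, (∀ i : I, h i = v i) ∧ minFace (orthantHull C I) h = F := by
  constructor
  · rintro ⟨w, hw, rfl⟩
    obtain ⟨h, rfl⟩ := exists_eq_dualOf _ w
    refine ⟨h, fun i => ?_, ?_⟩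
    · rw [restrictDual_dualOf hC]
    · rw [← supportFace_dualOf]; exact hw
  · rintro ⟨h, hv, rfl⟩
    refine ⟨dualOf _ h, supportFace_dualOf _ _, ?_⟩
    rw [restrictDual_dualOf hC]
    exact funext hv

lemma finrank_map_eq_iff {V V' : Type*} [AddCommGroup V] [Module ℝ V] [FiniteDimensional ℝ V]
    [AddCommGroup V'] [Module ℝ V'] (p : V →ₗ[ℝ] V') (W : Submodule ℝ V) :
    Module.finrank ℝ (W.map p) = Module.finrank ℝ W ↔ ∀ w ∈ W, p w = 0 → w = 0 := by
  have h1 := (p.domRestrict W).finrank_range_add_finrank_ker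
  have h2 : LinearMap.range (p.domRestrict W) = W.map p := LinearMap.range_domRestrict W p
  rw [h2] at h1
  constructor
  · intro h w hw hpw
    have h3 : Module.finrank ℝ (LinearMap.ker (p.domRestrict W)) = 0 := by omega
    rw [Submodule.finrank_eq_zero] at h3
    have h4 : (⟨w, hw⟩ : W) ∈ LinearMap.ker (p.domRestrict W) := hpw
    rw [h3, Submodule.mem_bot] at h4
    exact congrArg Subtype.val h4
  · intro h
    have h3 : LinearMap.ker (p.domRestrict W) = ⊥ := by
      rw [Submodule.eq_bot_iff]
      rintro ⟨w, hw⟩ hpw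
      exact Subtype.ext (h w hw hpw)
    rw [h3, finrank_bot] at h1
    omega

omit [DecidableEq ι] in
lemma minFace_congr {Γ : Set (ι → ℝ)} {h h' : ι → ℝ}
    (heq : ∀ u ∈ vectorSpan ℝ Γ, h ⬝ᵥ u = h' ⬝ᵥ u) : minFace Γ h = minFace Γ h' := by
  have key : ∀ x ∈ Γ, ∀ y ∈ Γ, (h ⬝ᵥ x ≤ h ⬝ᵥ y ↔ h' ⬝ᵥ x ≤ h' ⬝ᵥ y) := by
    intro x hx y hy
    have := heq _ (vsub_mem_vectorSpan ℝ hy hx)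
    rw [vsub_eq_sub, dotProduct_sub, dotProduct_sub] at this
    constructor <;> intro _ <;> linarith
  ext x
  exact and_congr_right fun hx => forall₂_congr fun y hy => key x hx y hy

end Restriction

section EdgePolyhedra

variable {ι : Type*} [Fintype ι] [DecidableEq ι]

/-- The generators `C` project along `ℝ^I` to lattice points of the segment from `p + r e` to
`p + (r + L) e`, including both end points. Here `e` is a primitive vector, and the value of the
integer covector `τ` is the coordinate on the line `p + ℝ e`. -/
structure IsEdgeSystem (C : Set (ι → ℝ)) (I : Finset ι) (p e τ : ι → ℤ) (r : ℤ) (L : ℕ) :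
    Prop where
  finite : C.Finite
  lattice : ∀ a ∈ C, IsLatticePoint a
  pos : 0 < L
  e_zero : ∀ i ∈ I, e i = 0
  τ_zero : ∀ i ∈ I, τ i = 0
  τ_e : τ ⬝ᵥ e = 1
  coords : ∀ a ∈ C, ∀ j ∉ I, a j = p j + (intToReal ι τ ⬝ᵥ a) * e j
  range : ∀ a ∈ C, (r : ℝ) ≤ intToReal ι τ ⬝ᵥ a ∧ intToReal ι τ ⬝ᵥ a ≤ r + L
  left : ∃ a ∈ C, intToReal ι τ ⬝ᵥ a = r
  right : ∃ a ∈ C, intToReal ι τ ⬝ᵥ a = r + L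

namespace IsEdgeSystem

variable {C : Set (ι → ℝ)} {I : Finset ι} {p e τ : ι → ℤ} {r : ℤ} {L : ℕ}

omit [DecidableEq ι] in
lemma nonempty (H : IsEdgeSystem C I p e τ r L) : C.Nonempty := by
  obtain ⟨a, ha, -⟩ := H.left
  exact ⟨a, ha⟩

omit [DecidableEq ι] in
lemma dot_single (H : IsEdgeSystem C I p e τ r L) {x y : ι → ℝ} (hxy : ∀ j ∉ I, x j = y j) :
    intToReal ι τ ⬝ᵥ x = intToReal ι τ ⬝ᵥ y := by
  unfold dotProduct
  refine Finset.sum_congr rfl fun i _ => ?_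
  by_cases hi : i ∈ I
  · simp [H.τ_zero i hi]
  · rw [hxy i hi]

lemma mem_vectorSpan (H : IsEdgeSystem C I p e τ r L) {x : ι → ℝ} :
    x ∈ vectorSpan ℝ (orthantHull C I) ↔ ∀ j ∉ I, x j = (intToReal ι τ ⬝ᵥ x) * e j := by
  constructor
  · intro hx
    have hC : ∀ y ∈ orthantHull C I, ∀ j ∉ I, y j = p j + (intToReal ι τ ⬝ᵥ y) * e j := by
      rintro y ⟨z, hz, -, hzy⟩ j hj
      rw [← H.dot_single (x := z) (y := y) fun j hj => hzy j (by simpa using hj)]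
      rw [← hzy j (by simpa using hj)]
      have h1 := dotProduct_const_of_mem_convexHull (C := C)
        (h := Pi.single j 1 - (e j : ℝ) • intToReal ι τ) (c := p j) (fun a ha => by
          rw [sub_dotProduct, smul_dotProduct, single_dotProduct, H.coords a ha j hj, smul_eq_mul]
          ring) hz
      rw [sub_dotProduct, smul_dotProduct, single_dotProduct, smul_eq_mul] at h1
      linarith
    rw [vectorSpan_def] at hx
    refine Submodule.span_induction (p := fun x _ => ∀ j ∉ I, x j = (intToReal ι τ ⬝ᵥ x) * e j)
      ?_ ?_ ?_ ?_ hx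
    · rintro _ ⟨y, hy, z, hz, rfl⟩ j hj
      simp only [vsub_eq_sub, Pi.sub_apply, dotProduct_sub]
      rw [hC y hy j hj, hC z hz j hj]; ring
    · intro j _; simp
    · intro y z _ _ hy hz j hj
      simp only [Pi.add_apply, dotProduct_add]
      rw [hy j hj, hz j hj]; ring
    · intro c y _ hy j hj
      simp only [Pi.smul_apply, dotProduct_smul, smul_eq_mul]
      rw [hy j hj]; ring
  · intro hx
    obtain ⟨a, ha, har⟩ := H.left
    obtain ⟨b, hb, hbr⟩ := H.right
    have hL : (L : ℝ) ≠ 0 := by exact_mod_cast H.pos.ne'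
    have h1 : b - a ∈ vectorSpan ℝ (orthantHull C I) :=
      vsub_mem_vectorSpan ℝ (subset_orthantHull C I hb) (subset_orthantHull C I ha)
    have h2 : x - ((intToReal ι τ ⬝ᵥ x) / L) • (b - a) ∈ vectorSpan ℝ (orthantHull C I) := by
      refine mem_vectorSpan_orthantHull_of_support H.nonempty fun j hj => ?_
      have hj' : j ∉ I := by simpa using hj
      simp only [Pi.sub_apply, Pi.smul_apply, smul_eq_mul]
      rw [H.coords a ha j hj', H.coords b hb j hj', har, hbr, hx j hj']
      field_simp
      ring
    have := Submodule.add_mem _ h2 (Submodule.smul_mem _ ((intToReal ι τ ⬝ᵥ x) / L) h1)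
    simpa using this

lemma e_mem (H : IsEdgeSystem C I p e τ r L) :
    intToReal ι e ∈ vectorSpan ℝ (orthantHull C I) := by
  rw [H.mem_vectorSpan]
  intro j _
  rw [intToReal_dotProduct, H.τ_e]; simp

/-- Linear functions on the space `ℝ^I ⊕ ℝ e`. -/
lemma dotProduct_eq (H : IsEdgeSystem C I p e τ r L) (h : ι → ℝ) {x : ι → ℝ}
    (hx : x ∈ vectorSpan ℝ (orthantHull C I)) :
    h ⬝ᵥ x = extendZero I (fun i : I => h i) ⬝ᵥ x +
      (intToReal ι τ ⬝ᵥ x) * (h ⬝ᵥ intToReal ι e) := by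
  rw [H.mem_vectorSpan] at hx
  conv_rhs => rw [dotProduct, dotProduct.eq_1 h, Finset.mul_sum, ← Finset.sum_add_distrib]
  rw [dotProduct]
  refine Finset.sum_congr rfl fun i _ => ?_
  by_cases hi : i ∈ I
  · rw [extendZero_of_mem _ hi]; simp [H.e_zero i hi]
  · rw [extendZero_of_notMem _ hi, intToReal_apply]
    nth_rewrite 1 [hx i hi]
    ring

/-- The direct image of the space of linear functions constant on a face `F`, which is spanned by
lattice vectors `u ∈ ℝ^I` and `f ∉ ℝ^I`: the lattice index is the integer `τ ⬝ᵥ f`. -/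
lemma latticeIndex_eq (H : IsEdgeSystem C I p e τ r L) {F : Set (ι → ℝ)}
    (hF : F ⊆ orthantHull C I) {u f m : ι → ℤ}
    (hU : ∀ x, x ∈ vectorSpan ℝ F ↔ ∃ α β : ℝ, x = α • intToReal ι u + β • intToReal ι f)
    (hτu : τ ⬝ᵥ u = 0) (hτf : 0 < τ ⬝ᵥ f) (hmu : m ⬝ᵥ u = 0) (hmf : m ⬝ᵥ f = 1) :
    Module.finrank ℝ ((faceAnnihilator (orthantHull C I) F).map
        (restrictDual I (orthantHull C I))) =
      Module.finrank ℝ (faceAnnihilator (orthantHull C I) F) ∧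
    (latticeIndex (dualLattice (orthantHull C I)) (restrictDual I (orthantHull C I))
      (faceAnnihilator (orthantHull C I) F) : ℝ) = ((τ ⬝ᵥ f : ℤ) : ℝ) := by
  set Γ := orthantHull C I with hΓ
  set T := intToReal ι τ with hT
  have hne := H.nonempty
  have hle : vectorSpan ℝ F ≤ vectorSpan ℝ Γ := vectorSpan_mono ℝ hF
  have huF : intToReal ι u ∈ vectorSpan ℝ F := (hU _).2 ⟨1, 0, by simp⟩
  have hfF : intToReal ι f ∈ vectorSpan ℝ F := (hU _).2 ⟨0, 1, by simp⟩
  have hTf : T ⬝ᵥ intToReal ι f = ((τ ⬝ᵥ f : ℤ) : ℝ) := intToReal_dotProduct _ _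
  have hTu : T ⬝ᵥ intToReal ι u = 0 := by rw [hT, intToReal_dotProduct, hτu]; simp
  have hq0 : ((τ ⬝ᵥ f : ℤ) : ℝ) ≠ 0 := by exact_mod_cast hτf.ne'
  have hann : ∀ h : ι → ℝ, dualOf Γ h ∈ faceAnnihilator Γ F ↔
      h ⬝ᵥ intToReal ι u = 0 ∧ h ⬝ᵥ intToReal ι f = 0 := by
    intro h
    rw [mem_faceAnnihilator]
    constructor
    · intro hh
      exact ⟨hh ⟨_, hle huF⟩ huF, hh ⟨_, hle hfF⟩ hfF⟩
    · rintro ⟨h1, h2⟩ ⟨x, hx⟩ hxF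
      obtain ⟨α, β, hαβ⟩ := (hU x).1 hxF
      simp only [dualOf_apply]
      rw [hαβ, dotProduct_add, dotProduct_smul, dotProduct_smul, h1, h2]; simp
  have hres : ∀ h : ι → ℝ, restrictDual I Γ (dualOf Γ h) = fun i : I => h i :=
    restrictDual_dualOf hne
  constructor
  · rw [finrank_map_eq_iff]
    intro w hw hw0
    obtain ⟨h, rfl⟩ := exists_eq_dualOf _ w
    rw [hres] at hw0
    obtain ⟨-, h2⟩ := (hann h).1 hw
    rw [H.dotProduct_eq h (hle hfF), hw0, map_zero, zero_dotProduct, zero_add] at h2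
    rw [← hT, hTf] at h2
    have h3 : h ⬝ᵥ intToReal ι e = 0 := (mul_eq_zero.1 h2).resolve_left hq0
    ext ⟨x, hx⟩
    rw [dualOf_apply, H.dotProduct_eq h hx, hw0, h3]
    simp
  · set q : ℤ := τ ⬝ᵥ f with hq
    set W := faceAnnihilator Γ F with hW
    set Λ := dualLattice Γ with hΛ
    set π := restrictDual I Γ with hπ
    -- `χ` detects the sublattice: the projection of a covector of `W` to `ℝ^I` determines its value
    -- at `e` as `-χ / q`, so this covector is integer exactly if `χ` is a multiple of `q`
    let χ : (I → ℝ) →+ ℝ :=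
      { toFun := fun w => extendZero I w ⬝ᵥ intToReal ι f
        map_zero' := by simp
        map_add' := fun v w => by rw [map_add, add_dotProduct] }
    have hχ : ∀ h : ι → ℝ, χ (fun i : I => h i) =
        h ⬝ᵥ intToReal ι f - q * (h ⬝ᵥ intToReal ι e) := by
      intro h
      rw [H.dotProduct_eq h (hle hfF), ← hT, hTf]
      change extendZero I _ ⬝ᵥ _ = _
      ring
    -- integrality of a covector
    have hint : ∀ h : ι → ℝ, dualOf Γ h ∈ Λ ↔
        (∀ i : I, ∃ z : ℤ, h i = z) ∧ ∃ z : ℤ, h ⬝ᵥ intToReal ι e = z := by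
      intro h
      constructor
      · intro hh
        refine ⟨fun i => ?_, ?_⟩
        · have := hh ⟨Pi.single (i : ι) 1,
            single_mem_vectorSpan_orthantHull hne (Finset.mem_coe.2 i.2)⟩
            ⟨Pi.single (i : ι) 1, fun j => by
              by_cases hj : j = i
              · subst hj; simp
              · simp [hj]⟩
          simpa using this
        · exact hh ⟨_, H.e_mem⟩ ⟨e, fun _ => rfl⟩
      · rintro ⟨h1, ze, hze⟩ ⟨x, hx⟩ ⟨z, hz⟩
        choose w hw using h1
        have hxz : x = intToReal ι z := funext hz
        let w' : ι → ℤ := fun i => if hi : i ∈ I then w ⟨i, hi⟩ else 0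
        have hw' : extendZero I (fun i : I => h i) = intToReal ι w' := by
          ext i
          by_cases hi : i ∈ I
          · rw [extendZero_of_mem _ hi, intToReal_apply]
            simp only [w', hi, dif_pos]
            exact hw ⟨i, hi⟩
          · rw [extendZero_of_notMem _ hi, intToReal_apply]
            simp [w', hi]
        refine ⟨w' ⬝ᵥ z + (τ ⬝ᵥ z) * ze, ?_⟩
        rw [dualOf_apply, H.dotProduct_eq h hx, hw', hze, hxz, intToReal_dotProduct,
          intToReal_dotProduct]
        push_cast; ring
    set K := (W.map π).toAddSubgroup ⊓ Λ.map π.toAddMonoidHom with hK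
    have hHK : (W.toAddSubgroup ⊓ Λ).map π.toAddMonoidHom =
        (AddSubgroup.zmultiples (q : ℝ)).comap χ ⊓ K := by
      ext w
      constructor
      · rintro ⟨d, ⟨hdW, hdΛ⟩, rfl⟩
        obtain ⟨h, rfl⟩ := exists_eq_dualOf _ d
        refine ⟨?_, ⟨dualOf Γ h, hdW, rfl⟩, ⟨dualOf Γ h, hdΛ, rfl⟩⟩
        change χ (π (dualOf Γ h)) ∈ AddSubgroup.zmultiples (q : ℝ)
        rw [hres, hχ, ((hann h).1 hdW).2]
        obtain ⟨-, z, hz⟩ := (hint h).1 hdΛ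
        rw [AddSubgroup.mem_zmultiples_iff]
        exact ⟨-z, by rw [hz]; simp [mul_comm]⟩
      · rintro ⟨h1, ⟨d, hdW, rfl⟩, ⟨d', hd'Λ, hdd'⟩⟩
        obtain ⟨h, rfl⟩ := exists_eq_dualOf _ d
        obtain ⟨h', rfl⟩ := exists_eq_dualOf _ d'
        refine ⟨dualOf Γ h, ⟨hdW, ?_⟩, rfl⟩
        have h2 : χ (π (dualOf Γ h)) ∈ AddSubgroup.zmultiples (q : ℝ) := h1
        rw [hres, hχ, ((hann h).1 hdW).2, AddSubgroup.mem_zmultiples_iff] at h2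
        obtain ⟨z, hz⟩ := h2
        refine (hint h).2 ⟨fun i => ?_, -z, ?_⟩
        · have h3 : π (dualOf Γ h') = π (dualOf Γ h) := hdd'
          rw [hres, hres] at h3
          rw [← congrFun h3 i]
          exact ((hint h').1 hd'Λ).1 i
        · have h4 : (q : ℝ) * (h ⬝ᵥ intToReal ι e) = q * (-z) := by
            rw [zsmul_eq_mul] at hz; linarith
          rw [mul_left_cancel₀ hq0 h4]; simp
    -- modulo `q` the character `χ` is onto: use the covector `m` with `m ⬝ᵥ f = 1`
    have hKmap : AddSubgroup.zmultiples (q : ℝ) ⊔ K.map χ = AddSubgroup.zmultiples (1 : ℝ) := by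
      apply le_antisymm
      · refine sup_le ?_ ?_
        · rw [AddSubgroup.zmultiples_le]
          exact AddSubgroup.mem_zmultiples_iff.2 ⟨q, by simp⟩
        · rintro _ ⟨w, ⟨-, ⟨d, hdΛ, rfl⟩⟩, rfl⟩
          obtain ⟨h, rfl⟩ := exists_eq_dualOf _ d
          obtain ⟨z, hz⟩ := hdΛ ⟨_, hle hfF⟩ ⟨f, fun _ => rfl⟩
          rw [dualOf_apply] at hz
          obtain ⟨-, z', hz'⟩ := (hint h).1 hdΛ
          change χ (π (dualOf Γ h)) ∈ AddSubgroup.zmultiples (1 : ℝ)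
          rw [hres, hχ, hz', AddSubgroup.mem_zmultiples_iff]
          refine ⟨z - q * z', ?_⟩
          simp only at hz
          rw [hz]; simp
      · rw [AddSubgroup.zmultiples_le]
        have hmem : (fun i : I => (m i : ℝ)) ∈ K := by
          constructor
          · refine ⟨dualOf Γ (intToReal ι m - (q : ℝ)⁻¹ • T), (hann _).2 ⟨?_, ?_⟩, ?_⟩
            · rw [sub_dotProduct, smul_dotProduct, hTu, intToReal_dotProduct, hmu]; simp
            · rw [sub_dotProduct, smul_dotProduct, hTf, intToReal_dotProduct, hmf]
              simp [hq0]
            · rw [hres]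
              ext i
              simp [hT, H.τ_zero i i.2]
          · refine ⟨dualOf Γ (intToReal ι m), (hint _).2 ⟨fun i => ⟨m i, rfl⟩, m ⬝ᵥ e, ?_⟩, ?_⟩
            · rw [intToReal_dotProduct]
            · exact hres _
        have hval : χ (fun i : I => (m i : ℝ)) = 1 - q * ((m ⬝ᵥ e : ℤ) : ℝ) := by
          have := hχ (intToReal ι m)
          rw [intToReal_dotProduct, intToReal_dotProduct, hmf] at this
          simpa using this
        have h1 : (1 : ℝ) = (m ⬝ᵥ e) • (q : ℝ) + χ (fun i : I => (m i : ℝ)) := by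
          rw [hval, zsmul_eq_mul]; ring
        rw [h1]
        exact AddSubgroup.add_mem_sup (AddSubgroup.mem_zmultiples_iff.2 ⟨_, rfl⟩) ⟨_, hmem, rfl⟩
    have hidx : (AddSubgroup.zmultiples (q : ℝ)).relIndex (AddSubgroup.zmultiples (1 : ℝ)) =
        q.natAbs := by
      have e1 : AddSubgroup.zmultiples (q : ℝ) =
          (AddSubgroup.zmultiples q).map (Int.castAddHom ℝ) := by
        rw [AddMonoidHom.map_zmultiples]; rfl
      have e2 : AddSubgroup.zmultiples (1 : ℝ) = (⊤ : AddSubgroup ℤ).map (Int.castAddHom ℝ) := by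
        rw [← Int.zmultiples_one, AddMonoidHom.map_zmultiples]; simp
      rw [e1, e2, AddSubgroup.relIndex_map_map_of_injective _ _ Int.cast_injective,
        AddSubgroup.relIndex_top_right, Int.index_zmultiples]
    unfold latticeIndex
    rw [hHK, AddSubgroup.inf_relIndex_right, AddSubgroup.relIndex_comap,
      ← AddSubgroup.relIndex_sup_left, hKmap, hidx, Nat.cast_natAbs, abs_of_pos hτf]

end IsEdgeSystem

end EdgePolyhedra

/-! ### Lower hulls and generic linear functions -/

section LowerHull

/-- The lower convex hull of the points `(T a, h a)` over a strip `κ ≤ T ≤ κ + 1` which contains no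
points in its interior: there is a linear function `h + c T` minimal at points on both sides. -/
lemma exists_supporting_chord {α : Type*} {C : Set α} (hC : C.Finite) (T h : α → ℝ) (κ : ℝ)
    (hside : ∀ a ∈ C, T a ≤ κ ∨ κ + 1 ≤ T a) (hl : ∃ a ∈ C, T a ≤ κ)
    (hr : ∃ a ∈ C, κ + 1 ≤ T a) :
    ∃ a ∈ C, ∃ b ∈ C, ∃ c : ℝ, T a ≤ κ ∧ κ + 1 ≤ T b ∧ h a + c * T a = h b + c * T b ∧
      ∀ x ∈ C, h a + c * T a ≤ h x + c * T x := by
  -- the chord with the lowest value over the middle of the strip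
  let val : α × α → ℝ := fun s =>
    (h s.1 * (T s.2 - (κ + 1 / 2)) + h s.2 * ((κ + 1 / 2) - T s.1)) / (T s.2 - T s.1)
  have hfin : ({a ∈ C | T a ≤ κ} ×ˢ {a ∈ C | κ + 1 ≤ T a}).Finite :=
    (hC.subset fun a ha => ha.1).prod (hC.subset fun a ha => ha.1)
  obtain ⟨a₀, ha₀, hTa₀⟩ := hl
  obtain ⟨b₀, hb₀, hTb₀⟩ := hr
  obtain ⟨⟨a, b⟩, ⟨⟨haC, ha⟩, ⟨hbC, hb⟩⟩, hmin⟩ := Set.exists_min_image _ val hfin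
    ⟨(a₀, b₀), ⟨ha₀, hTa₀⟩, hb₀, hTb₀⟩
  simp only at haC ha hbC hb
  set c := -((h b - h a) / (T b - T a)) with hc
  have hab : 0 < T b - T a := by linarith
  have hcm : c * (T b - T a) = -(h b - h a) := by rw [hc]; field_simp
  clear_value c
  have hval : val (a, b) + c * (κ + 1 / 2) = h a + c * T a := by
    have : val (a, b) = h a - c * ((κ + 1 / 2) - T a) := by
      simp only [val]
      rw [div_eq_iff hab.ne']
      linear_combination (κ + 1 / 2 - T a) * hcm
    rw [this]; ring
  have hline : h a + c * T a = h b + c * T b := by linarith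
  refine ⟨a, haC, b, hbC, c, ha, hb, hline, fun x hx => ?_⟩
  by_contra! hcon
  rcases hside x hx with hxκ | hxκ
  · have h1 := hmin (x, b) ⟨⟨hx, hxκ⟩, hbC, hb⟩
    have hxb : 0 < T b - T x := by linarith
    have h2 : val (x, b) + c * (κ + 1 / 2) =
        ((h x + c * T x) * (T b - (κ + 1 / 2)) + (h b + c * T b) * ((κ + 1 / 2) - T x)) /
          (T b - T x) := by
      simp only [val]; field_simp; ring
    have h3 : ((h x + c * T x) * (T b - (κ + 1 / 2)) + (h b + c * T b) * ((κ + 1 / 2) - T x)) /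
          (T b - T x) < h a + c * T a := by
      rw [div_lt_iff₀ hxb, ← hline]
      have : 0 < T b - (κ + 1 / 2) := by linarith
      nlinarith
    linarith
  · have h1 := hmin (a, x) ⟨⟨haC, ha⟩, hx, hxκ⟩
    have hxb : 0 < T x - T a := by linarith
    have h2 : val (a, x) + c * (κ + 1 / 2) =
        ((h a + c * T a) * (T x - (κ + 1 / 2)) + (h x + c * T x) * ((κ + 1 / 2) - T a)) /
          (T x - T a) := by
      simp only [val]; field_simp; ring
    have h3 : ((h a + c * T a) * (T x - (κ + 1 / 2)) + (h x + c * T x) * ((κ + 1 / 2) - T a)) /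
          (T x - T a) < h a + c * T a := by
      rw [div_lt_iff₀ hxb]
      have : 0 < (κ + 1 / 2) - T a := by linarith
      nlinarith
    linarith

end LowerHull

section Generic

/-- A non-empty open set is not covered by finitely many proper subspaces. -/
lemma exists_mem_open_notMem {κ : Type*} [Fintype κ] (S : Finset (Submodule ℝ (κ → ℝ)))
    (hS : ∀ W ∈ S, W ≠ ⊤) {O : Set (κ → ℝ)} (hO : IsOpen O) (hne : O.Nonempty) :
    ∃ v ∈ O, ∀ W ∈ S, v ∉ W := by
  have hnull : MeasureTheory.volume (⋃ W ∈ S, (W : Set (κ → ℝ))) = 0 := by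
    refine (MeasureTheory.measure_biUnion_null_iff S.countable_toSet).2 ?_
    exact fun W hW => MeasureTheory.Measure.addHaar_submodule _ W (hS W hW)
  by_contra! hcon
  have hsub : O ⊆ ⋃ W ∈ S, (W : Set (κ → ℝ)) := by
    intro v hv
    obtain ⟨W, hW, hvW⟩ := hcon v hv
    exact Set.mem_biUnion hW hvW
  exact (hO.measure_pos MeasureTheory.volume hne).ne' (MeasureTheory.measure_mono_null hsub hnull)

lemma isOpen_pos {κ : Type*} [Finite κ] : IsOpen {v : κ → ℝ | ∀ i, 0 < v i} := by
  have : {v : κ → ℝ | ∀ i, 0 < v i} = Set.pi Set.univ fun _ => Set.Ioi 0 := by ext; simp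
  rw [this]
  exact isOpen_set_pi Set.finite_univ fun _ _ => isOpen_Ioi

lemma ne_top_of_finrank_add_lt {κ : Type*} [Finite κ] {W : Submodule ℝ (κ → ℝ)} {d : ℕ}
    (h : Module.finrank ℝ W + d < Module.finrank ℝ (κ → ℝ)) : W ≠ ⊤ := by
  rintro rfl
  rw [finrank_top] at h
  omega

/-- If for all positive linear functions outside a set of codimension `2` the minimal point of a
finite set is unique, then the set has a least element: otherwise, on a generic segment between a
linear function minimal at some `x₀` and one which is not, the minimal point changes. -/
lemma exists_least_of_unique_minimizers {κ : Type*} [Fintype κ] {Y : Set (κ → ℝ)} (hY : Y.Finite)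
    (hne : Y.Nonempty) (S : Finset (Submodule ℝ (κ → ℝ)))
    (hS : ∀ W ∈ S, Module.finrank ℝ W + 1 < Module.finrank ℝ (κ → ℝ))
    (huniq : ∀ v : κ → ℝ, (∀ i, 0 < v i) → (∀ W ∈ S, v ∉ W) →
      (minFace Y v).Subsingleton) :
    ∃ x₀ ∈ Y, ∀ y ∈ Y, ∀ i, x₀ i ≤ y i := by
  classical
  obtain ⟨v₀, hv₀, hv₀S⟩ := exists_mem_open_notMem S
    (fun W hW => ne_top_of_finrank_add_lt (hS W hW)) isOpen_pos ⟨fun _ => 1, fun _ => one_pos⟩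
  obtain ⟨x₀, hx₀⟩ := minFace_nonempty_of_finite v₀ hY hne
  have hx₀u : ∀ z ∈ Y, z ≠ x₀ → v₀ ⬝ᵥ x₀ < v₀ ⬝ᵥ z := by
    intro z hz hzx
    refine lt_of_le_of_ne (hx₀.2 z hz) fun heq => hzx ?_
    exact huniq v₀ hv₀ hv₀S ⟨hz, fun w hw => by rw [← heq]; exact hx₀.2 w hw⟩ hx₀
  refine ⟨x₀, hx₀.1, ?_⟩
  by_contra! hcon
  obtain ⟨y, hy, i, hyi⟩ := hcon
  -- a generic linear function which is smaller at `y` than at `x₀`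
  have hcont : ∀ x : κ → ℝ, Continuous fun v : κ → ℝ => v ⬝ᵥ x := by
    intro x; unfold dotProduct; fun_prop
  have hOopen : IsOpen ({v : κ → ℝ | ∀ i, 0 < v i} ∩ {v | v ⬝ᵥ y < v ⬝ᵥ x₀}) :=
    isOpen_pos.inter (isOpen_lt (hcont y) (hcont x₀))
  have hOne : ({v : κ → ℝ | ∀ i, 0 < v i} ∩ {v | v ⬝ᵥ y < v ⬝ᵥ x₀}).Nonempty := by
    have hev : ∀ᶠ ε : ℝ in nhdsWithin 0 (Set.Ioi 0),
        (Pi.single i 1 + ε • (fun _ => (1 : ℝ)) : κ → ℝ) ⬝ᵥ y <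
        (Pi.single i 1 + ε • (fun _ => (1 : ℝ)) : κ → ℝ) ⬝ᵥ x₀ := by
      have hc : Continuous fun ε : ℝ =>
          (Pi.single i 1 + ε • (fun _ => (1 : ℝ)) : κ → ℝ) ⬝ᵥ x₀ -
          (Pi.single i 1 + ε • (fun _ => (1 : ℝ)) : κ → ℝ) ⬝ᵥ y := by
        simp only [add_dotProduct, smul_dotProduct, smul_eq_mul]; fun_prop
      have h0 : (0 : ℝ) < (Pi.single i 1 + (0 : ℝ) • (fun _ => (1 : ℝ)) : κ → ℝ) ⬝ᵥ x₀ -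
          (Pi.single i 1 + (0 : ℝ) • (fun _ => (1 : ℝ)) : κ → ℝ) ⬝ᵥ y := by simpa using hyi
      filter_upwards [(hc.continuousAt.eventually (lt_mem_nhds h0)).filter_mono
        nhdsWithin_le_nhds] with ε hε
      linarith
    obtain ⟨ε, hε, hεpos⟩ := (hev.and self_mem_nhdsWithin).exists
    have hε' : (0 : ℝ) < ε := hεpos
    refine ⟨_, fun j => ?_, hε⟩
    by_cases hj : j = i
    · subst hj; simp; linarith
    · simp [hj, hε']
  -- if `v₁` avoids the span of `W` and `v₀`, then the half-open segment from `v₀` to `v₁` avoids `W`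
  set S' : Finset (Submodule ℝ (κ → ℝ)) := S.image fun W => W ⊔ Submodule.span ℝ {v₀} with hS'
  obtain ⟨v₁, ⟨hv₁, hv₁y⟩, hv₁S⟩ := exists_mem_open_notMem S' (by
    intro W' hW'
    obtain ⟨W, hW, rfl⟩ := Finset.mem_image.1 hW'
    intro htop
    have h1 := Submodule.finrank_add_le_finrank_add_finrank W (Submodule.span ℝ {v₀})
    rw [htop, finrank_top] at h1
    have h2 := finrank_span_le_card (R := ℝ) ({v₀} : Set (κ → ℝ))
    simp at h2
    have h3 := hS W hW
    simp only [Module.finrank_fintype_fun_eq_card] at h1 h3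
    omega) hOopen hOne
  -- the first time when another point becomes minimal
  have hZfin : {z ∈ Y | v₁ ⬝ᵥ z < v₁ ⬝ᵥ x₀}.Finite := hY.subset fun z hz => hz.1
  obtain ⟨z, ⟨hzY, hz1⟩, hzmin⟩ := Set.exists_min_image _
    (fun z => (v₀ ⬝ᵥ z - v₀ ⬝ᵥ x₀) / ((v₀ ⬝ᵥ z - v₀ ⬝ᵥ x₀) + (v₁ ⬝ᵥ x₀ - v₁ ⬝ᵥ z))) hZfin
    ⟨y, hy, hv₁y⟩
  have hzx : z ≠ x₀ := by rintro rfl; exact lt_irrefl _ hz1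
  have ha := hx₀u z hzY hzx
  set t := (v₀ ⬝ᵥ z - v₀ ⬝ᵥ x₀) / ((v₀ ⬝ᵥ z - v₀ ⬝ᵥ x₀) + (v₁ ⬝ᵥ x₀ - v₁ ⬝ᵥ z)) with ht
  have hden : 0 < (v₀ ⬝ᵥ z - v₀ ⬝ᵥ x₀) + (v₁ ⬝ᵥ x₀ - v₁ ⬝ᵥ z) := by linarith
  have ht0 : 0 < t := div_pos (by linarith) hden
  have ht1 : t < 1 := (div_lt_one hden).2 (by linarith)
  set v := (1 - t) • v₀ + t • v₁ with hv
  have hvdot : ∀ x, v ⬝ᵥ x = (1 - t) * (v₀ ⬝ᵥ x) + t * (v₁ ⬝ᵥ x) := by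
    intro x
    rw [hv, add_dotProduct, smul_dotProduct, smul_dotProduct, smul_eq_mul, smul_eq_mul]
  have hvpos : ∀ i, 0 < v i := by
    intro i
    have h1 := hv₀ i
    have h2 := hv₁ i
    simp only [hv, Pi.add_apply, Pi.smul_apply, smul_eq_mul]
    have : 0 < 1 - t := by linarith
    positivity
  have hvS : ∀ W ∈ S, v ∉ W := by
    intro W hW hvW
    apply hv₁S _ (Finset.mem_image_of_mem _ hW)
    have h1 : v₁ = t⁻¹ • v - (t⁻¹ * (1 - t)) • v₀ := by
      rw [hv, smul_add, smul_smul, smul_smul, inv_mul_cancel₀ ht0.ne', one_smul]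
      abel
    rw [h1]
    exact Submodule.sub_mem _ (Submodule.mem_sup_left (Submodule.smul_mem _ _ hvW))
      (Submodule.mem_sup_right (Submodule.smul_mem _ _ (Submodule.mem_span_singleton_self v₀)))
  have heq : v ⬝ᵥ z = v ⬝ᵥ x₀ := by
    rw [hvdot, hvdot]
    have : t * ((v₀ ⬝ᵥ z - v₀ ⬝ᵥ x₀) + (v₁ ⬝ᵥ x₀ - v₁ ⬝ᵥ z)) = v₀ ⬝ᵥ z - v₀ ⬝ᵥ x₀ :=
      div_mul_cancel₀ _ hden.ne'
    linarith
  have hmin : ∀ w ∈ Y, v ⬝ᵥ x₀ ≤ v ⬝ᵥ w := by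
    intro w hw
    rw [hvdot, hvdot]
    have h0 := hx₀.2 w hw
    rcases le_or_gt (v₁ ⬝ᵥ x₀) (v₁ ⬝ᵥ w) with h1 | h1
    · have h3 : 0 ≤ 1 - t := by linarith
      have := mul_le_mul_of_nonneg_left h0 h3
      have := mul_le_mul_of_nonneg_left h1 ht0.le
      linarith
    · have h2 := hzmin w ⟨hw, h1⟩
      rw [le_div_iff₀ (by linarith)] at h2
      linarith
  exact hzx (huniq v hvpos hvS ⟨hzY, fun w hw => by rw [heq]; exact hmin w hw⟩ ⟨hx₀.1, hmin⟩)

/-- Outside finitely many subspaces, the faces of high dimension do not appear as support faces: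
their normal cones are projected to sets of high codimension. -/
lemma exists_generic_subspaces {ι : Type*} [Fintype ι] [DecidableEq ι] {C : Set (ι → ℝ)}
    {I : Finset ι} (hC : C.Finite) (hne : C.Nonempty) (s d : ℕ)
    (hs : dim (orthantHull C I) + d < I.card + s) :
    ∃ S : Finset (Submodule ℝ (I → ℝ)),
      (∀ W ∈ S, Module.finrank ℝ W + d < Module.finrank ℝ (I → ℝ)) ∧
      ∀ v : I → ℝ, (∀ W ∈ S, v ∉ W) → ∀ h : ι → ℝ, (∀ i : I, h i = v i) →
        (minFace (orthantHull C I) h).Nonempty →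
        Bornology.IsBounded (minFace (orthantHull C I) h) →
        dim (minFace (orthantHull C I) h) < s := by
  classical
  set Γ := orthantHull C I
  refine ⟨((finite_faces (I := (I : Set ι)) hC).toFinset.filter fun F => F ⊆ Γ ∧ s ≤ dim F).image
    fun F => (faceAnnihilator Γ F).map (restrictDual I Γ), ?_, ?_⟩
  · intro W hW
    obtain ⟨F, hF, rfl⟩ := Finset.mem_image.1 hW
    obtain ⟨-, hFΓ, hFs⟩ := Finset.mem_filter.1 hF
    have h1 := Submodule.finrank_map_le (restrictDual I Γ) (faceAnnihilator Γ F)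
    have h2 := finrank_faceAnnihilator hFΓ
    rw [Module.finrank_fintype_fun_eq_card, Fintype.card_coe]
    omega
  · intro v hv h hhv hFne hb
    by_contra! hcon
    have hface : IsFace Γ (minFace Γ h) := isFace_iff.2 ⟨hFne, h, rfl⟩
    refine hv _ (Finset.mem_image_of_mem _ (Finset.mem_filter.2
      ⟨(Set.Finite.mem_toFinset _).2 hface, fun x hx => hx.1, hcon⟩)) ?_
    refine ⟨dualOf Γ h, ?_, ?_⟩
    · have h1 : dualOf Γ h ∈ normalCone Γ (minFace Γ h) := supportFace_dualOf Γ h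
      have h2 := Submodule.subset_span (R := ℝ) h1
      rw [span_normalCone hC hface hb] at h2
      exact h2
    · rw [restrictDual_dualOf hne]
      exact funext hhv

end Generic

/-! ### Weights of polyhedra over an edge -/

section LatticeLength

variable {ι : Type*} [Fintype ι]

open Classical in
/-- The lattice length of a segment; it is `0` for sets whose dimension is not `1`. -/
noncomputable def latticeLength (S : Set (ι → ℝ)) : ℝ :=
  if dim S = 1 then latticeVolume S else 0

lemma latticeLength_of_subsingleton {S : Set (ι → ℝ)} (hS : S.Subsingleton) :
    latticeLength S = 0 := by
  unfold latticeLength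
  rw [if_neg]
  rcases hS.eq_empty_or_singleton with rfl | ⟨x, rfl⟩
  · rw [dim, vectorSpan_empty, finrank_bot]; exact zero_ne_one
  · rw [dim_singleton]; exact zero_ne_one

lemma latticeLength_segment {u l : ι → ℤ} (hl : l ⬝ᵥ u = 1) (x : ι → ℝ) {c : ℝ} (hc : 0 ≤ c) :
    latticeLength (segment ℝ x (x + c • intToReal ι u)) = c := by
  unfold latticeLength
  rcases hc.eq_or_lt with rfl | hc
  · rw [zero_smul, add_zero, segment_same, dim_singleton]; simp
  · obtain ⟨h1, h2⟩ := dim_latticeVolume_segment hl x hc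
    rw [if_pos h1, h2]

omit [Fintype ι] in
lemma eq_of_dim_eq_one {F : Set (ι → ℝ)} (hF : dim F = 1) {f : ι → ℝ} (hf : f ≠ 0)
    (hfF : f ∈ vectorSpan ℝ F) {x : ι → ℝ} (hx : x ∈ vectorSpan ℝ F) : ∃ c : ℝ, c • f = x := by
  have h := (finrank_eq_one_iff_of_nonzero' (⟨f, hfF⟩ : vectorSpan ℝ F)
    (fun h => hf (congrArg Subtype.val h))).1 hF ⟨x, hx⟩
  obtain ⟨c, hc⟩ := h
  exact ⟨c, congrArg Subtype.val hc⟩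

lemma exists_dotProduct_eq_of_convex {F : Set (ι → ℝ)} (hF : Convex ℝ F) {h x y : ι → ℝ}
    (hx : x ∈ F) (hy : y ∈ F) {t : ℝ} (hxt : h ⬝ᵥ x ≤ t) (hty : t ≤ h ⬝ᵥ y) :
    ∃ z ∈ F, h ⬝ᵥ z = t := by
  have hcont : Continuous fun x : ι → ℝ => h ⬝ᵥ x := by unfold dotProduct; fun_prop
  exact hF.isPreconnected.intermediate_value hx hy hcont.continuousOn ⟨hxt, hty⟩

end LatticeLength

section EdgeWeights

variable {ι : Type*} [Fintype ι] [DecidableEq ι]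

/-- At a covector which is not positive, the projected fans have weight `0`. -/
lemma weightAt_eq_zero_of_not_pos {C : Set (ι → ℝ)} {I : Finset ι} (hC : C.Finite)
    (hne : C.Nonempty) (d : ℕ) {v : I → ℝ} (hv : ¬ ∀ i, 0 < v i) :
    weightAt (pushforward (dualLattice (orthantHull C I)) (restrictDual I (orthantHull C I))
      (charClass (orthantHull C I) d)) v = 0 := by
  rw [weightAt_pushforward_charClass hC, Finset.sum_eq_zero, mul_zero]
  intro F hF
  rw [Set.Finite.mem_toFinset] at hF
  rw [if_neg]
  rintro ⟨-, hmem⟩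
  rw [mem_restrictDual_image_normalCone hne] at hmem
  obtain ⟨h, hhv, rfl⟩ := hmem
  have hpos := bounded_face_orthantHull hC hF.1.1 hF.2.1
  exact hv fun i => by rw [← hhv i]; exact hpos i (Finset.mem_coe.2 i.2)

/-- The section of the polyhedron by the hyperplane `τ = t`. -/
def edgeSection (C : Set (ι → ℝ)) (I : Finset ι) (τ : ι → ℤ) (t : ℝ) : Set (ι → ℝ) :=
  {x | x ∈ orthantHull C I ∧ intToReal ι τ ⬝ᵥ x = t}

/-- The linear functions on `ℝ^I ⊕ ℝ e` with the restriction `v` to `ℝ^I`. -/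
noncomputable def edgeFun (I : Finset ι) (τ : ι → ℤ) (v : I → ℝ) (c : ℝ) : ι → ℝ :=
  extendZero I v + c • intToReal ι τ

lemma edgeFun_dotProduct (I : Finset ι) (τ : ι → ℤ) (v : I → ℝ) (c : ℝ) (x : ι → ℝ) :
    edgeFun I τ v c ⬝ᵥ x = extendZero I v ⬝ᵥ x + c * (intToReal ι τ ⬝ᵥ x) := by
  rw [edgeFun, add_dotProduct, smul_dotProduct, smul_eq_mul]

namespace IsEdgeSystem

variable {C : Set (ι → ℝ)} {I : Finset ι} {p e τ : ι → ℤ} {r : ℤ} {L : ℕ}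

omit [Fintype ι] in
lemma edgeFun_apply [Fintype ι] (H : IsEdgeSystem C I p e τ r L) (v : I → ℝ) (c : ℝ) (i : I) :
    edgeFun I τ v c i = v i := by
  simp [edgeFun, H.τ_zero i i.2]

lemma edgeFun_pos (H : IsEdgeSystem C I p e τ r L) {v : I → ℝ} (hv : ∀ i, 0 < v i) (c : ℝ) :
    ∀ i ∈ (I : Set ι), 0 < edgeFun I τ v c i := by
  intro i hi
  have := H.edgeFun_apply v c ⟨i, hi⟩
  simp only at this
  rw [this]
  exact hv _

/-- The support faces over a covector `v` of `ℝ^I` form a family with one parameter, the value of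
the covector at `e`. -/
lemma minFace_eq (H : IsEdgeSystem C I p e τ r L) (v : I → ℝ) {h : ι → ℝ}
    (hh : ∀ i : I, h i = v i) :
    minFace (orthantHull C I) h =
      minFace (orthantHull C I) (edgeFun I τ v (h ⬝ᵥ intToReal ι e)) := by
  refine minFace_congr fun u hu => ?_
  rw [H.dotProduct_eq h hu, edgeFun_dotProduct, mul_comm]
  congr 3
  exact funext hh

lemma minFace_eq_convexHull (H : IsEdgeSystem C I p e τ r L) {v : I → ℝ} (hv : ∀ i, 0 < v i)
    (c : ℝ) : minFace (orthantHull C I) (edgeFun I τ v c) =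
      convexHull ℝ (minFace C (edgeFun I τ v c)) :=
  minFace_orthantHull_of_pos H.finite (H.edgeFun_pos hv c)

lemma minFace_nonempty (H : IsEdgeSystem C I p e τ r L) {v : I → ℝ} (hv : ∀ i, 0 < v i)
    (c : ℝ) : (minFace (orthantHull C I) (edgeFun I τ v c)).Nonempty :=
  minFace_orthantHull_nonempty H.finite H.nonempty fun i hi => (H.edgeFun_pos hv c i hi).le

lemma minFace_bounded (H : IsEdgeSystem C I p e τ r L) {v : I → ℝ} (hv : ∀ i, 0 < v i)
    (c : ℝ) : Bornology.IsBounded (minFace (orthantHull C I) (edgeFun I τ v c)) :=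
  isBounded_minFace_of_pos H.finite (H.edgeFun_pos hv c)

omit [DecidableEq ι] in
/-- The values of `τ` at the generators are among `r, …, r + L`. -/
lemma exists_nat_eq (H : IsEdgeSystem C I p e τ r L) {a : ι → ℝ} (ha : a ∈ C) :
    ∃ i : ℕ, i ≤ L ∧ intToReal ι τ ⬝ᵥ a = r + i := by
  obtain ⟨z, rfl⟩ := isLatticePoint_iff.1 (H.lattice a ha)
  have h := H.range _ ha
  rw [intToReal_dotProduct] at h ⊢
  have h1 : r ≤ τ ⬝ᵥ z := by exact_mod_cast h.1
  have h2 : τ ⬝ᵥ z ≤ r + L := by exact_mod_cast h.2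
  refine ⟨(τ ⬝ᵥ z - r).toNat, by omega, ?_⟩
  have h3 : τ ⬝ᵥ z = r + (τ ⬝ᵥ z - r).toNat := by omega
  exact_mod_cast h3

/-- The range of `τ` on a support face. -/
lemma exists_range (H : IsEdgeSystem C I p e τ r L) {v : I → ℝ} (hv : ∀ i, 0 < v i) (c : ℝ) :
    ∃ i₀ N : ℕ, i₀ + N ≤ L ∧
      (∀ x ∈ minFace (orthantHull C I) (edgeFun I τ v c),
        (r : ℝ) + i₀ ≤ intToReal ι τ ⬝ᵥ x ∧ intToReal ι τ ⬝ᵥ x ≤ r + i₀ + N) ∧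
      (∃ a ∈ minFace C (edgeFun I τ v c), intToReal ι τ ⬝ᵥ a = r + i₀) ∧
      (∃ b ∈ minFace C (edgeFun I τ v c), intToReal ι τ ⬝ᵥ b = r + i₀ + N) := by
  have hfin : (minFace C (edgeFun I τ v c)).Finite := H.finite.subset fun a ha => ha.1
  have hne := minFace_nonempty_of_finite (edgeFun I τ v c) H.finite H.nonempty
  obtain ⟨a, ha, hamin⟩ := Set.exists_min_image _ (fun a => intToReal ι τ ⬝ᵥ a) hfin hne
  obtain ⟨b, hb, hbmax⟩ := Set.exists_max_image _ (fun a => intToReal ι τ ⬝ᵥ a) hfin hne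
  obtain ⟨i, hiL, hi⟩ := H.exists_nat_eq ha.1
  obtain ⟨j, hjL, hj⟩ := H.exists_nat_eq hb.1
  have hij : i ≤ j := by
    have := hamin b hb
    rw [hi, hj] at this
    exact_mod_cast (add_le_add_iff_left _).1 this
  have hcast : ((j - i : ℕ) : ℝ) = j - i := by push_cast [hij]; ring
  refine ⟨i, j - i, by omega, ?_, ⟨a, ha, hi⟩, b, hb, by rw [hj, hcast]; ring⟩
  rw [H.minFace_eq_convexHull hv]
  intro x hx
  constructor
  · rw [← hi]; exact le_dotProduct_of_mem_convexHull (fun y hy => hamin y hy) hx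
  · have := le_dotProduct_of_mem_convexHull (h := -intToReal ι τ) (c := -(r + j))
      (fun y hy => by rw [neg_dotProduct, neg_le_neg_iff, ← hj]; exact hbmax y hy) hx
    rw [neg_dotProduct, neg_le_neg_iff] at this
    rw [hcast]; linarith

/-- Over the range of a support face, the points of the fibers where `v` is minimal are the fibers
of the support face. -/
lemma minFace_edgeSection {v : I → ℝ} {c t : ℝ} {y : ι → ℝ}
    (hy : y ∈ minFace (orthantHull C I) (edgeFun I τ v c)) (hyt : intToReal ι τ ⬝ᵥ y = t) :
    minFace (edgeSection C I τ t) (extendZero I v) =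
      {x ∈ minFace (orthantHull C I) (edgeFun I τ v c) | intToReal ι τ ⬝ᵥ x = t} := by
  ext x
  constructor
  · rintro ⟨⟨hx, hxt⟩, hmin⟩
    refine ⟨⟨hx, fun z hz => ?_⟩, hxt⟩
    refine le_trans ?_ (hy.2 z hz)
    rw [edgeFun_dotProduct, edgeFun_dotProduct, hxt, hyt]
    have := hmin y ⟨hy.1, hyt⟩
    linarith
  · rintro ⟨⟨hx, hmin⟩, hxt⟩
    refine ⟨⟨hx, hxt⟩, fun z hz => ?_⟩
    have := hmin z hz.1
    rw [edgeFun_dotProduct, edgeFun_dotProduct, hxt, hz.2] at this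
    linarith

/-- The unit interval from `r + k` to `r + k + 1` is in the image of `F` under `τ`. -/
def Crosses (τ : ι → ℤ) (r : ℤ) (F : Set (ι → ℝ)) (k : ℕ) : Prop :=
  (∃ x ∈ F, intToReal ι τ ⬝ᵥ x = r + k) ∧ ∃ y ∈ F, intToReal ι τ ⬝ᵥ y = r + k + 1

/-- A bounded support face between the lattice levels `r + i₀` and `r + i₀ + N` covers exactly the
unit intervals between them. -/
lemma crosses_iff (H : IsEdgeSystem C I p e τ r L) {v : I → ℝ} (hv : ∀ i, 0 < v i) {c : ℝ}
    {i₀ N : ℕ}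
    (hr : ∀ x ∈ minFace (orthantHull C I) (edgeFun I τ v c),
        (r : ℝ) + i₀ ≤ intToReal ι τ ⬝ᵥ x ∧ intToReal ι τ ⬝ᵥ x ≤ r + i₀ + N)
    (ha : ∃ a ∈ minFace C (edgeFun I τ v c), intToReal ι τ ⬝ᵥ a = r + i₀)
    (hb : ∃ b ∈ minFace C (edgeFun I τ v c), intToReal ι τ ⬝ᵥ b = r + i₀ + N) (k : ℕ) :
    Crosses τ r (minFace (orthantHull C I) (edgeFun I τ v c)) k ↔ i₀ ≤ k ∧ k < i₀ + N := by
  constructor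
  · rintro ⟨⟨x, hx, hxk⟩, y, hy, hyk⟩
    have h1 := (hr x hx).1
    have h2 := (hr y hy).2
    rw [hxk] at h1
    rw [hyk] at h2
    have h3 : (i₀ : ℝ) ≤ k := by linarith
    have h4 : (k : ℝ) + 1 ≤ i₀ + N := by linarith
    exact ⟨by exact_mod_cast h3, by exact_mod_cast h4⟩
  · rintro ⟨h1, h2⟩
    obtain ⟨a, ha, hai⟩ := ha
    obtain ⟨b, hb, hbi⟩ := hb
    have h3 : (i₀ : ℝ) ≤ k := by exact_mod_cast h1
    have h4 : (k : ℝ) + 1 ≤ i₀ + N := by exact_mod_cast h2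
    have haF : a ∈ minFace (orthantHull C I) (edgeFun I τ v c) := by
      rw [H.minFace_eq_convexHull hv]; exact subset_convexHull ℝ _ ha
    have hbF : b ∈ minFace (orthantHull C I) (edgeFun I τ v c) := by
      rw [H.minFace_eq_convexHull hv]; exact subset_convexHull ℝ _ hb
    have hconv : Convex ℝ (minFace (orthantHull C I) (edgeFun I τ v c)) := by
      rw [H.minFace_eq_convexHull hv]; exact convex_convexHull ℝ _
    exact ⟨exists_dotProduct_eq_of_convex hconv haF hbF (by linarith) (by linarith),
      exists_dotProduct_eq_of_convex hconv haF hbF (by linarith) (by linarith)⟩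

/-- Over each unit interval there is a bounded support face: the one containing a supporting chord
of the generators over this interval. -/
lemma exists_crosses (H : IsEdgeSystem C I p e τ r L) {v : I → ℝ} (hv : ∀ i, 0 < v i) {k : ℕ}
    (hk : k < L) : ∃ c, Crosses τ r (minFace (orthantHull C I) (edgeFun I τ v c)) k := by
  have hkL : (k : ℝ) + 1 ≤ L := by exact_mod_cast hk
  obtain ⟨a, ha, b, hb, c, hTa, hTb, hab, hmin⟩ := exists_supporting_chord H.finite
    (fun a => intToReal ι τ ⬝ᵥ a) (fun a => extendZero I v ⬝ᵥ a) (r + k) (fun a ha => by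
      obtain ⟨i, -, hi⟩ := H.exists_nat_eq ha
      simp only [hi]
      rcases Nat.lt_or_ge k i with h | h
      · right
        have : (k : ℝ) + 1 ≤ i := by exact_mod_cast h
        linarith
      · left
        have : (i : ℝ) ≤ k := by exact_mod_cast h
        linarith)
    (by
      obtain ⟨a, ha, hai⟩ := H.left
      exact ⟨a, ha, by rw [hai]; linarith [(Nat.cast_nonneg k : (0 : ℝ) ≤ k)]⟩)
    (by
      obtain ⟨a, ha, hai⟩ := H.right
      exact ⟨a, ha, by rw [hai]; linarith⟩)
  refine ⟨c, ?_⟩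
  have hF := H.minFace_eq_convexHull hv c
  have haF : a ∈ minFace C (edgeFun I τ v c) :=
    ⟨ha, fun x hx => by rw [edgeFun_dotProduct, edgeFun_dotProduct]; exact hmin x hx⟩
  have hbF : b ∈ minFace C (edgeFun I τ v c) :=
    ⟨hb, fun x hx => by
      rw [edgeFun_dotProduct, edgeFun_dotProduct, ← hab]; exact hmin x hx⟩
  have hconv : Convex ℝ (minFace (orthantHull C I) (edgeFun I τ v c)) := by
    rw [hF]; exact convex_convexHull ℝ _
  have haF' := subset_convexHull ℝ _ haF
  have hbF' := subset_convexHull ℝ _ hbF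
  rw [← hF] at haF' hbF'
  exact ⟨exists_dotProduct_eq_of_convex hconv haF' hbF' hTa (by linarith),
    exists_dotProduct_eq_of_convex hconv haF' hbF' (by linarith) hTb⟩

omit [DecidableEq ι] in
/-- At most one support face over `v` covers a given unit interval: the least values of `v` over the
end points of the interval determine the slope `c`. -/
lemma eq_of_crosses [DecidableEq ι] {v : I → ℝ} {c c' : ℝ} {k : ℕ}
    (h : Crosses τ r (minFace (orthantHull C I) (edgeFun I τ v c)) k)
    (h' : Crosses τ r (minFace (orthantHull C I) (edgeFun I τ v c')) k) : c = c' := by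
  obtain ⟨⟨x, hx, hxk⟩, y, hy, hyk⟩ := h
  obtain ⟨⟨x', hx', hxk'⟩, y', hy', hyk'⟩ := h'
  have e1 := hx.2 x' hx'.1
  have e2 := hx'.2 x hx.1
  have e3 := hy.2 y' hy'.1
  have e4 := hy'.2 y hy.1
  have e5 := hx.2 y hy.1
  have e6 := hy.2 x hx.1
  have e7 := hx'.2 y' hy'.1
  have e8 := hy'.2 x' hx'.1
  simp only [edgeFun_dotProduct, hxk, hyk, hxk', hyk'] at e1 e2 e3 e4 e5 e6 e7 e8
  linarith

/-- Faces on which `τ` is constant are projected to sets of a smaller dimension. -/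
lemma finrank_map_ne_of_const (H : IsEdgeSystem C I p e τ r L) {F : Set (ι → ℝ)} {t : ℝ}
    (hF : ∀ x ∈ F, intToReal ι τ ⬝ᵥ x = t) :
    Module.finrank ℝ ((faceAnnihilator (orthantHull C I) F).map
        (restrictDual I (orthantHull C I))) ≠
      Module.finrank ℝ (faceAnnihilator (orthantHull C I) F) := by
  intro heq
  rw [finrank_map_eq_iff] at heq
  have h1 : dualOf (orthantHull C I) (intToReal ι τ) ∈ faceAnnihilator (orthantHull C I) F := by
    rw [mem_faceAnnihilator]
    rintro ⟨u, hu⟩ huF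
    have hle : vectorSpan ℝ F ≤ LinearMap.ker (dotProductBilin ℝ ℝ (intToReal ι τ)) := by
      rw [vectorSpan_def, Submodule.span_le]
      rintro _ ⟨x, hx, y, hy, rfl⟩
      change intToReal ι τ ⬝ᵥ (x - y) = 0
      rw [dotProduct_sub, hF x hx, hF y hy, sub_self]
    exact hle huF
  have h2 := heq _ h1 (by
    rw [restrictDual_dualOf H.nonempty]
    ext i
    simp [H.τ_zero i i.2])
  have h3 := congrArg (fun w => w ⟨_, H.e_mem⟩) h2
  simp only [dualOf_apply, LinearMap.zero_apply, intToReal_dotProduct, H.τ_e] at h3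
  norm_num at h3

/-- A one-dimensional support face: lattice length times lattice index is the length of its
projection. -/
lemma value_of_dim_eq_one (H : IsEdgeSystem C I p e τ r L) {v : I → ℝ} (hv : ∀ i, 0 < v i) {c : ℝ}
    {i₀ N : ℕ} (hN : 0 < N)
    (hr : ∀ x ∈ minFace (orthantHull C I) (edgeFun I τ v c),
        (r : ℝ) + i₀ ≤ intToReal ι τ ⬝ᵥ x ∧ intToReal ι τ ⬝ᵥ x ≤ r + i₀ + N)
    (ha : ∃ a ∈ minFace C (edgeFun I τ v c), intToReal ι τ ⬝ᵥ a = r + i₀)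
    (hb : ∃ b ∈ minFace C (edgeFun I τ v c), intToReal ι τ ⬝ᵥ b = r + i₀ + N)
    (hdim : dim (minFace (orthantHull C I) (edgeFun I τ v c)) = 1) :
    Module.finrank ℝ ((faceAnnihilator (orthantHull C I)
        (minFace (orthantHull C I) (edgeFun I τ v c))).map
        (restrictDual I (orthantHull C I))) =
      Module.finrank ℝ (faceAnnihilator (orthantHull C I)
        (minFace (orthantHull C I) (edgeFun I τ v c))) ∧
    latticeVolume (minFace (orthantHull C I) (edgeFun I τ v c)) *
      (latticeIndex (dualLattice (orthantHull C I)) (restrictDual I (orthantHull C I))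
        (faceAnnihilator (orthantHull C I)
          (minFace (orthantHull C I) (edgeFun I τ v c))) : ℝ) = N := by
  obtain ⟨a, ha, hai⟩ := ha
  obtain ⟨b, hb, hbi⟩ := hb
  have hF := H.minFace_eq_convexHull hv c
  have haF' := subset_convexHull ℝ _ ha
  have hbF' := subset_convexHull ℝ _ hb
  rw [← hF] at haF' hbF'
  have hNpos : (0 : ℝ) < N := by exact_mod_cast hN
  set F := minFace (orthantHull C I) (edgeFun I τ v c)
  have hFconv : Convex ℝ F := by rw [hF]; exact convex_convexHull ℝ _
  obtain ⟨za, hza⟩ := isLatticePoint_iff.1 (H.lattice a ha.1)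
  obtain ⟨zb, hzb⟩ := isLatticePoint_iff.1 (H.lattice b hb.1)
  have hτz : τ ⬝ᵥ (zb - za) = N := by
    rw [hza, intToReal_dotProduct] at hai
    rw [hzb, intToReal_dotProduct] at hbi
    have h1 : ((τ ⬝ᵥ zb - τ ⬝ᵥ za : ℤ) : ℝ) = ((N : ℤ) : ℝ) := by push_cast; linarith
    rw [dotProduct_sub]; exact_mod_cast h1
  obtain ⟨f, l, g, hg, hgf, hlf⟩ := exists_primitive (zb - za) (fun h => by
    rw [h, dotProduct_zero] at hτz; omega)
  have hgτ : g * (τ ⬝ᵥ f) = N := by rw [← hτz, hgf, dotProduct_smul, smul_eq_mul]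
  have hτf : 0 < τ ⬝ᵥ f := by
    have h1 : 0 < g * (τ ⬝ᵥ f) := by rw [hgτ]; omega
    exact (pos_iff_pos_of_mul_pos h1).1 hg
  have hgR : (0 : ℝ) < g := by exact_mod_cast hg
  have hba : b - a = (g : ℝ) • intToReal ι f := by
    rw [hza, hzb, ← map_sub, hgf, map_smul, Int.cast_smul_eq_zsmul]
  have hbaF : (g : ℝ) • intToReal ι f ∈ vectorSpan ℝ F := by
    rw [← hba]; exact vsub_mem_vectorSpan ℝ hbF' haF'
  have hfF : intToReal ι f ∈ vectorSpan ℝ F := (Submodule.smul_mem_iff _ hgR.ne').1 hbaF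
  have hf0 : intToReal ι f ≠ 0 := by
    intro h
    have h1 := intToReal_dotProduct l f
    rw [h, dotProduct_zero, hlf] at h1
    norm_num at h1
  have hU : ∀ x, x ∈ vectorSpan ℝ F ↔
      ∃ α β : ℝ, x = α • intToReal ι (0 : ι → ℤ) + β • intToReal ι f := by
    intro x
    constructor
    · intro hx
      obtain ⟨c, hc⟩ := eq_of_dim_eq_one hdim hf0 hfF hx
      exact ⟨0, c, by rw [← hc]; simp⟩
    · rintro ⟨α, β, rfl⟩
      rw [map_zero, smul_zero, zero_add]
      exact Submodule.smul_mem _ _ hfF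
  obtain ⟨h1, h2⟩ := H.latticeIndex_eq (fun x hx => hx.1) hU (dotProduct_zero τ) hτf
    (dotProduct_zero l) hlf
  refine ⟨h1, ?_⟩
  have hseg : F = segment ℝ a (a + (g : ℝ) • intToReal ι f) := by
    apply Set.Subset.antisymm
    · intro x hx
      obtain ⟨β, hβ⟩ := eq_of_dim_eq_one hdim hf0 hfF (vsub_mem_vectorSpan ℝ hx haF')
      rw [mem_segment_add_smul]
      have hxa : x = a + β • intToReal ι f := by rw [hβ]; simp
      have hTx : intToReal ι τ ⬝ᵥ x = r + i₀ + β * ((τ ⬝ᵥ f : ℤ) : ℝ) := by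
        rw [hxa, dotProduct_add, dotProduct_smul, hai, intToReal_dotProduct, smul_eq_mul]
      have hq : (0 : ℝ) < ((τ ⬝ᵥ f : ℤ) : ℝ) := by exact_mod_cast hτf
      have hgq : (g : ℝ) * ((τ ⬝ᵥ f : ℤ) : ℝ) = N := by exact_mod_cast hgτ
      have h3 := hr x hx
      rw [hTx] at h3
      have h4 : 0 ≤ β := by
        by_contra! h
        nlinarith
      have h5 : β ≤ g := by
        by_contra! h
        nlinarith
      refine ⟨β / g, ⟨by positivity, (div_le_one hgR).2 h5⟩, ?_⟩
      rw [div_mul_cancel₀ _ hgR.ne', hxa]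
    · rw [← hba, add_sub_cancel]
      exact hFconv.segment_subset haF' hbF'
  rw [h2, hseg, (dim_latticeVolume_segment hlf a hgR).2]
  exact_mod_cast hgτ

/-- A two-dimensional support face: lattice area times lattice index, in terms of the lattice
lengths of its sections. -/
lemma value_of_dim_eq_two (H : IsEdgeSystem C I p e τ r L) {v : I → ℝ} (hv : ∀ i, 0 < v i) {c : ℝ}
    {i₀ N : ℕ} (hN : 0 < N)
    (hr : ∀ x ∈ minFace (orthantHull C I) (edgeFun I τ v c),
        (r : ℝ) + i₀ ≤ intToReal ι τ ⬝ᵥ x ∧ intToReal ι τ ⬝ᵥ x ≤ r + i₀ + N)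
    (ha : ∃ a ∈ minFace C (edgeFun I τ v c), intToReal ι τ ⬝ᵥ a = r + i₀)
    (hb : ∃ b ∈ minFace C (edgeFun I τ v c), intToReal ι τ ⬝ᵥ b = r + i₀ + N)
    (hdim : dim (minFace (orthantHull C I) (edgeFun I τ v c)) = 2) :
    (Module.finrank ℝ ((faceAnnihilator (orthantHull C I)
        (minFace (orthantHull C I) (edgeFun I τ v c))).map
        (restrictDual I (orthantHull C I))) =
      Module.finrank ℝ (faceAnnihilator (orthantHull C I)
        (minFace (orthantHull C I) (edgeFun I τ v c))) ∧
    latticeVolume (minFace (orthantHull C I) (edgeFun I τ v c)) *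
      (latticeIndex (dualLattice (orthantHull C I)) (restrictDual I (orthantHull C I))
        (faceAnnihilator (orthantHull C I)
          (minFace (orthantHull C I) (edgeFun I τ v c))) : ℝ) =
      ∑ k ∈ Finset.range N,
        (latticeLength (minFace (edgeSection C I τ (r + (i₀ + k : ℕ))) (extendZero I v)) +
        latticeLength (minFace (edgeSection C I τ (r + (i₀ + k + 1 : ℕ))) (extendZero I v)))) ∧
    ∀ k ≤ N, ∃ (x : ι → ℝ) (u l : ι → ℤ) (ψ : ℝ), l ⬝ᵥ u = 1 ∧ 0 ≤ ψ ∧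
      minFace (edgeSection C I τ (r + (i₀ + k : ℕ))) (extendZero I v) =
        segment ℝ x (x + ψ • intToReal ι u) := by
  obtain ⟨a, ha, hai⟩ := ha
  obtain ⟨b, hb, hbi⟩ := hb
  have hF := H.minFace_eq_convexHull hv c
  have haF' := subset_convexHull ℝ _ ha
  have hbF' := subset_convexHull ℝ _ hb
  rw [← hF] at haF' hbF'
  have hDF : minFace C (edgeFun I τ v c) ⊆ minFace (orthantHull C I) (edgeFun I τ v c) := by
    rw [hF]; exact subset_convexHull ℝ _
  have hFconv : Convex ℝ (minFace (orthantHull C I) (edgeFun I τ v c)) := by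
    rw [hF]; exact convex_convexHull ℝ _
  have hNpos : (0 : ℝ) < N := by exact_mod_cast hN
  obtain ⟨u, f, l, m, ⟨hlu, hlf, hmu, hmf, hτu, hτf, hU⟩, ψ, hψ, hvol⟩ :=
    exists_sections_of_polygon (D := minFace C (edgeFun I τ v c))
      (H.finite.subset fun a ha => ha.1) (fun a ha => H.lattice a ha.1) (by rw [← hF]; exact hdim)
      τ (r + i₀) N hN (fun x hx => by
        have := hr x (hDF hx)
        push_cast; exact this) ha hb (by rw [hai]; push_cast; ring) (by rw [hbi]; push_cast; ring)
  rw [← hF] at hψ hvol hU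
  have hsec : ∀ k ≤ N, minFace (edgeSection C I τ (r + (i₀ + k : ℕ))) (extendZero I v) =
      {y ∈ minFace (orthantHull C I) (edgeFun I τ v c) |
        intToReal ι τ ⬝ᵥ y = ((r + i₀ : ℤ) : ℝ) + k} := by
    intro k hk
    have hkN : (k : ℝ) ≤ N := by exact_mod_cast hk
    have hk0 : (0 : ℝ) ≤ k := by positivity
    obtain ⟨y, hy, hyt⟩ := exists_dotProduct_eq_of_convex (t := (r : ℝ) + (i₀ + k : ℕ)) hFconv haF'
      hbF' (by rw [hai]; push_cast; linarith) (by rw [hbi]; push_cast; linarith)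
    rw [minFace_edgeSection hy hyt]
    push_cast
    rw [add_assoc]
  have hlen : ∀ k ≤ N,
      latticeLength (minFace (edgeSection C I τ (r + (i₀ + k : ℕ))) (extendZero I v)) = ψ k := by
    intro k hk
    obtain ⟨hψ0, x, hx⟩ := hψ k hk
    rw [hsec k hk, hx, latticeLength_segment hlu x hψ0]
  refine ⟨?_, ?_⟩
  · have hU' : ∀ x, x ∈ vectorSpan ℝ (minFace (orthantHull C I) (edgeFun I τ v c)) ↔
        ∃ α β : ℝ, x = α • intToReal ι u + β • intToReal ι f := by
      intro x
      rw [hU, Submodule.mem_span_range_iff_exists_fun]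
      constructor
      · rintro ⟨c, rfl⟩
        exact ⟨c 0, c 1, by simp [Fin.sum_univ_two]⟩
      · rintro ⟨α, β, rfl⟩
        exact ⟨![α, β], by simp [Fin.sum_univ_two]⟩
    obtain ⟨h1, h2⟩ := H.latticeIndex_eq (fun x hx => hx.1) hU' hτu hτf hmu hmf
    refine ⟨h1, ?_⟩
    rw [h2, hvol]
    refine Finset.sum_congr rfl fun k hk => ?_
    have hk' := Finset.mem_range.1 hk
    rw [hlen k hk'.le, add_assoc i₀ k 1, hlen (k + 1) hk']
  · intro k hk
    obtain ⟨hψ0, x, hx⟩ := hψ k hk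
    exact ⟨x, u, l, ψ k, hlu, hψ0, by rw [hsec k hk, hx]⟩

omit [DecidableEq ι] in
/-- Support faces crossing a unit interval are not points; the sections of the one-dimensional
ones are points. -/
lemma dim_of_crosses {F : Set (ι → ℝ)} {k : ℕ} (h : Crosses τ r F k) :
    0 < dim F ∧ (dim F = 1 → ∀ t, {x ∈ F | intToReal ι τ ⬝ᵥ x = t}.Subsingleton) := by
  obtain ⟨⟨x, hx, hxk⟩, y, hy, hyk⟩ := h
  have hmem : y - x ∈ vectorSpan ℝ F := vsub_mem_vectorSpan ℝ hy hx
  have hT : intToReal ι τ ⬝ᵥ (y - x) = 1 := by rw [dotProduct_sub, hxk, hyk]; ring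
  have h0 : y - x ≠ 0 := by
    intro h
    rw [h, dotProduct_zero] at hT
    exact one_ne_zero hT.symm
  constructor
  · unfold dim
    rw [Module.finrank_pos_iff_exists_ne_zero]
    exact ⟨⟨y - x, hmem⟩, fun h => h0 (congrArg Subtype.val h)⟩
  · rintro hdim t z ⟨hz, hzt⟩ w ⟨hw, hwt⟩
    obtain ⟨c, hc⟩ := eq_of_dim_eq_one hdim h0 hmem (vsub_mem_vectorSpan ℝ hz hw)
    rw [vsub_eq_sub] at hc
    have h1 : c = 0 := by
      have h2 := congrArg (fun x => intToReal ι τ ⬝ᵥ x) hc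
      simpa only [dotProduct_smul, hT, dotProduct_sub, hzt, hwt, smul_eq_mul, mul_one,
        sub_self] using h2
    rw [h1, zero_smul] at hc
    exact (sub_eq_zero.1 hc.symm)

/-- The weight of the projected fan is the sum of contributions of the unit intervals, because
every unit interval is crossed by exactly one support face. -/
lemma weightAt_eq_sum (H : IsEdgeSystem C I p e τ r L) {v : I → ℝ} (hv : ∀ i, 0 < v i) (d : ℕ)
    (w : ℕ → ℝ)
    (hval : ∀ (c : ℝ) (i₀ N : ℕ), 0 < N →
      (∀ x ∈ minFace (orthantHull C I) (edgeFun I τ v c),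
        (r : ℝ) + i₀ ≤ intToReal ι τ ⬝ᵥ x ∧ intToReal ι τ ⬝ᵥ x ≤ r + i₀ + N) →
      (∃ a ∈ minFace C (edgeFun I τ v c), intToReal ι τ ⬝ᵥ a = r + i₀) →
      (∃ b ∈ minFace C (edgeFun I τ v c), intToReal ι τ ⬝ᵥ b = r + i₀ + N) →
      dim (minFace (orthantHull C I) (edgeFun I τ v c)) = d →
      Module.finrank ℝ ((faceAnnihilator (orthantHull C I)
        (minFace (orthantHull C I) (edgeFun I τ v c))).map
        (restrictDual I (orthantHull C I))) =
      Module.finrank ℝ (faceAnnihilator (orthantHull C I)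
        (minFace (orthantHull C I) (edgeFun I τ v c))) ∧
      latticeVolume (minFace (orthantHull C I) (edgeFun I τ v c)) *
      (latticeIndex (dualLattice (orthantHull C I)) (restrictDual I (orthantHull C I))
        (faceAnnihilator (orthantHull C I)
          (minFace (orthantHull C I) (edgeFun I τ v c))) : ℝ) =
      ∑ k ∈ Finset.range N, w (i₀ + k))
    (hdim : ∀ (c : ℝ) (k : ℕ), Crosses τ r (minFace (orthantHull C I) (edgeFun I τ v c)) k →
      w k ≠ 0 → dim (minFace (orthantHull C I) (edgeFun I τ v c)) = d) :
    weightAt (pushforward (dualLattice (orthantHull C I)) (restrictDual I (orthantHull C I))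
      (charClass (orthantHull C I) d)) v = (-1 : ℝ) ^ (d + 1) * ∑ k ∈ Finset.range L, w k := by
  classical
  set Γ := orthantHull C I
  rw [weightAt_pushforward_charClass H.finite]
  congr 1
  -- the value of a face, as a sum over the unit intervals which it crosses
  have hface : ∀ F ∈ (finite_boundedFaces (I := (I : Set ι)) H.finite d).toFinset,
      (if Module.finrank ℝ ((faceAnnihilator Γ F).map (restrictDual I Γ)) =
          Module.finrank ℝ (faceAnnihilator Γ F) ∧ v ∈ restrictDual I Γ '' normalCone Γ F then
        latticeVolume F * (latticeIndex (dualLattice Γ) (restrictDual I Γ)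
          (faceAnnihilator Γ F) : ℝ) else 0) =
      ∑ k ∈ Finset.range L,
        if (∃ c, F = minFace Γ (edgeFun I τ v c)) ∧ Crosses τ r F k then w k else 0 := by
    intro F hF
    rw [Set.Finite.mem_toFinset] at hF
    by_cases hc : ∃ c, F = minFace Γ (edgeFun I τ v c)
    · obtain ⟨c, rfl⟩ := hc
      obtain ⟨i₀, N, hiN, hr, ha, hb⟩ := H.exists_range hv c
      have hcr := H.crosses_iff hv hr ha hb
      have hmem : v ∈ restrictDual I Γ '' normalCone Γ (minFace Γ (edgeFun I τ v c)) :=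
        (mem_restrictDual_image_normalCone H.nonempty).2 ⟨_, H.edgeFun_apply v c, rfl⟩
      rcases Nat.eq_zero_or_pos N with rfl | hN
      · rw [if_neg, Finset.sum_eq_zero]
        · intro k _
          rw [if_neg]
          rintro ⟨-, hk⟩
          have := (hcr k).1 hk
          omega
        · rintro ⟨h1, -⟩
          refine H.finrank_map_ne_of_const (t := r + i₀) (fun x hx => ?_) h1
          have := hr x hx
          simp only [Nat.cast_zero, add_zero] at this
          exact le_antisymm this.2 this.1
      · obtain ⟨h1, h2⟩ := hval c i₀ N hN hr ha hb hF.2.2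
        rw [if_pos ⟨h1, hmem⟩, h2]
        have h3 : ∀ k, (if (∃ c', minFace Γ (edgeFun I τ v c) = minFace Γ (edgeFun I τ v c')) ∧
            Crosses τ r (minFace Γ (edgeFun I τ v c)) k then w k else 0) =
            if k ∈ Finset.Ico i₀ (i₀ + N) then w k else 0 := by
          intro k
          congr 1
          rw [Finset.mem_Ico, ← hcr k]
          exact propext ⟨fun h => h.2, fun h => ⟨⟨c, rfl⟩, h⟩⟩
        simp_rw [h3]
        rw [← Finset.sum_filter]
        have h4 : (Finset.range L).filter (fun k => k ∈ Finset.Ico i₀ (i₀ + N)) =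
            Finset.Ico i₀ (i₀ + N) := by
          ext k
          simp only [Finset.mem_filter, Finset.mem_range, Finset.mem_Ico]
          omega
        rw [h4, Finset.sum_Ico_eq_sum_range, Nat.add_sub_cancel_left]
    · rw [if_neg, Finset.sum_eq_zero]
      · intro k _
        rw [if_neg fun h => hc h.1]
      · rintro ⟨-, h2⟩
        obtain ⟨h, hh, rfl⟩ := (mem_restrictDual_image_normalCone H.nonempty).1 h2
        exact hc ⟨_, H.minFace_eq v hh⟩
  rw [Finset.sum_congr rfl hface, Finset.sum_comm]
  refine Finset.sum_congr rfl fun k hk => ?_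
  obtain ⟨c, hc⟩ := H.exists_crosses hv (Finset.mem_range.1 hk)
  by_cases hw : w k = 0
  · rw [hw]; simp
  · rw [Finset.sum_eq_single (minFace Γ (edgeFun I τ v c)), if_pos ⟨⟨c, rfl⟩, hc⟩]
    · intro F _ hne
      rw [if_neg]
      rintro ⟨⟨c', rfl⟩, hc'⟩
      exact hne (by rw [eq_of_crosses hc hc'])
    · intro hnot
      exfalso
      apply hnot
      rw [Set.Finite.mem_toFinset]
      exact ⟨isFace_iff.2 ⟨H.minFace_nonempty hv c, _, rfl⟩, H.minFace_bounded hv c,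
        hdim c k hc hw⟩

/-- The component of codimension `0` at a generic covector. -/
lemma weightAt_zero (H : IsEdgeSystem C I p e τ r L) {v : I → ℝ} (hv : ∀ i, 0 < v i)
    (hgen : ∀ h : ι → ℝ, (∀ i : I, h i = v i) → (minFace (orthantHull C I) h).Nonempty →
        Bornology.IsBounded (minFace (orthantHull C I) h) →
        dim (minFace (orthantHull C I) h) < 2) :
    weightAt (pushforward (dualLattice (orthantHull C I)) (restrictDual I (orthantHull C I))
      (charClass (orthantHull C I) 1)) v = L := by
  rw [H.weightAt_eq_sum hv 1 fun _ => 1]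
  · simp
  · intro c i₀ N hN hr ha hb hdim
    have := H.value_of_dim_eq_one hv hN hr ha hb hdim
    simpa using this
  · intro c k hc _
    have h1 := (dim_of_crosses hc).1
    have h2 := hgen _ (H.edgeFun_apply v c) (H.minFace_nonempty hv c) (H.minFace_bounded hv c)
    omega

/-- The component of codimension `1` at a generic covector. -/
lemma weightAt_one (H : IsEdgeSystem C I p e τ r L) {v : I → ℝ} (hv : ∀ i, 0 < v i)
    (hgen : ∀ h : ι → ℝ, (∀ i : I, h i = v i) → (minFace (orthantHull C I) h).Nonempty →
        Bornology.IsBounded (minFace (orthantHull C I) h) →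
        dim (minFace (orthantHull C I) h) < 3) :
    weightAt (pushforward (dualLattice (orthantHull C I)) (restrictDual I (orthantHull C I))
      (charClass (orthantHull C I) 2)) v =
    -∑ k ∈ Finset.range L,
      (latticeLength (minFace (edgeSection C I τ (r + (k : ℕ))) (extendZero I v)) +
      latticeLength (minFace (edgeSection C I τ (r + (k + 1 : ℕ))) (extendZero I v))) := by
  rw [H.weightAt_eq_sum hv 2 fun k =>
    (latticeLength (minFace (edgeSection C I τ (r + (k : ℕ))) (extendZero I v)) +
      latticeLength (minFace (edgeSection C I τ (r + (k + 1 : ℕ))) (extendZero I v)))]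
  · ring
  · intro c i₀ N hN hr ha hb hdim
    exact (H.value_of_dim_eq_two hv hN hr ha hb hdim).1
  · intro c k hc hw
    obtain ⟨h1, h3⟩ := dim_of_crosses hc
    have h2 := hgen _ (H.edgeFun_apply v c) (H.minFace_nonempty hv c) (H.minFace_bounded hv c)
    by_contra hne
    have hdim : dim (minFace (orthantHull C I) (edgeFun I τ v c)) = 1 := by omega
    apply hw
    obtain ⟨⟨x, hx, hxk⟩, y, hy, hyk⟩ := hc
    rw [minFace_edgeSection hx hxk, minFace_edgeSection hy (by rw [hyk]; push_cast; ring),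
      latticeLength_of_subsingleton (h3 hdim _), latticeLength_of_subsingleton (h3 hdim _),
      add_zero]

/-- At a generic covector, the minimal points of the fibers form segments. -/
lemma latticeLength_section (H : IsEdgeSystem C I p e τ r L) {v : I → ℝ} (hv : ∀ i, 0 < v i)
    (hgen : ∀ h : ι → ℝ, (∀ i : I, h i = v i) → (minFace (orthantHull C I) h).Nonempty →
        Bornology.IsBounded (minFace (orthantHull C I) h) →
        dim (minFace (orthantHull C I) h) < 3) {k : ℕ} (hk : k ≤ L) :
    0 ≤ latticeLength (minFace (edgeSection C I τ (r + (k : ℕ))) (extendZero I v)) ∧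
    (latticeLength (minFace (edgeSection C I τ (r + (k : ℕ))) (extendZero I v)) = 0 →
      (minFace (edgeSection C I τ (r + (k : ℕ))) (extendZero I v)).Subsingleton) := by
  obtain ⟨k', hk'L, hkk'⟩ : ∃ k' < L, k = k' ∨ k = k' + 1 := by
    have := H.pos
    rcases Nat.eq_zero_or_pos k with h | h
    · exact ⟨0, this, Or.inl h⟩
    · exact ⟨k - 1, by omega, Or.inr (by omega)⟩
  obtain ⟨c, hc⟩ := H.exists_crosses hv hk'L
  obtain ⟨h1, h3⟩ := dim_of_crosses hc
  have h2 := hgen _ (H.edgeFun_apply v c) (H.minFace_nonempty hv c) (H.minFace_bounded hv c)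
  obtain ⟨i₀, N, hiN, hr, ha, hb⟩ := H.exists_range hv c
  have hcr := (H.crosses_iff hv hr ha hb k').1 hc
  rcases (by omega : dim (minFace (orthantHull C I) (edgeFun I τ v c)) = 1 ∨
    dim (minFace (orthantHull C I) (edgeFun I τ v c)) = 2) with hdim | hdim
  · have hS : (minFace (edgeSection C I τ (r + (k : ℕ))) (extendZero I v)).Subsingleton := by
      obtain ⟨⟨x, hx, hxk⟩, y, hy, hyk⟩ := hc
      rcases hkk' with rfl | rfl
      · rw [minFace_edgeSection hx hxk]; exact h3 hdim _
      · rw [minFace_edgeSection hy (by rw [hyk]; push_cast; ring)]; exact h3 hdim _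
    exact ⟨(latticeLength_of_subsingleton hS).ge, fun _ => hS⟩
  · have hki : k = i₀ + (k - i₀) := by omega
    obtain ⟨x, u, l, ψ, hlu, hψ, hseg⟩ := (H.value_of_dim_eq_two hv (by omega) hr ha hb hdim).2
      (k - i₀) (by omega)
    rw [← hki] at hseg
    rw [hseg, latticeLength_segment hlu x hψ]
    refine ⟨hψ, ?_⟩
    rintro rfl
    simp

/-- If for generic positive covectors the minimal points of a fiber are unique, then this fiber is
a shifted orthant. -/
lemma exists_least_section (H : IsEdgeSystem C I p e τ r L) {k : ℕ} (hk : k ≤ L)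
    (S : Finset (Submodule ℝ (I → ℝ)))
    (hS : ∀ W ∈ S, Module.finrank ℝ W + 1 < Module.finrank ℝ (I → ℝ))
    (huniq : ∀ v : I → ℝ, (∀ i, 0 < v i) → (∀ W ∈ S, v ∉ W) →
      (minFace (edgeSection C I τ (r + (k : ℕ))) (extendZero I v)).Subsingleton) :
    ∃ x₀ ∈ edgeSection C I τ (r + (k : ℕ)),
      ∀ x ∈ edgeSection C I τ (r + (k : ℕ)), ∀ i ∈ I, x₀ i ≤ x i := by
  obtain ⟨k', hk'L, hkk'⟩ : ∃ k' < L, k = k' ∨ k = k' + 1 := by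
    have := H.pos
    rcases Nat.eq_zero_or_pos k with h | h
    · exact ⟨0, this, Or.inl h⟩
    · exact ⟨k - 1, by omega, Or.inr (by omega)⟩
  set T := intToReal ι τ with hT
  set t : ℝ := r + (k : ℕ) with ht
  have htk : (r : ℝ) + k' ≤ t ∧ t ≤ r + k' + 1 := by
    rcases hkk' with rfl | rfl
    · constructor <;> linarith
    · rw [ht]; push_cast; constructor <;> linarith
  -- the points of the chords of the strip over `t`
  set pt : (ι → ℝ) × (ι → ℝ) → ι → ℝ := fun s =>
    s.1 + ((t - T ⬝ᵥ s.1) / (T ⬝ᵥ s.2 - T ⬝ᵥ s.1)) • (s.2 - s.1) with hpt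
  set Z : Set ((ι → ℝ) × (ι → ℝ)) :=
    {a ∈ C | T ⬝ᵥ a ≤ r + k'} ×ˢ {b ∈ C | (r : ℝ) + k' + 1 ≤ T ⬝ᵥ b} with hZ
  have hZfin : Z.Finite :=
    (H.finite.subset fun a ha => ha.1).prod (H.finite.subset fun a ha => ha.1)
  have hY : ∀ s ∈ Z, pt s ∈ edgeSection C I τ t := by
    rintro ⟨a, b⟩ ⟨⟨haC, ha⟩, hbC, hb⟩
    simp only at haC ha hbC hb
    have hab : 0 < T ⬝ᵥ b - T ⬝ᵥ a := by linarith
    constructor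
    · apply (convex_orthantHull C I).segment_subset (subset_orthantHull C I haC)
        (subset_orthantHull C I hbC)
      rw [segment_eq_image']
      exact ⟨_, ⟨div_nonneg (by linarith) hab.le, (div_le_one hab).2 (by linarith)⟩, rfl⟩
    · simp only [hpt]
      rw [dotProduct_add, dotProduct_smul, dotProduct_sub, smul_eq_mul, ← hT,
        div_mul_cancel₀ _ hab.ne']
      ring
  -- the minimum of `v` on the fiber is attained on a chord
  have hle : ∀ v : I → ℝ, (∀ i, 0 ≤ v i) → ∃ s ∈ Z, ∀ x ∈ edgeSection C I τ t,
      extendZero I v ⬝ᵥ pt s ≤ extendZero I v ⬝ᵥ x := by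
    intro v hv
    have hkL : (k' : ℝ) + 1 ≤ L := by exact_mod_cast hk'L
    obtain ⟨a, ha, b, hb, c, hTa, hTb, hab, hmin⟩ := exists_supporting_chord H.finite
      (fun a => T ⬝ᵥ a) (fun a => extendZero I v ⬝ᵥ a) (r + k') (fun a ha => by
        obtain ⟨i, -, hi⟩ := H.exists_nat_eq ha
        simp only [hT, hi]
        rcases Nat.lt_or_ge k' i with h | h
        · right
          have : (k' : ℝ) + 1 ≤ i := by exact_mod_cast h
          linarith
        · left
          have : (i : ℝ) ≤ k' := by exact_mod_cast h
          linarith)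
      (by
        obtain ⟨a, ha, hai⟩ := H.left
        exact ⟨a, ha, by rw [hai]; linarith [(Nat.cast_nonneg k' : (0 : ℝ) ≤ k')]⟩)
      (by
        obtain ⟨a, ha, hai⟩ := H.right
        exact ⟨a, ha, by rw [hai]; linarith⟩)
    refine ⟨(a, b), ⟨⟨ha, hTa⟩, hb, hTb⟩, ?_⟩
    rintro x ⟨hx, hxt⟩
    have h1 : edgeFun I τ v c ⬝ᵥ a ≤ edgeFun I τ v c ⬝ᵥ x := by
      obtain ⟨y, hy, hyx1, hyx2⟩ := hx
      refine (le_dotProduct_of_mem_convexHull (fun z hz => ?_) hy).trans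
        (dotProduct_le_of_up (I := (I : Set ι)) (fun i hi => ?_) hyx1 hyx2)
      · rw [edgeFun_dotProduct, edgeFun_dotProduct]; exact hmin z hz
      · have := H.edgeFun_apply v c ⟨i, hi⟩
        simp only at this
        rw [this]; exact hv _
    rw [edgeFun_dotProduct, edgeFun_dotProduct, ← hT] at h1
    rw [← hT] at hxt
    have h2 : extendZero I v ⬝ᵥ pt (a, b) + c * t = extendZero I v ⬝ᵥ a + c * (T ⬝ᵥ a) := by
      have hab' : 0 < T ⬝ᵥ b - T ⬝ᵥ a := by linarith
      simp only [hpt]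
      rw [dotProduct_add, dotProduct_smul, dotProduct_sub, smul_eq_mul]
      have h3 : extendZero I v ⬝ᵥ b - extendZero I v ⬝ᵥ a = -c * (T ⬝ᵥ b - T ⬝ᵥ a) := by linarith
      rw [h3]
      field_simp
      ring
    rw [hxt] at h1
    linarith
  have hZne : Z.Nonempty := by
    obtain ⟨s, hs, -⟩ := hle (fun _ => 0) fun _ => le_rfl
    exact ⟨s, hs⟩
  have hext : ∀ (v : I → ℝ) (x : ι → ℝ), extendZero I v ⬝ᵥ x = v ⬝ᵥ (fun i : I => x i) := by
    intro v x
    unfold dotProduct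
    rw [← Finset.sum_subset (Finset.subset_univ I) (fun i _ hi => by
      rw [extendZero_of_notMem v hi, zero_mul]), ← Finset.sum_coe_sort I]
    simp
  obtain ⟨x₀, ⟨s₀, hs₀, rfl⟩, hx₀⟩ := exists_least_of_unique_minimizers
    (Y := (fun s => fun i : I => pt s i) '' Z) (hZfin.image _) (hZne.image _) S hS (by
      intro v hv hvS
      have hmem : ∀ s ∈ Z, (fun i : I => pt s i) ∈ minFace ((fun s => fun i : I => pt s i) '' Z) v →
          pt s ∈ minFace (edgeSection C I τ t) (extendZero I v) := by
        intro s hs hmin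
        refine ⟨hY s hs, fun x hx => ?_⟩
        obtain ⟨s', hs', hs'x⟩ := hle v fun i => (hv i).le
        refine le_trans ?_ (hs'x x hx)
        rw [hext, hext]
        exact hmin.2 _ ⟨s', hs', rfl⟩
      rintro _ hx _ hy
      obtain ⟨s, hs, rfl⟩ := hx.1
      obtain ⟨s', hs', rfl⟩ := hy.1
      have := huniq v hv hvS (hmem s hs hx) (hmem s' hs' hy)
      simp only [this])
  refine ⟨pt s₀, hY s₀ hs₀, fun x hx i hi => ?_⟩
  obtain ⟨s, hs, hsx⟩ := hle (Pi.single ⟨i, hi⟩ 1) fun j => by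
    by_cases h : j = ⟨i, hi⟩
    · subst h; simp
    · simp [h]
  refine (hx₀ _ ⟨s, hs, rfl⟩ ⟨i, hi⟩).trans ?_
  have := hsx x hx
  rw [hext, hext] at this
  simpa using this

end IsEdgeSystem

end EdgeWeights

/-! ### Weights of polyhedra over a vertex -/

section VertexWeights

variable {ι : Type*} [Fintype ι] [DecidableEq ι]

/-- The weight at `v` of the direct image of the codimension `d` component of `⟨Γ⟩`. -/
noncomputable def faceWeight (I : Finset ι) (Γ : Set (ι → ℝ)) (d : ℕ) (v : I → ℝ) : ℝ :=
  weightAt (pushforward (dualLattice Γ) (restrictDual I Γ) (charClass Γ d)) v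

lemma eq_zero_of_mem_vectorSpan {C : Set (ι → ℝ)} {I : Finset ι} {b : ι → ℝ}
    (hCb : ∀ a ∈ C, ∀ j ∉ I, a j = b j) {u : ι → ℝ} (hu : u ∈ vectorSpan ℝ (orthantHull C I))
    {j : ι} (hj : j ∉ I) : u j = 0 := by
  have hC : ∀ y ∈ orthantHull C I, y j = b j := by
    rintro y ⟨z, hz, -, hzy⟩
    rw [← hzy j (by simpa using hj)]
    have := dotProduct_const_of_mem_convexHull (h := Pi.single j 1) (c := b j)
      (fun a ha => by simpa using hCb a ha j hj) hz
    simpa using this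
  have hle : vectorSpan ℝ (orthantHull C I) ≤ 
      LinearMap.ker (LinearMap.proj j : (ι → ℝ) →ₗ[ℝ] ℝ) := by
    rw [vectorSpan_def, Submodule.span_le]
    rintro _ ⟨x, hx, y, hy, rfl⟩
    change x j - y j = 0
    rw [hC x hx, hC y hy, sub_self]
  exact hle hu

lemma extendZero_dotProduct_of_support {I : Finset ι} (h : ι → ℝ) {u : ι → ℝ}
    (hu : ∀ j ∉ I, u j = 0) : extendZero I (fun i : I => h i) ⬝ᵥ u = h ⬝ᵥ u := by
  unfold dotProduct
  refine Finset.sum_congr rfl fun i _ => ?_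
  by_cases hi : i ∈ I
  · rw [extendZero_of_mem _ hi]
  · rw [hu i hi, mul_zero, mul_zero]

open Classical in
/-- For a polyhedron parallel to `ℝ^I`, the dual fans are not changed by the projection. -/
lemma faceWeight_of_parallel {C : Set (ι → ℝ)} {I : Finset ι} (hC : C.Finite) (hne : C.Nonempty)
    {b : ι → ℝ} (hCb : ∀ a ∈ C, ∀ j ∉ I, a j = b j) (d : ℕ) {v : I → ℝ} (hv : ∀ i, 0 < v i) :
    faceWeight I (orthantHull C I) d v = (-1 : ℝ) ^ (d + 1) *
      if dim (minFace (orthantHull C I) (extendZero I v)) = d then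
        latticeVolume (minFace (orthantHull C I) (extendZero I v)) else 0 := by
  set Γ := orthantHull C I with hΓ
  set F₀ := minFace Γ (extendZero I v) with hF₀
  have hpos : ∀ i ∈ (I : Set ι), 0 < extendZero I v i := fun i hi => by
    rw [extendZero_of_mem v (Finset.mem_coe.1 hi)]; exact hv _
  have hF₀face : IsFace Γ F₀ := isFace_iff.2 ⟨minFace_orthantHull_nonempty hC hne
    fun i hi => (hpos i hi).le, _, rfl⟩
  have hF₀b : Bornology.IsBounded F₀ := isBounded_minFace_of_pos hC hpos
  have hinj : Function.Injective (restrictDual I Γ) := by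
    rw [← LinearMap.ker_eq_bot, Submodule.eq_bot_iff]
    intro w hw
    obtain ⟨h, rfl⟩ := exists_eq_dualOf _ w
    rw [LinearMap.mem_ker, restrictDual_dualOf hne] at hw
    ext ⟨u, hu⟩
    rw [dualOf_apply, ← extendZero_dotProduct_of_support (I := I) h
      fun j hj => eq_zero_of_mem_vectorSpan hCb hu hj, hw]
    simp
  have hidx : ∀ W : Submodule ℝ (DualSpace Γ),
      latticeIndex (dualLattice Γ) (restrictDual I Γ) W = 1 := by
    intro W
    unfold latticeIndex
    have h1 : (W.map (restrictDual I Γ)).toAddSubgroup =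
        W.toAddSubgroup.map (restrictDual I Γ).toAddMonoidHom := rfl
    rw [h1, AddSubgroup.map_inf_eq _ _ _ hinj, AddSubgroup.relIndex_self]
  have hrank : ∀ W : Submodule ℝ (DualSpace Γ),
      Module.finrank ℝ (W.map (restrictDual I Γ)) = Module.finrank ℝ W := by
    intro W
    rw [finrank_map_eq_iff]
    intro w _ hw
    exact hinj (hw.trans (map_zero _).symm)
  have hmem : ∀ F, v ∈ restrictDual I Γ '' normalCone Γ F ↔ F = F₀ := by
    intro F
    rw [mem_restrictDual_image_normalCone hne]
    constructor
    · rintro ⟨h, hhv, rfl⟩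
      refine minFace_congr fun u hu => ?_
      rw [← extendZero_dotProduct_of_support (I := I) h
        fun j hj => eq_zero_of_mem_vectorSpan hCb hu hj]
      congr 2
      exact funext hhv
    · rintro rfl
      exact ⟨_, extendZero_coe I v, rfl⟩
  unfold faceWeight
  rw [weightAt_pushforward_charClass hC]
  congr 1
  have hterm : ∀ F, (if Module.finrank ℝ ((faceAnnihilator Γ F).map (restrictDual I Γ)) =
      Module.finrank ℝ (faceAnnihilator Γ F) ∧ v ∈ restrictDual I Γ '' normalCone Γ F then
      latticeVolume F * (latticeIndex (dualLattice Γ) (restrictDual I Γ)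
        (faceAnnihilator Γ F) : ℝ) else 0) = if F = F₀ then latticeVolume F else 0 := by
    intro F
    rw [hidx, Nat.cast_one, mul_one]
    exact if_congr ⟨fun h => (hmem F).1 h.2, fun h => ⟨hrank _, (hmem F).2 h⟩⟩ rfl rfl
  rw [Finset.sum_congr rfl fun F _ => hterm F, Finset.sum_ite_eq' _ F₀ latticeVolume]
  congr 1
  rw [Set.Finite.mem_toFinset]
  exact propext ⟨fun h => h.2.2, fun h => ⟨hF₀face, hF₀b, h⟩⟩

lemma faceWeight_zero_of_parallel {C : Set (ι → ℝ)} {I : Finset ι} (hC : C.Finite)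
    (hne : C.Nonempty) {b : ι → ℝ} (hCb : ∀ a ∈ C, ∀ j ∉ I, a j = b j) {v : I → ℝ}
    (hv : ∀ i, 0 < v i) (hgen : dim (minFace (orthantHull C I) (extendZero I v)) < 1) :
    faceWeight I (orthantHull C I) 0 v = -1 := by
  have hpos : ∀ i ∈ (I : Set ι), 0 < extendZero I v i := fun i hi => by
    rw [extendZero_of_mem v (Finset.mem_coe.1 hi)]; exact hv _
  obtain ⟨x, hx⟩ := minFace_orthantHull_nonempty (I := (I : Set ι)) hC hne
    fun i hi => (hpos i hi).le
  have h0 : dim (minFace (orthantHull C I) (extendZero I v)) = 0 := by omega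
  have hsub : minFace (orthantHull C I) (extendZero I v) = {x} := by
    refine Set.eq_singleton_iff_unique_mem.2 ⟨hx, fun y hy => ?_⟩
    have h1 := vsub_mem_vectorSpan ℝ hy hx
    rw [Submodule.finrank_eq_zero.1 h0, Submodule.mem_bot] at h1
    exact sub_eq_zero.1 h1
  rw [faceWeight_of_parallel hC hne hCb 0 hv, if_pos h0, hsub, latticeVolume_singleton]
  norm_num

lemma faceWeight_one_of_parallel {C : Set (ι → ℝ)} {I : Finset ι} (hC : C.Finite)
    (hne : C.Nonempty) {b : ι → ℝ} (hCb : ∀ a ∈ C, ∀ j ∉ I, a j = b j) {v : I → ℝ}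
    (hv : ∀ i, 0 < v i) :
    faceWeight I (orthantHull C I) 1 v =
      latticeLength (minFace (orthantHull C I) (extendZero I v)) := by
  rw [faceWeight_of_parallel hC hne hCb 1 hv]
  norm_num [latticeLength]

end VertexWeights

section Projections

variable {ι : Type*} [Fintype ι]

/-- The coordinate projection along `ℝ^I` as a linear map. -/
def projLinear (I : Finset ι) : (ι → ℝ) →ₗ[ℝ] ({i // i ∉ I} → ℝ) :=
  LinearMap.funLeft ℝ ℝ Subtype.val

omit [Fintype ι] in
/-- The projection of an orthant hull. -/
lemma projAlong_image_orthantHull (C : Set (ι → ℝ)) (I : Finset ι) (K : Set ι) (hIK : ↑I ⊆ K) :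
    projAlong I '' orthantHull C K = orthantHull (projAlong I '' C) {j | (j : ι) ∈ K} := by
  have himg : projAlong I '' convexHull ℝ C = convexHull ℝ (projAlong I '' C) :=
    (projLinear I).image_convexHull C
  classical
  ext x
  constructor
  · rintro ⟨y, ⟨z, hz, h1, h2⟩, rfl⟩
    refine ⟨projAlong I z, himg ▸ ⟨z, hz, rfl⟩, fun j hj => h1 j hj, fun j hj => h2 j hj⟩
  · rintro ⟨y, hy, h1, h2⟩
    rw [← himg] at hy
    obtain ⟨z, hz, rfl⟩ := hy
    refine ⟨fun i => if hi : i ∈ I then z i else x ⟨i, hi⟩, ⟨z, hz, fun i hi => ?_, fun i hi => ?_⟩,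
      ?_⟩
    · by_cases h : i ∈ I
      · simp [h]
      · simp only [h, dif_neg, not_false_eq_true]
        exact h1 ⟨i, h⟩ hi
    · have h : i ∉ I := fun h => hi (hIK h)
      simp only [h, dif_neg, not_false_eq_true]
      exact h2 ⟨i, h⟩ hi
    · ext j
      simp [projAlong, j.2]

/-- The dimension of a polyhedron which is invariant along `ℝ^I`. -/
lemma dim_orthantHull [DecidableEq ι] {C : Set (ι → ℝ)} (hne : C.Nonempty) (I : Finset ι) :
    dim (orthantHull C I) = I.card + dim (projAlong I '' orthantHull C I) := by
  set U := vectorSpan ℝ (orthantHull C I) with hU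
  have h1 : vectorSpan ℝ (projAlong I '' orthantHull C I) = U.map (projLinear I) :=
    ((projLinear I).toAffineMap.map_vectorSpan (s := orthantHull C I)).symm
  have h2 := ((projLinear I).domRestrict U).finrank_range_add_finrank_ker
  have h3 : LinearMap.range ((projLinear I).domRestrict U) = U.map (projLinear I) :=
    LinearMap.range_domRestrict U _
  have hker : ∀ x : I → ℝ, extendZero I x ∈ U := fun x =>
    mem_vectorSpan_orthantHull_of_support hne fun i hi => extendZero_of_notMem x (by simpa using hi)
  let emb : (I → ℝ) →ₗ[ℝ] U := (extendZero I).codRestrict U hker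
  have hemb : LinearMap.range emb = LinearMap.ker ((projLinear I).domRestrict U) := by
    ext ⟨u, hu⟩
    constructor
    · rintro ⟨x, hx⟩
      rw [LinearMap.mem_ker, ← hx]
      ext j
      exact extendZero_of_notMem x j.2
    · intro h
      refine ⟨fun i => u i, Subtype.ext (funext fun i => ?_)⟩
      by_cases hi : i ∈ I
      · exact extendZero_of_mem _ hi
      · refine (extendZero_of_notMem _ hi).trans ?_
        exact (congrFun h ⟨i, hi⟩).symm
  have hinj : Function.Injective emb := by
    intro x y hxy
    ext i
    have := congrFun (congrArg Subtype.val hxy) (i : ι)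
    simpa [emb] using this
  have h4 := LinearMap.finrank_range_of_inj hinj
  rw [hemb, Module.finrank_fintype_fun_eq_card, Fintype.card_coe] at h4
  unfold dim
  rw [h1, ← h3, ← hU]
  omega

end Projections

/-! ### Faces of a polyhedron and faces of its projection -/

section VFaces

variable {ι : Type*} [Fintype ι] [DecidableEq ι]

/-- The part of `N` over a subset `B` of its projection along `ℝ^I`. -/
def liftFace (N : Set (ι → ℝ)) (I : Finset ι) (B : Set ({i // i ∉ I} → ℝ)) : Set (ι → ℝ) :=
  {x | x ∈ N ∧ projAlong I x ∈ B}

/-- The extension by zero of a function on the complement of `I`. -/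
def extendCompl {R : Type*} [Zero R] (I : Finset ι) (h : {i // i ∉ I} → R) : ι → R :=
  fun i => if hi : i ∈ I then 0 else h ⟨i, hi⟩

omit [Fintype ι] in
lemma extendCompl_of_mem {R : Type*} [Zero R] {I : Finset ι} (h : {i // i ∉ I} → R) {i : ι}
    (hi : i ∈ I) : extendCompl I h i = 0 := by simp [extendCompl, hi]

omit [Fintype ι] in
lemma extendCompl_of_notMem {R : Type*} [Zero R] {I : Finset ι} (h : {i // i ∉ I} → R) {i : ι}
    (hi : i ∉ I) : extendCompl I h i = h ⟨i, hi⟩ := by simp [extendCompl, hi]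

omit [Fintype ι] in
@[simp]
lemma extendCompl_coe {R : Type*} [Zero R] {I : Finset ι} (h : {i // i ∉ I} → R)
    (j : {i // i ∉ I}) : extendCompl I h j = h j := extendCompl_of_notMem h j.2

lemma extendCompl_dotProduct {I : Finset ι} (h : {i // i ∉ I} → ℝ) (x : ι → ℝ) :
    extendCompl I h ⬝ᵥ x = h ⬝ᵥ projAlong I x := by
  unfold dotProduct
  rw [← Fintype.sum_subtype_add_sum_subtype (fun i => i ∈ I), Finset.sum_eq_zero, zero_add]
  · refine Finset.sum_congr rfl fun j _ => ?_
    rw [extendCompl_of_notMem h j.2]; rfl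
  · intro i _
    rw [extendCompl_of_mem h i.2, zero_mul]

lemma minFace_extendCompl (N : Set (ι → ℝ)) (I : Finset ι) (h : {i // i ∉ I} → ℝ) :
    minFace N (extendCompl I h) = liftFace N I (minFace (projAlong I '' N) h) := by
  ext x
  simp only [minFace, liftFace, Set.mem_ofPred_eq, extendCompl_dotProduct, Set.forall_mem_image]
  constructor
  · rintro ⟨hx, hmin⟩
    exact ⟨hx, ⟨x, hx, rfl⟩, fun y hy => hmin y hy⟩
  · rintro ⟨hx, -, hmin⟩
    exact ⟨hx, fun y hy => hmin y hy⟩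

omit [Fintype ι] [DecidableEq ι] in
lemma projAlong_image_liftFace {N : Set (ι → ℝ)} {I : Finset ι} {B : Set ({i // i ∉ I} → ℝ)}
    (hB : B ⊆ projAlong I '' N) : projAlong I '' liftFace N I B = B := by
  apply Set.Subset.antisymm
  · rintro _ ⟨x, hx, rfl⟩
    exact hx.2
  · intro b hb
    obtain ⟨x, hx, rfl⟩ := hB hb
    exact ⟨x, ⟨hx, hb⟩, rfl⟩

/-- The part of a Newton polyhedron over a bounded face of its projection. -/
lemma liftFace_eq_orthantHull {C : Set (ι → ℝ)} (hC : C.Finite) (hne : C.Nonempty) {I : Finset ι}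
    {h : {i // i ∉ I} → ℝ} (hpos : ∀ j, 0 < h j) :
    liftFace (orthantHull C Set.univ) I (minFace (projAlong I '' orthantHull C Set.univ) h) =
      orthantHull {a ∈ C | projAlong I a ∈ minFace (projAlong I '' orthantHull C Set.univ) h} I := by
  rw [← minFace_extendCompl]
  have h0 : ∀ i ∈ (Set.univ : Set ι), 0 ≤ extendCompl I h i := by
    intro i _
    by_cases hi : i ∈ I
    · rw [extendCompl_of_mem h hi]
    · rw [extendCompl_of_notMem h hi]; exact (hpos _).le
  have hFne := minFace_orthantHull_nonempty hC hne h0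
  rw [minFace_orthantHull hC h0, face_inter_generators hC hFne, minFace_extendCompl]
  congr 1
  · ext a
    constructor
    · rintro ⟨ha, -, hb⟩
      exact ⟨ha, hb⟩
    · rintro ⟨ha, hb⟩
      exact ⟨ha, subset_orthantHull C _ ha, hb⟩
  · ext i
    simp only [Set.mem_univ, true_and, Set.mem_ofPred_eq, Finset.mem_coe]
    constructor
    · intro hi
      by_contra hiI
      rw [extendCompl_of_notMem h hiI] at hi
      exact (hpos _).ne' hi
    · intro hi
      rw [extendCompl_of_mem h hi]

omit [Fintype ι] in
lemma inCoordSubspace_orthantHull_iff {D : Set (ι → ℝ)} (hne : D.Nonempty) {I : Finset ι}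
    (K : Finset ι) :
    InCoordSubspace K (orthantHull D I) ↔
      I ⊆ K ∧ InCoordSubspace (K.subtype (· ∉ I)) (projAlong I '' orthantHull D I) := by
  constructor
  · intro h
    refine ⟨fun i hi => ?_, ?_⟩
    · by_contra hiK
      obtain ⟨a, ha⟩ := hne
      have ha' := subset_orthantHull D I ha
      have h1 := h a ha' i hiK
      have h2 := h _ (orthantHull_add_single ha' (Finset.mem_coe.2 hi) zero_le_one) i hiK
      simp [h1] at h2
    · rintro _ ⟨x, hx, rfl⟩ j hj
      exact h x hx j fun hjK => hj (Finset.mem_subtype.2 hjK)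
  · rintro ⟨hIK, h⟩ x hx i hi
    have hiI : i ∉ I := fun h => hi (hIK h)
    exact h _ ⟨x, hx, rfl⟩ ⟨i, hiI⟩ fun hj => hi (Finset.mem_subtype.1 hj)

omit [Fintype ι] in
lemma card_eq_add_card_subtype {I K : Finset ι} (hIK : I ⊆ K) :
    K.card = I.card + (K.subtype (· ∉ I)).card := by
  rw [Finset.card_subtype, Finset.filter_notMem_eq_sdiff, Finset.card_sdiff_of_subset hIK]
  have := Finset.card_le_card hIK
  omega

omit [Fintype ι] in
lemma exists_subtype_eq (I : Finset ι) (K' : Finset {i // i ∉ I}) :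
    ∃ K : Finset ι, I ⊆ K ∧ K.subtype (· ∉ I) = K' := by
  refine ⟨I ∪ K'.map (Function.Embedding.subtype _), Finset.subset_union_left, ?_⟩
  ext j
  simp only [Finset.mem_subtype, Finset.mem_union, Finset.mem_map,
    Function.Embedding.subtype_apply]
  constructor
  · rintro (h | ⟨j', hj', h⟩)
    · exact absurd h j.2
    · rwa [← Subtype.ext h]
  · intro h
    exact Or.inr ⟨j, h, rfl⟩

omit [Fintype ι] in
lemma latticeDist_orthantHull {D : Set (ι → ℝ)} (hne : D.Nonempty) {I K : Finset ι}
    (hIK : I ⊆ K) :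
    latticeDist K (orthantHull D I) =
      latticeDist (K.subtype (· ∉ I)) (projAlong I '' orthantHull D I) := by
  have hgcd : ∀ l : ι → ℤ, (∀ i ∈ I, l i = 0) →
      K.gcd l = (K.subtype (· ∉ I)).gcd fun j => l j := by
    intro l hl
    refine dvd_antisymm_of_normalize_eq Finset.normalize_gcd Finset.normalize_gcd ?_ ?_
    · refine Finset.dvd_gcd fun j hj => ?_
      exact Finset.gcd_dvd (Finset.mem_subtype.1 hj)
    · refine Finset.dvd_gcd fun i hi => ?_
      by_cases hiI : i ∈ I
      · rw [hl i hiI]; exact dvd_zero _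
      · exact Finset.gcd_dvd (f := fun j : {i // i ∉ I} => l j)
          (Finset.mem_subtype.2 hi : (⟨i, hiI⟩ : {i // i ∉ I}) ∈ _)
  have hsum : ∀ l : ι → ℤ, (∀ i ∈ I, l i = 0) → ∀ x : ι → ℝ,
      ∑ i ∈ K, (l i : ℝ) * x i =
        ∑ j ∈ K.subtype (· ∉ I), (l j : ℝ) * projAlong I x j := by
    intro l hl x
    refine Eq.trans ?_ (Finset.sum_subtype_eq_sum_filter (s := K) (p := (· ∉ I))
      (f := fun i => (l i : ℝ) * x i)).symm
    rw [Finset.sum_filter_of_ne]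
    intro i _ hi hiI
    rw [hl i hiI] at hi
    simp at hi
  unfold latticeDist
  congr 1
  ext m
  constructor
  · rintro ⟨l, hl1, hl⟩
    have hl0 : ∀ i ∈ I, l i = 0 := by
      intro i hi
      obtain ⟨a, ha⟩ := hne
      have ha' := subset_orthantHull D I ha
      have h1 := hl a ha'
      have h2 := hl _ (orthantHull_add_single ha' (Finset.mem_coe.2 hi) zero_le_one)
      have h3 : ∑ j ∈ K, (l j : ℝ) * (Pi.single i 1 : ι → ℝ) j = 0 := by
        simp only [Pi.add_apply, mul_add, Finset.sum_add_distrib, h1] at h2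
        linarith
      rw [Finset.sum_eq_single i (fun j _ hj => by simp [hj])
        (fun h => absurd (hIK hi) h)] at h3
      simpa using h3
    refine ⟨fun j => l j, by rw [← hgcd l hl0]; exact hl1, ?_⟩
    rintro _ ⟨x, hx, rfl⟩
    rw [← hsum l hl0]
    exact hl x hx
  · rintro ⟨l, hl1, hl⟩
    have hl0 : ∀ i ∈ I, extendCompl I l i = 0 := fun i hi => extendCompl_of_mem l hi
    refine ⟨extendCompl I l, ?_, fun x hx => ?_⟩
    · rw [hgcd _ hl0]
      simpa using hl1
    · rw [hsum _ hl0]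
      simpa using hl _ ⟨x, hx, rfl⟩

/-- `V_I`-faces are supported by the functions which vanish exactly at the coordinates in `I`. -/
lemma IsVFace.exists_minFace {C : Set (ι → ℝ)} (hC : C.Finite) {I J : Finset ι}
    {Γ : Set (ι → ℝ)} (hΓ : IsVFace I J (orthantHull C Set.univ) Γ) :
    I ⊆ J ∧ ∃ h : ι → ℝ, (∀ i, 0 ≤ h i) ∧ (∀ i, h i = 0 ↔ i ∈ I) ∧
      Γ = minFace (orthantHull C Set.univ) h := by
  obtain ⟨hne, h, rfl⟩ := isFace_iff.1 hΓ.face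
  have h0 : ∀ i, 0 ≤ h i := fun i => nonneg_of_minFace_nonempty hne i (Set.mem_univ i)
  have hoh := minFace_orthantHull (I := Set.univ) hC fun i _ => h0 i
  have hDne : (minFace C h).Nonempty := by
    rw [hoh] at hne; exact nonempty_of_orthantHull hne
  have hDfin : (minFace C h).Finite := hC.subset fun a ha => ha.1
  have hb := hΓ.bounded_proj
  have hsub := hΓ.subset
  set Z : Finset ι := Finset.univ.filter fun i => h i = 0 with hZ
  have hZc : {i ∈ Set.univ | h i = 0} = (Z : Set ι) := by
    ext i; simp [hZ]
  rw [hoh, hZc] at hb hsub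
  have hbd := fun K => isBounded_projAlong_orthantHull (I := (Z : Set ι)) hDfin hDne K
  have hZJ : Z ⊆ J := ((inCoordSubspace_orthantHull_iff hDne J).1 hsub).1
  have hIZ : I ⊆ Z := hb.2 ⟨hZJ, (hbd Z).2 subset_rfl⟩
  have hZI : Z ⊆ I := Finset.coe_subset.1 ((hbd I).1 hb.1.2)
  refine ⟨hIZ.trans hZJ, h, h0, fun i => ?_, rfl⟩
  rw [hIZ.antisymm hZI, hZ]
  simp

omit [Fintype ι] [DecidableEq ι] in
lemma projAlong_image_newton (C : Set (ι → ℝ)) (I : Finset ι) :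
    projAlong I '' orthantHull C Set.univ = orthantHull (projAlong I '' C) Set.univ := by
  rw [projAlong_image_orthantHull C I Set.univ (Set.subset_univ _)]
  congr 1

/-- The `V_I`-faces of `N` are the preimages of the bounded `V`-faces of its projection along
`ℝ^I`. -/
lemma isVFace_liftFace_iff {C : Set (ι → ℝ)} (hC : C.Finite) (hne : C.Nonempty) {I K : Finset ι}
    {h : {i // i ∉ I} → ℝ} (hpos : ∀ j, 0 < h j) :
    IsVFace I K (orthantHull C Set.univ)
      (liftFace (orthantHull C Set.univ) I (minFace (projAlong I '' orthantHull C Set.univ) h)) ↔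
    I ⊆ K ∧ IsVFace ∅ (K.subtype (· ∉ I)) (projAlong I '' orthantHull C Set.univ)
      (minFace (projAlong I '' orthantHull C Set.univ) h) := by
  set N := orthantHull C Set.univ with hN
  set P := projAlong I '' N with hP
  set B := minFace P h with hB
  have hBne : B.Nonempty := by
    rw [hB, hP, hN, projAlong_image_newton]
    exact minFace_orthantHull_nonempty (hC.image _) (hne.image _) fun j _ => (hpos j).le
  have hBface : IsFace P B := isFace_iff.2 ⟨hBne, h, rfl⟩
  have hproj : projAlong I '' liftFace N I B = B := projAlong_image_liftFace fun x hx => hx.1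
  have hΓface : IsFace N (liftFace N I B) := by
    rw [isFace_iff]
    refine ⟨?_, extendCompl I h, (minFace_extendCompl N I h).symm⟩
    rw [← hproj] at hBne
    exact Set.image_nonempty.1 hBne
  have hBconv : B = orthantHull (minFace (projAlong I '' C) h) ∅ := by
    rw [orthantHull_empty, hB, hP, hN, projAlong_image_newton]
    exact minFace_orthantHull_of_pos (hC.image _) fun j _ => hpos j
  have hBbd : Bornology.IsBounded (projAlong ∅ '' B) := by
    rw [hBconv, isBounded_projAlong_orthantHull ((hC.image _).subset fun a ha => ha.1)]
    · simp
    · rw [hBconv] at hBne; exact nonempty_of_orthantHull hBne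
  have hoh := liftFace_eq_orthantHull hC hne hpos
  rw [← hN, ← hP, ← hB] at hoh
  have hDfin : {a ∈ C | projAlong I a ∈ B}.Finite := hC.subset fun a ha => ha.1
  have hDne : {a ∈ C | projAlong I a ∈ B}.Nonempty := by
    have := hΓface.1
    rw [hoh] at this
    exact nonempty_of_orthantHull this
  set D := {a ∈ C | projAlong I a ∈ B} with hD
  rw [hoh] at hΓface hproj ⊢
  have hdim := dim_orthantHull hDne I
  rw [hproj] at hdim
  have hin := inCoordSubspace_orthantHull_iff hDne (I := I)
  rw [hproj] at hin
  have hbd := isBounded_projAlong_orthantHull (I := (I : Set ι)) hDfin hDne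
  constructor
  · intro hV
    obtain ⟨hIK, hsub⟩ := (hin K).1 hV.subset
    refine ⟨hIK, hBface, hsub, ?_, ?_, ?_⟩
    · have h1 := hV.card_eq
      rw [card_eq_add_card_subtype hIK] at h1
      omega
    · intro K' hK' hcard
      obtain ⟨K₀, hIK₀, rfl⟩ := exists_subtype_eq I K'
      refine hV.not_convenient K₀ ((hin K₀).2 ⟨hIK₀, hK'⟩) ?_
      rw [card_eq_add_card_subtype hIK₀]
      omega
    · exact ⟨⟨Finset.empty_subset _, hBbd⟩, fun _ _ => Finset.empty_subset _⟩
  · rintro ⟨hIK, hV⟩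
    refine ⟨hΓface, (hin K).2 ⟨hIK, hV.subset⟩, ?_, ?_, ?_⟩
    · have h1 := hV.card_eq
      rw [card_eq_add_card_subtype hIK]
      omega
    · intro K₀ hK₀ hcard
      obtain ⟨hIK₀, hK'⟩ := (hin K₀).1 hK₀
      refine hV.not_convenient _ hK' ?_
      rw [card_eq_add_card_subtype hIK₀] at hcard
      omega
    · exact ⟨⟨hIK, (hbd I).2 subset_rfl⟩, fun K₀ hK₀ => Finset.coe_subset.1 ((hbd K₀).1 hK₀.2)⟩

omit [DecidableEq ι] in
/-- Bounded faces are supported by positive functions. -/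
lemma exists_pos_of_bounded_face {C : Set (ι → ℝ)} (hC : C.Finite) {B : Set (ι → ℝ)}
    (hB : IsFace (orthantHull C Set.univ) B) (hb : Bornology.IsBounded B) :
    ∃ h : ι → ℝ, (∀ j, 0 < h j) ∧ B = minFace (orthantHull C Set.univ) h := by
  obtain ⟨hne, h, rfl⟩ := isFace_iff.1 hB
  exact ⟨h, fun j => bounded_face_orthantHull hC hne hb j (Set.mem_univ j), rfl⟩

lemma Contributes.exists_pos {C : Set (ι → ℝ)} (hC : C.Finite) {m : ℕ} {B : Set (ι → ℝ)}
    (hB : Contributes (orthantHull C Set.univ) m B) :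
    ∃ h : ι → ℝ, (∀ j, 0 < h j) ∧ B = minFace (orthantHull C Set.univ) h := by
  obtain ⟨J, hV, -⟩ := hB
  obtain ⟨-, h, h0, hz, rfl⟩ := hV.exists_minFace hC
  exact ⟨h, fun j => lt_of_le_of_ne (h0 j) fun hj => by simpa using (hz j).1 hj.symm, rfl⟩

omit [Fintype ι] [DecidableEq ι] in
lemma Contributes.isFace {C : Set (ι → ℝ)} {m : ℕ} {B : Set (ι → ℝ)}
    (hB : Contributes (orthantHull C Set.univ) m B) : IsFace (orthantHull C Set.univ) B := by
  obtain ⟨J, hV, -⟩ := hB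
  exact hV.face

lemma Contributes.isBounded {C : Set (ι → ℝ)} (hC : C.Finite) {m : ℕ} {B : Set (ι → ℝ)}
    (hB : Contributes (orthantHull C Set.univ) m B) : Bornology.IsBounded B := by
  obtain ⟨h, hpos, rfl⟩ := hB.exists_pos hC
  exact isBounded_minFace_of_pos hC fun j _ => hpos j

omit [DecidableEq ι] in
lemma finite_contributes {C : Set (ι → ℝ)} (hC : C.Finite) (m : ℕ) :
    {B | Contributes (orthantHull C Set.univ) m B}.Finite :=
  (finite_faces hC).subset fun _ hB => hB.isFace

/-- The faces in the definition of the class `Φ_{m,I}` are the preimages of the contributing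
faces. -/
lemma vFaces_eq_image {C : Set (ι → ℝ)} (hC : C.Finite) (hne : C.Nonempty) (I : Finset ι)
    (m : ℕ) :
    {Γ : Set (ι → ℝ) | ∃ J : Finset ι, IsVFace I J (orthantHull C Set.univ) Γ ∧
      m ∣ latticeDist J Γ} =
    liftFace (orthantHull C Set.univ) I ''
      {B | Contributes (projAlong I '' orthantHull C Set.univ) m B} := by
  have hdist : ∀ (h : {i // i ∉ I} → ℝ) (K : Finset ι), (∀ j, 0 < h j) → I ⊆ K →
      latticeDist K (liftFace (orthantHull C Set.univ) I
        (minFace (projAlong I '' orthantHull C Set.univ) h)) =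
      latticeDist (K.subtype (· ∉ I)) (minFace (projAlong I '' orthantHull C Set.univ) h) := by
    intro h K hpos hIK
    have hproj : projAlong I '' liftFace (orthantHull C Set.univ) I
      (minFace (projAlong I '' orthantHull C Set.univ) h) =
      minFace (projAlong I '' orthantHull C Set.univ) h := projAlong_image_liftFace fun x hx => hx.1
    have hBne : (minFace (projAlong I '' orthantHull C Set.univ) h).Nonempty := by
      rw [projAlong_image_newton]
      exact minFace_orthantHull_nonempty (hC.image _) (hne.image _) fun j _ => (hpos j).le
    have hoh := liftFace_eq_orthantHull hC hne hpos
    rw [← hproj] at hBne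
    have hΓne := Set.image_nonempty.1 hBne
    rw [hoh] at hproj hΓne ⊢
    rw [latticeDist_orthantHull (nonempty_of_orthantHull hΓne) hIK, hproj]
  ext Γ
  constructor
  · rintro ⟨J, hV, hm⟩
    obtain ⟨hIJ, h, h0, hz, hΓ⟩ := hV.exists_minFace hC
    have hpos : ∀ j : {i // i ∉ I}, 0 < h j :=
      fun j => lt_of_le_of_ne (h0 j) fun hj => j.2 ((hz j).1 hj.symm)
    have hext : h = extendCompl I fun j => h j := by
      ext i
      by_cases hi : i ∈ I
      · rw [extendCompl_of_mem _ hi, (hz i).2 hi]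
      · rw [extendCompl_of_notMem _ hi]
    rw [hext, minFace_extendCompl] at hΓ
    subst hΓ
    refine ⟨_, ⟨_, ((isVFace_liftFace_iff hC hne hpos).1 hV).2, ?_⟩, rfl⟩
    rw [← hdist _ J hpos hIJ]
    exact hm
  · rintro ⟨B, hB, rfl⟩
    obtain ⟨h, hpos, hBh⟩ : ∃ h : {i // i ∉ I} → ℝ, (∀ j, 0 < h j) ∧
        B = minFace (projAlong I '' orthantHull C Set.univ) h := by
      have hB' : Contributes (projAlong I '' orthantHull C Set.univ) m B := hB
      rw [projAlong_image_newton] at hB' ⊢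
      exact hB'.exists_pos (hC.image _)
    subst hBh
    obtain ⟨J', hV, hm⟩ := hB
    obtain ⟨J, hIJ, rfl⟩ := exists_subtype_eq I J'
    exact ⟨J, (isVFace_liftFace_iff hC hne hpos).2 ⟨hIJ, hV⟩, by rw [hdist h J hpos hIJ]; exact hm⟩

/-- The weight function of the class `Φ_{m,I}`, as a sum over the contributing faces. -/
lemma weightAt_tropicalClass {C : Set (ι → ℝ)} (hC : C.Finite) (hne : C.Nonempty) (I : Finset ι)
    (m d : ℕ) (hfin : {B | Contributes (projAlong I '' orthantHull C Set.univ) m B}.Finite)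
    (v : I → ℝ) :
    weightAt (tropicalClass (orthantHull C Set.univ) I m d) v =
      ∑ B ∈ hfin.toFinset, faceWeight I (liftFace (orthantHull C Set.univ) I B) (d + dim B) v := by
  unfold tropicalClass
  have hBsub : ∀ B ∈ {B | Contributes (projAlong I '' orthantHull C Set.univ) m B},
      projAlong I '' liftFace (orthantHull C Set.univ) I B = B := by
    rintro B ⟨J, hV, -⟩
    obtain ⟨-, h, rfl⟩ := isFace_iff.1 hV.face
    exact projAlong_image_liftFace fun x hx => hx.1
  rw [vFaces_eq_image hC hne, finsum_mem_image (fun B hB B' hB' h => by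
    rw [← hBsub B hB, ← hBsub B' hB', h]), finsum_mem_eq_finite_toFinset_sum _ hfin,
    weightAt_finset_sum]
  refine Finset.sum_congr rfl fun B hB => ?_
  rw [Set.Finite.mem_toFinset] at hB
  have hdim : dim (liftFace (orthantHull C Set.univ) I B) = I.card + dim B := by
    obtain ⟨h, hpos, hBh⟩ : ∃ h : {i // i ∉ I} → ℝ, (∀ j, 0 < h j) ∧
        B = minFace (projAlong I '' orthantHull C Set.univ) h := by
      have hB' : Contributes (projAlong I '' orthantHull C Set.univ) m B := hB
      rw [projAlong_image_newton] at hB' ⊢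
      exact hB'.exists_pos (hC.image _)
    have hproj := hBsub B hB
    have hBne : B.Nonempty := by
      obtain ⟨J, hV, -⟩ := hB
      exact hV.face.1
    have hoh := liftFace_eq_orthantHull hC hne hpos
    rw [← hBh] at hoh
    rw [← hproj] at hBne
    have hΓne := Set.image_nonempty.1 hBne
    rw [hoh] at hproj hΓne ⊢
    rw [dim_orthantHull (nonempty_of_orthantHull hΓne), hproj]
  unfold faceWeight
  have h1 : d + dim (liftFace (orthantHull C Set.univ) I B) - I.card = d + dim B := by omega
  rw [h1]

end VFaces

/-! ### Lattice segments -/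

section LatticeSegments

variable {κ : Type*} [Fintype κ]

/-- `B` is the segment of lattice length `L` from the lattice point `z` in the direction of the
primitive vector `e`. -/
structure IsLatticeSegment (B : Set (κ → ℝ)) (z e : κ → ℤ) (L : ℕ) : Prop where
  pos : 0 < L
  primitive : ∃ τ : κ → ℤ, τ ⬝ᵥ e = 1
  eq : B = segment ℝ (intToReal κ z) (intToReal κ z + (L : ℝ) • intToReal κ e)

lemma dotProduct_add_smul_intToReal {τ e : κ → ℤ} (h : τ ⬝ᵥ e = 1) (z : κ → ℤ) (θ : ℝ) :
    intToReal κ τ ⬝ᵥ (intToReal κ z + θ • intToReal κ e) = ((τ ⬝ᵥ z : ℤ) : ℝ) + θ := by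
  rw [dotProduct_add, dotProduct_smul, intToReal_dotProduct, intToReal_dotProduct, h]
  simp

omit [Fintype κ] in
lemma intToReal_add_nsmul (z e : κ → ℤ) (k : ℕ) :
    intToReal κ (z + k • e) = intToReal κ z + (k : ℝ) • intToReal κ e := by
  rw [map_add, map_nsmul, Nat.cast_smul_eq_nsmul]

omit [Fintype κ] in
lemma intToReal_add_nsmul_reverse (z e : κ → ℤ) (k : ℕ) :
    intToReal κ (z + k • e) + (k : ℝ) • intToReal κ (-e) = intToReal κ z := by
  rw [intToReal_add_nsmul, map_neg]
  module

namespace IsLatticeSegment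

variable {B : Set (κ → ℝ)} {z e : κ → ℤ} {L : ℕ}

lemma dim_latticeVolume (H : IsLatticeSegment B z e L) : dim B = 1 ∧ latticeVolume B = L := by
  obtain ⟨τ, hτ⟩ := H.primitive
  rw [H.eq]
  exact dim_latticeVolume_segment hτ _ (by exact_mod_cast H.pos)

lemma mem_iff (H : IsLatticeSegment B z e L) {x : κ → ℝ} :
    x ∈ B ↔ ∃ θ : ℝ, 0 ≤ θ ∧ θ ≤ L ∧ x = intToReal κ z + θ • intToReal κ e := by
  have hL : (0 : ℝ) < L := by exact_mod_cast H.pos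
  rw [H.eq, mem_segment_add_smul]
  constructor
  · rintro ⟨θ, ⟨h0, h1⟩, rfl⟩
    exact ⟨θ * L, by positivity, by nlinarith, rfl⟩
  · rintro ⟨θ, h0, h1, rfl⟩
    exact ⟨θ / L, ⟨by positivity, (div_le_one hL).2 h1⟩, by rw [div_mul_cancel₀ _ hL.ne']⟩

lemma reverse (H : IsLatticeSegment B z e L) : IsLatticeSegment B (z + L • e) (-e) L := by
  obtain ⟨τ, hτ⟩ := H.primitive
  refine ⟨H.pos, ⟨-τ, by simpa using hτ⟩, ?_⟩
  rw [H.eq, segment_symm, intToReal_add_nsmul_reverse, intToReal_add_nsmul]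

lemma injective (H : IsLatticeSegment B z e L) {θ θ' : ℝ}
    (h : intToReal κ z + θ • intToReal κ e = intToReal κ z + θ' • intToReal κ e) : θ = θ' := by
  obtain ⟨τ, hτ⟩ := H.primitive
  have := congrArg (intToReal κ τ ⬝ᵥ ·) h
  simp only [dotProduct_add_smul_intToReal hτ] at this
  linarith

/-- A lattice segment can be parametrized from any of its end points. -/
lemma of_segment_eq (H : IsLatticeSegment B z e L) {a b : κ → ℝ} (hB : B = segment ℝ a b) :
    ∃ z' e', IsLatticeSegment B z' e' L ∧ a = intToReal κ z' ∧
      b = intToReal κ z' + (L : ℝ) • intToReal κ e' := by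
  obtain ⟨α, hα0, hαL, rfl⟩ := H.mem_iff.1 (hB ▸ left_mem_segment ℝ a b : a ∈ B)
  obtain ⟨β, hβ0, hβL, rfl⟩ := H.mem_iff.1 (hB ▸ right_mem_segment ℝ _ b : b ∈ B)
  have key : ∀ θ : ℝ, 0 ≤ θ → θ ≤ L → ∃ s, 0 ≤ s ∧ s ≤ 1 ∧ θ = α + s * (β - α) := by
    intro θ h0 h1
    have hθ : intToReal κ z + θ • intToReal κ e ∈ B := H.mem_iff.2 ⟨θ, h0, h1, rfl⟩
    rw [hB] at hθ
    obtain ⟨p, q, hp, hq, hpq, h⟩ := hθ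
    refine ⟨q, hq, by linarith, H.injective ?_⟩
    rw [← h]
    obtain rfl : p = 1 - q := by linarith
    module
  obtain ⟨s, hs0, hs1, hs⟩ := key 0 le_rfl (by positivity)
  obtain ⟨u, hu0, hu1, hu⟩ := key L (by positivity) le_rfl
  rcases le_total α β with hαβ | hαβ
  · obtain rfl : α = 0 := by nlinarith
    obtain rfl : β = L := by nlinarith
    exact ⟨z, e, H, by simp, rfl⟩
  · obtain rfl : β = 0 := by nlinarith
    obtain rfl : α = L := by nlinarith
    exact ⟨_, _, H.reverse, (intToReal_add_nsmul z e L).symm,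
      by rw [intToReal_add_nsmul_reverse, zero_smul, add_zero]⟩

/-- Vertices of a polyhedron which belong to a lattice segment in it are end points of the
segment. -/
lemma eq_or_eq_of_isFace (H : IsLatticeSegment B z e L) {P : Set (κ → ℝ)} (hBP : B ⊆ P)
    {a : κ → ℝ} (ha : IsFace P {a}) (haB : a ∈ B) :
    a = intToReal κ z ∨ a = intToReal κ z + (L : ℝ) • intToReal κ e := by
  obtain ⟨-, h, hh⟩ := isFace_iff.1 ha
  obtain ⟨θ, h0, h1, hθ⟩ := H.mem_iff.1 haB
  have hL : (0 : ℝ) < L := by exact_mod_cast H.pos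
  have hmin : ∀ y ∈ P, h ⬝ᵥ a ≤ h ⬝ᵥ y := (hh ▸ Set.mem_singleton a : a ∈ minFace P h).2
  have huniq : ∀ y ∈ P, h ⬝ᵥ y ≤ h ⬝ᵥ a → y = a := by
    intro y hy hya
    have : y ∈ minFace P h := ⟨hy, fun w hw => hya.trans (hmin w hw)⟩
    rwa [← hh] at this
  have hz : intToReal κ z ∈ B := H.mem_iff.2 ⟨0, le_rfl, hL.le, by simp⟩
  have hw : intToReal κ z + (L : ℝ) • intToReal κ e ∈ B := H.mem_iff.2 ⟨L, hL.le, le_rfl, rfl⟩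
  have hva := congrArg (h ⬝ᵥ ·) hθ
  simp only [dotProduct_add, dotProduct_smul, smul_eq_mul] at hva
  by_cases hs : 0 ≤ h ⬝ᵥ intToReal κ e
  · refine Or.inl (huniq _ (hBP hz) ?_).symm
    nlinarith
  · refine Or.inr (huniq _ (hBP hw) ?_).symm
    simp only [dotProduct_add, dotProduct_smul, smul_eq_mul]
    nlinarith

lemma exists_start_eq (H : IsLatticeSegment B z e L) {P : Set (κ → ℝ)} (hBP : B ⊆ P)
    {a : κ → ℝ} (ha : IsFace P {a}) (haB : a ∈ B) :
    ∃ z' e', IsLatticeSegment B z' e' L ∧ a = intToReal κ z' := by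
  rcases H.eq_or_eq_of_isFace hBP ha haB with h | h
  · exact ⟨z, e, H, h⟩
  · exact ⟨_, _, H.reverse, h.trans (intToReal_add_nsmul z e L).symm⟩

lemma point_mem (H : IsLatticeSegment B z e L) {k : ℕ} (hk : k ≤ L) :
    intToReal κ z + (k : ℝ) • intToReal κ e ∈ B :=
  H.mem_iff.2 ⟨k, by positivity, by exact_mod_cast hk, rfl⟩

/-- The interior lattice points of a lattice segment. -/
lemma interior_lattice_points (H : IsLatticeSegment B z e L) :
    {x | x ∈ openSegment ℝ (intToReal κ z) (intToReal κ z + (L : ℝ) • intToReal κ e) ∧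
      IsLatticePoint x} =
    {x | ∃ k : ℕ, 0 < k ∧ k < L ∧ x = intToReal κ z + (k : ℝ) • intToReal κ e} := by
  have hL : (0 : ℝ) < L := by exact_mod_cast H.pos
  obtain ⟨τ, hτ⟩ := H.primitive
  ext x
  constructor
  · rintro ⟨⟨p, q, hp, hq, hpq, rfl⟩, hx⟩
    obtain rfl : p = 1 - q := by linarith
    have hxe : (1 - q) • intToReal κ z + q • (intToReal κ z + (L : ℝ) • intToReal κ e) =
        intToReal κ z + (q * L) • intToReal κ e := by module
    rw [hxe] at hx ⊢
    obtain ⟨w, hw⟩ := isLatticePoint_iff.1 hx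
    have h1 := congrArg (intToReal κ τ ⬝ᵥ ·) hw
    simp only [dotProduct_add_smul_intToReal hτ, intToReal_dotProduct] at h1
    set n := τ ⬝ᵥ w - τ ⬝ᵥ z with hn
    have h2 : q * L = (n : ℝ) := by rw [hn]; push_cast; linarith
    have h3 : (0 : ℝ) < n := by rw [← h2]; positivity
    have h4 : (n : ℝ) < L := by rw [← h2]; nlinarith
    have h5 : 0 < n := by exact_mod_cast h3
    have h6 : n < L := by exact_mod_cast h4
    refine ⟨n.toNat, by omega, by omega, ?_⟩
    rw [h2]
    congr 2
    have : ((n.toNat : ℤ) : ℝ) = n := by rw [Int.toNat_of_nonneg h5.le]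
    rw [← this, Int.cast_natCast]
  · rintro ⟨k, hk0, hkL, rfl⟩
    have hk0' : (0 : ℝ) < k := by exact_mod_cast hk0
    have hkL' : (k : ℝ) < L := by exact_mod_cast hkL
    refine ⟨⟨1 - k / L, k / L, by rw [sub_pos, div_lt_one hL]; exact hkL', by positivity, by ring,
      ?_⟩, isLatticePoint_iff.2 ⟨z + k • e, (intToReal_add_nsmul z e k).symm⟩⟩
    have h7 : (k : ℝ) / L * L = k := div_mul_cancel₀ _ hL.ne'
    calc (1 - (k : ℝ) / L) • intToReal κ z +
          ((k : ℝ) / L) • (intToReal κ z + (L : ℝ) • intToReal κ e) =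
          intToReal κ z + ((k : ℝ) / L * L) • intToReal κ e := by module
      _ = _ := by rw [h7]

lemma length_eq_two (H : IsLatticeSegment B z e L) {p : κ → ℝ}
    (hp : {x | x ∈ openSegment ℝ (intToReal κ z) (intToReal κ z + (L : ℝ) • intToReal κ e) ∧
      IsLatticePoint x} = {p}) :
    L = 2 ∧ p = intToReal κ z + (1 : ℝ) • intToReal κ e := by
  rw [H.interior_lattice_points] at hp
  obtain ⟨k, hk0, hkL, hk⟩ : p ∈ {x | ∃ k : ℕ, 0 < k ∧ k < L ∧
      x = intToReal κ z + (k : ℝ) • intToReal κ e} := hp ▸ Set.mem_singleton p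
  have h1 : ∀ j : ℕ, 0 < j → j < L → intToReal κ z + (j : ℝ) • intToReal κ e = p := by
    intro j hj0 hjL
    have : intToReal κ z + (j : ℝ) • intToReal κ e ∈ ({p} : Set (κ → ℝ)) :=
      hp ▸ ⟨j, hj0, hjL, rfl⟩
    exact this
  have h2 : L = 2 := by
    by_contra hne
    have h3 := (h1 1 one_pos (by omega)).trans (h1 2 two_pos (by omega)).symm
    have := H.injective h3
    norm_num at this
  refine ⟨h2, ?_⟩
  rw [← h1 1 one_pos (by omega)]
  simp

lemma interior_of_length_two (H : IsLatticeSegment B z e 2) :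
    {x | x ∈ openSegment ℝ (intToReal κ z) (intToReal κ z + ((2 : ℕ) : ℝ) • intToReal κ e) ∧
      IsLatticePoint x} = {intToReal κ z + (1 : ℝ) • intToReal κ e} := by
  rw [H.interior_lattice_points]
  ext x
  constructor
  · rintro ⟨k, hk0, hkL, rfl⟩
    obtain rfl : k = 1 := by omega
    simp
  · rintro rfl
    exact ⟨1, one_pos, one_lt_two, by simp⟩

end IsLatticeSegment

/-- One-dimensional lattice polytopes are lattice segments. -/
lemma exists_isLatticeSegment {D : Set (κ → ℝ)} (hD : D.Finite)
    (hlat : ∀ a ∈ D, IsLatticePoint a) (hdim : dim (convexHull ℝ D) = 1) :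
    ∃ z e L, IsLatticeSegment (convexHull ℝ D) z e L := by
  obtain ⟨a, ha, b, hb, hab⟩ : D.Nontrivial := by
    by_contra hcon
    rcases (Set.not_nontrivial_iff.1 hcon).eq_empty_or_singleton with rfl | ⟨x, rfl⟩
    · rw [convexHull_empty, dim, vectorSpan_empty, finrank_bot] at hdim
      exact zero_ne_one hdim
    · rw [convexHull_singleton, dim_singleton] at hdim
      exact zero_ne_one hdim
  obtain ⟨za, rfl⟩ := isLatticePoint_iff.1 (hlat a ha)
  obtain ⟨zb, rfl⟩ := isLatticePoint_iff.1 (hlat b hb)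
  obtain ⟨e, τ, g, hg, hge, hτ⟩ := exists_primitive (zb - za) fun h => hab (by
    rw [sub_eq_zero.1 h])
  have hsub := subset_convexHull ℝ D
  have heF : intToReal κ e ∈ vectorSpan ℝ (convexHull ℝ D) := by
    have h1 := vsub_mem_vectorSpan ℝ (hsub hb) (hsub ha)
    rw [vsub_eq_sub, ← map_sub, hge, map_zsmul, ← Int.cast_smul_eq_zsmul ℝ] at h1
    exact (Submodule.smul_mem_iff _ (by exact_mod_cast hg.ne')).1 h1
  have he0 : intToReal κ e ≠ 0 := by
    intro h
    have : e = 0 := intToReal_injective (by rw [h, map_zero])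
    rw [this] at hτ
    simp at hτ
  -- all points of `D` are on the line through `a` in the direction of `e`
  have hline : ∀ x ∈ D, ∀ y ∈ D, y = x + (intToReal κ τ ⬝ᵥ y - intToReal κ τ ⬝ᵥ x) •
      intToReal κ e := by
    intro x hx y hy
    obtain ⟨c, hc⟩ := eq_of_dim_eq_one hdim he0 heF (vsub_mem_vectorSpan ℝ (hsub hy) (hsub hx))
    rw [vsub_eq_sub] at hc
    have h1 := congrArg (intToReal κ τ ⬝ᵥ ·) hc
    simp only [dotProduct_smul, dotProduct_sub, intToReal_dotProduct τ e, hτ] at h1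
    rw [← h1]
    simp [hc]
  obtain ⟨x, hx, hxmin⟩ := minFace_nonempty_of_finite (intToReal κ τ) hD ⟨_, ha⟩
  obtain ⟨y, hy, hymax⟩ := minFace_nonempty_of_finite (-intToReal κ τ) hD ⟨_, ha⟩
  simp only [neg_dotProduct, neg_le_neg_iff] at hymax
  obtain ⟨zx, rfl⟩ := isLatticePoint_iff.1 (hlat x hx)
  obtain ⟨zy, rfl⟩ := isLatticePoint_iff.1 (hlat y hy)
  have hlt : τ ⬝ᵥ zx < τ ⬝ᵥ zy := by
    have h1 : (τ ⬝ᵥ zx : ℤ) ≤ τ ⬝ᵥ za := by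
      have := hxmin _ ha
      rw [intToReal_dotProduct, intToReal_dotProduct] at this
      exact_mod_cast this
    have h2 : (τ ⬝ᵥ zb : ℤ) ≤ τ ⬝ᵥ zy := by
      have := hymax _ hb
      rw [intToReal_dotProduct, intToReal_dotProduct] at this
      exact_mod_cast this
    have h3 : τ ⬝ᵥ zb - τ ⬝ᵥ za = g := by
      rw [← dotProduct_sub, hge, dotProduct_smul, hτ]; simp
    omega
  obtain ⟨L, hL⟩ := Int.eq_ofNat_of_zero_le (sub_nonneg.2 hlt.le)
  have hLr : intToReal κ τ ⬝ᵥ intToReal κ zy - intToReal κ τ ⬝ᵥ intToReal κ zx = L := by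
    rw [intToReal_dotProduct, intToReal_dotProduct]; exact_mod_cast hL
  have hLpos : 0 < L := by omega
  refine ⟨zx, e, L, hLpos, ⟨τ, hτ⟩, ?_⟩
  have hyx := hline _ hx _ hy
  rw [hLr] at hyx
  apply Set.Subset.antisymm
  · refine convexHull_min (fun w hw => ?_) (convex_segment _ _)
    rw [mem_segment_add_smul]
    have h1 := hxmin w hw
    have h2 := hymax w hw
    have hL0 : (0 : ℝ) < L := by exact_mod_cast hLpos
    refine ⟨(intToReal κ τ ⬝ᵥ w - intToReal κ τ ⬝ᵥ intToReal κ zx) / L,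
      ⟨div_nonneg (by linarith) hL0.le, (div_le_one hL0).2 (by linarith)⟩, ?_⟩
    rw [div_mul_cancel₀ _ hL0.ne']
    exact (hline _ hx w hw).symm
  · rw [← hyx]
    exact (convex_convexHull ℝ D).segment_subset (hsub hx) (hsub hy)

end LatticeSegments

/-! ### Contributing faces of a Newton polygon -/

section VertexFaces

variable {κ : Type*} [Fintype κ] [DecidableEq κ]

omit [DecidableEq κ] in
lemma isBounded_projAlong_image {B : Set (κ → ℝ)} (hB : Bornology.IsBounded B) (K : Finset κ) :
    Bornology.IsBounded (projAlong K '' B) := by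
  classical
  obtain ⟨r, hr⟩ := (isBounded_iff_forall_norm_le (E := κ → ℝ)).1 hB
  refine (isBounded_iff_forall_norm_le (E := {i // i ∉ K} → ℝ)).2 ⟨r, ?_⟩
  rintro _ ⟨x, hx, rfl⟩
  exact (pi_norm_le_iff_of_nonneg ((norm_nonneg x).trans (hr x hx))).2
    fun i => (norm_le_pi_norm x i).trans (hr x hx)

omit [DecidableEq κ] in
/-- For `I = ∅`, the `V_I`-faces are the bounded `V`-faces. -/
lemma IsFace.isVFace_empty {P B : Set (κ → ℝ)} (hB : IsFace P B) (hb : Bornology.IsBounded B)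
    {J : Finset κ} (hJ : InCoordSubspace J B) (hcard : J.card = dim B + 1)
    (hK : ∀ K : Finset κ, InCoordSubspace K B → K.card ≠ dim B) : IsVFace ∅ J P B :=
  ⟨hB, hJ, hcard, hK, ⟨Finset.empty_subset _, isBounded_projAlong_image hb ∅⟩,
    fun _ _ => Finset.empty_subset _⟩

omit [Fintype κ] [DecidableEq κ] in
lemma exists_eq_singleton_of_dim_eq_zero [Finite κ] {B : Set (κ → ℝ)} (hne : B.Nonempty)
    (hdim : dim B = 0) : ∃ a, B = {a} := by
  obtain ⟨a, ha⟩ := hne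
  refine ⟨a, Set.eq_singleton_iff_unique_mem.2 ⟨ha, fun x hx => ?_⟩⟩
  have h1 : vectorSpan ℝ B = ⊥ := Submodule.finrank_eq_zero.1 hdim
  have h2 := vsub_mem_vectorSpan ℝ hx ha
  rw [h1, Submodule.mem_bot, vsub_eq_sub, sub_eq_zero] at h2
  exact h2

/-- A contributing vertex is on a coordinate axis, and `m` divides its distance to the origin. -/
lemma Contributes.exists_axis {D : Set (κ → ℝ)} (hD : D.Finite)
    (hlat : ∀ a ∈ D, ∃ z : κ → ℕ, a = fun i => (z i : ℝ)) {m : ℕ} {a : κ → ℝ}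
    (ha : Contributes (orthantHull D Set.univ) m {a}) :
    ∃ (j : κ) (c : ℕ), 0 < c ∧ m ∣ c ∧ a = Pi.single j (c : ℝ) := by
  have haD : a ∈ D := by
    obtain ⟨hne, h, hh⟩ := isFace_iff.1 ha.isFace
    have h1 := face_inter_generators hD (hh ▸ hne)
    have h2 : (minFace D h).Nonempty := by
      have h0 := nonneg_of_minFace_nonempty (hh ▸ hne)
      have h3 : (minFace (orthantHull D Set.univ) h).Nonempty := hh ▸ hne
      rw [minFace_orthantHull hD h0] at h3
      exact nonempty_of_orthantHull h3
    rw [h1, ← hh] at h2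
    obtain ⟨x, hx, hxa⟩ := h2
    exact (Set.mem_singleton_iff.1 hxa) ▸ hx
  obtain ⟨z, hz⟩ := hlat a haD
  obtain ⟨J, hV, hm⟩ := ha
  have hcard := hV.card_eq
  rw [dim_singleton] at hcard
  obtain ⟨j, rfl⟩ := Finset.card_eq_one.1 hcard
  have hsupp : ∀ i, i ≠ j → a i = 0 := fun i hi =>
    hV.subset a rfl i (by simpa using hi)
  have haj : a = Pi.single j ((z j : ℕ) : ℝ) := by
    ext i
    by_cases hi : i = j
    · subst hi; simp [hz]
    · rw [hsupp i hi]; simp [hi]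
  have hpos : 0 < z j := by
    rw [Nat.pos_iff_ne_zero]
    intro h0
    refine hV.not_convenient ∅ ?_ (by rw [dim_singleton]; rfl)
    rintro x rfl i -
    rw [haj, h0]; simp
  refine ⟨j, z j, hpos, ?_, haj⟩
  have hmem : latticeDist {j} ({a} : Set (κ → ℝ)) ∈ {m : ℕ | ∃ l : κ → ℤ,
      Finset.gcd {j} l = 1 ∧ ∀ x ∈ ({a} : Set (κ → ℝ)), ∑ i ∈ {j}, (l i : ℝ) * x i = (m : ℝ)} := by
    refine Nat.sInf_mem ⟨z j, fun _ => 1, by simp, ?_⟩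
    rintro x rfl
    rw [haj]; simp
  obtain ⟨l, hl1, hl⟩ := hmem
  have h1 := hl a rfl
  rw [haj] at h1
  simp only [Finset.sum_singleton, Pi.single_eq_same] at h1
  have h2 : l j * (z j : ℤ) = latticeDist {j} ({a} : Set (κ → ℝ)) := by
    rw [haj]; exact_mod_cast h1
  have h3 : IsUnit (l j) := by
    rw [Finset.gcd_singleton] at hl1
    exact normalize_eq_one.1 hl1
  have h4 : (m : ℤ) ∣ l j * (z j : ℤ) := h2 ▸ Int.natCast_dvd_natCast.2 hm
  exact Int.natCast_dvd_natCast.1 (h3.dvd_mul_left.1 h4)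

/-- Every coordinate axis contains at most one contributing vertex. -/
lemma eq_of_same_axis {D : Set (κ → ℝ)} (hD : D.Finite) {m : ℕ} {j : κ} {c c' : ℝ}
    (ha : Contributes (orthantHull D Set.univ) m {Pi.single j c})
    (ha' : Contributes (orthantHull D Set.univ) m {Pi.single j c'}) : c = c' := by
  obtain ⟨h, hpos, hh⟩ := ha.exists_pos hD
  obtain ⟨h', hpos', hh'⟩ := ha'.exists_pos hD
  have h1 : Pi.single j c ∈ minFace (orthantHull D Set.univ) h := hh ▸ rfl
  have h2 : Pi.single j c' ∈ minFace (orthantHull D Set.univ) h' := hh' ▸ rfl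
  have h3 := h1.2 _ h2.1
  have h4 := h2.2 _ h1.1
  simp only [dotProduct_single] at h3 h4
  exact le_antisymm (le_of_mul_le_mul_left h3 (hpos j)) (le_of_mul_le_mul_left h4 (hpos' j))

lemma exists_other (hκ : Fintype.card κ = 2) (j : κ) : ∃ j', j' ≠ j ∧ ∀ i, i = j ∨ i = j' := by
  obtain ⟨j', hj'⟩ := Fintype.exists_ne_of_one_lt_card (by omega) j
  refine ⟨j', hj', fun i => ?_⟩
  by_contra! hcon
  have h1 : ({j, j', i} : Finset κ).card = 3 := by
    rw [Finset.card_eq_three]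
    exact ⟨j, j', i, hj'.symm, hcon.1.symm, hcon.2.symm, rfl⟩
  have h2 := Finset.card_le_univ ({j, j', i} : Finset κ)
  omega

/-- A Newton polygon has at most two contributing vertices. -/
lemma Contributes.eq_or_eq (hκ : Fintype.card κ = 2) {D : Set (κ → ℝ)} (hD : D.Finite)
    (hlat : ∀ a ∈ D, ∃ z : κ → ℕ, a = fun i => (z i : ℝ)) {m : ℕ} {a₁ a₂ a : κ → ℝ}
    (h₁ : Contributes (orthantHull D Set.univ) m {a₁})
    (h₂ : Contributes (orthantHull D Set.univ) m {a₂}) (hne : a₁ ≠ a₂)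
    (h : Contributes (orthantHull D Set.univ) m {a}) : a = a₁ ∨ a = a₂ := by
  obtain ⟨j₁, c₁, -, -, rfl⟩ := h₁.exists_axis hD hlat
  obtain ⟨j₂, c₂, -, -, rfl⟩ := h₂.exists_axis hD hlat
  obtain ⟨j, c, -, -, rfl⟩ := h.exists_axis hD hlat
  have hj : j₂ ≠ j₁ := by
    rintro rfl
    exact hne (by rw [eq_of_same_axis hD h₁ h₂])
  obtain ⟨j', hj', hall⟩ := exists_other hκ j₁
  obtain rfl : j₂ = j' := (hall j₂).resolve_left hj
  rcases hall j with rfl | rfl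
  · left; rw [eq_of_same_axis hD h h₁]
  · right; rw [eq_of_same_axis hD h h₂]

lemma dotProduct_eq_of_two {j j' : κ} (hj : j' ≠ j) (hall : ∀ i, i = j ∨ i = j') (h x : κ → ℝ) :
    h ⬝ᵥ x = h j * x j + h j' * x j' := by
  unfold dotProduct
  have : (Finset.univ : Finset κ) = {j, j'} := by
    ext i; simpa using hall i
  rw [this, Finset.sum_pair hj.symm]

omit [Fintype κ] [DecidableEq κ] in
lemma eq_of_two {j j' : κ} (hall : ∀ i, i = j ∨ i = j') {x y : κ → ℝ} (h : x j = y j)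
    (h' : x j' = y j') : x = y := by
  ext i
  rcases hall i with rfl | rfl
  · exact h
  · exact h'

omit [DecidableEq κ] in
lemma exists_pos_of_isBoundedEdge {D : Set (κ → ℝ)} (hD : D.Finite) {B : Set (κ → ℝ)}
    (hB : IsBoundedEdge (orthantHull D Set.univ) B) :
    ∃ h : κ → ℝ, (∀ j, 0 < h j) ∧ B = minFace (orthantHull D Set.univ) h :=
  exists_pos_of_bounded_face hD hB.1 hB.2.1

/-- Bounded edges of a Newton polygon are `V`-faces. -/
lemma IsBoundedEdge.contributes_iff (hκ : Fintype.card κ = 2) {D : Set (κ → ℝ)} (hD : D.Finite)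
    {m : ℕ} {B : Set (κ → ℝ)} (hB : IsBoundedEdge (orthantHull D Set.univ) B) :
    Contributes (orthantHull D Set.univ) m B ↔ m ∣ latticeDist Finset.univ B := by
  constructor
  · rintro ⟨J, hV, hm⟩
    have hJ : J = Finset.univ := by
      rw [← Finset.card_eq_iff_eq_univ, hV.card_eq, hB.2.2, hκ]
    rwa [← hJ]
  · intro hm
    refine ⟨Finset.univ, hB.1.isVFace_empty hB.2.1 (fun x _ i hi => absurd (Finset.mem_univ i) hi)
      (by rw [hB.2.2, Finset.card_univ, hκ]) fun K hK hcard => ?_, hm⟩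
    rw [hB.2.2] at hcard
    obtain ⟨j, rfl⟩ := Finset.card_eq_one.1 hcard
    obtain ⟨j', hj', hall⟩ := exists_other hκ j
    obtain ⟨h, hpos, rfl⟩ := exists_pos_of_isBoundedEdge hD hB
    have hsub : (minFace (orthantHull D Set.univ) h).Subsingleton := by
      intro x hx y hy
      have h1 := le_antisymm (hx.2 y hy.1) (hy.2 x hx.1)
      have hxj := hK x hx j' (by simpa using hj')
      have hyj := hK y hy j' (by simpa using hj')
      rw [dotProduct_eq_of_two hj' hall, dotProduct_eq_of_two hj' hall, hxj, hyj] at h1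
      refine eq_of_two hall ?_ (hxj.trans hyj.symm)
      have := (hpos j).ne'
      simpa [this] using h1
    have hd := hB.2.2
    obtain ⟨x, hx⟩ := hB.1.1
    rw [hsub.eq_singleton_of_mem hx, dim_singleton] at hd
    exact zero_ne_one hd

omit [DecidableEq κ] in
/-- A contributing face of a Newton polygon is a vertex or an edge. -/
lemma Contributes.dim_le_one (hκ : Fintype.card κ = 2) {P : Set (κ → ℝ)} {m : ℕ}
    {B : Set (κ → ℝ)} (hB : Contributes P m B) : dim B ≤ 1 := by
  obtain ⟨J, hV, -⟩ := hB
  have h1 := hV.card_eq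
  have h2 := Finset.card_le_univ J
  omega

lemma Contributes.isBoundedEdge {D : Set (κ → ℝ)} (hD : D.Finite) {m : ℕ} {B : Set (κ → ℝ)}
    (hB : Contributes (orthantHull D Set.univ) m B) (hdim : dim B = 1) :
    IsBoundedEdge (orthantHull D Set.univ) B :=
  ⟨hB.isFace, hB.isBounded hD, hdim⟩

/-- An edge which contains a contributing vertex contributes. -/
lemma IsBoundedEdge.contributes_of_mem (hκ : Fintype.card κ = 2) {D : Set (κ → ℝ)}
    (hD : D.Finite) (hlat : ∀ a ∈ D, ∃ z : κ → ℕ, a = fun i => (z i : ℝ)) {m : ℕ}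
    {B : Set (κ → ℝ)} (hB : IsBoundedEdge (orthantHull D Set.univ) B) {a : κ → ℝ}
    (ha : Contributes (orthantHull D Set.univ) m {a}) (haB : a ∈ B) :
    Contributes (orthantHull D Set.univ) m B := by
  rw [hB.contributes_iff hκ hD]
  obtain ⟨j, c, hc, hmc, rfl⟩ := ha.exists_axis hD hlat
  rcases Set.eq_empty_or_nonempty {m : ℕ | ∃ l : κ → ℤ, Finset.univ.gcd l = 1 ∧
    ∀ x ∈ B, ∑ i ∈ Finset.univ, (l i : ℝ) * x i = (m : ℝ)} with h0 | hne
  · unfold latticeDist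
    rw [h0, Nat.sInf_empty]
    exact dvd_zero m
  · obtain ⟨l, -, hl⟩ := Nat.sInf_mem hne
    have h1 := hl _ haB
    rw [Finset.sum_eq_single j (fun i _ hi => by simp [hi]) (by simp), Pi.single_eq_same] at h1
    have h2 : l j * (c : ℤ) = latticeDist Finset.univ B := by
      exact_mod_cast h1
    rw [← Int.natCast_dvd_natCast, ← h2]
    exact (Int.natCast_dvd_natCast.2 hmc).mul_left _

omit [DecidableEq κ] in
/-- The vectors parallel to a polygon edge are on a line. -/
lemma dim_minFace_le_one (hκ : Fintype.card κ = 2) (P : Set (κ → ℝ)) {h : κ → ℝ} (hh : h ≠ 0) :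
    dim (minFace P h) ≤ 1 := by
  have hle : vectorSpan ℝ (minFace P h) ≤ LinearMap.ker (dotProductBilin ℝ ℝ h) := by
    rw [vectorSpan_def, Submodule.span_le]
    rintro _ ⟨x, hx, y, hy, rfl⟩
    have h1 := le_antisymm (hx.2 y hy.1) (hy.2 x hx.1)
    simp [dotProductBilin, dotProduct_sub, h1]
  have hlt : LinearMap.ker (dotProductBilin ℝ ℝ h) ≠ ⊤ := by
    intro htop
    refine hh (dotProduct_self_eq_zero.1 ?_)
    have : h ∈ LinearMap.ker (dotProductBilin ℝ ℝ h) := htop ▸ Submodule.mem_top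
    simpa [dotProductBilin] using this
  have h1 := Submodule.finrank_mono hle
  have h2 := Submodule.finrank_lt hlt
  rw [Module.finrank_fintype_fun_eq_card, hκ] at h2
  unfold dim
  omega

omit [DecidableEq κ] in
lemma le_apply_of_mem_orthantHull {D : Set (κ → ℝ)} {i : κ} {t : ℝ} (h : ∀ d ∈ D, t ≤ d i)
    {x : κ → ℝ} (hx : x ∈ orthantHull D Set.univ) : t ≤ x i := by
  classical
  obtain ⟨y, hy, h1, -⟩ := hx
  refine le_trans ?_ (h1 i (Set.mem_univ i))
  have := le_dotProduct_of_mem_convexHull (h := Pi.single i 1) (c := t)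
    (fun a ha => by simpa using h a ha) hy
  simpa using this

/-- If a Newton polygon has a vertex on an axis and a point closer to the other axis, then there is
a bounded edge at this vertex. -/
lemma exists_adjacent_edge (hκ : Fintype.card κ = 2) {D : Set (κ → ℝ)}
    (hD : D.Finite) (hnn : ∀ a ∈ D, ∀ i, 0 ≤ a i) {m : ℕ} {j : κ} {c : ℝ}
    (ha : Contributes (orthantHull D Set.univ) m {Pi.single j c})
    (hd : ∃ d ∈ D, d j < c) :
    ∃ E, IsBoundedEdge (orthantHull D Set.univ) E ∧ Pi.single j c ∈ E := by
  obtain ⟨j', hj', hall⟩ := exists_other hκ j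
  obtain ⟨h, hpos, hh⟩ := ha.exists_pos hD
  have ha1 : Pi.single j c ∈ minFace (orthantHull D Set.univ) h := hh ▸ rfl
  have hslope : ∀ d ∈ D, d j < c → 0 < d j' := by
    intro d hdD hdc
    refine lt_of_le_of_ne (hnn d hdD j') fun h0 => ?_
    have h1 := ha1.2 d (subset_orthantHull D _ hdD)
    rw [dotProduct_eq_of_two hj' hall h d, ← h0, dotProduct_single] at h1
    nlinarith [hpos j]
  obtain ⟨d, ⟨hdD, hdc⟩, hdmin⟩ := Set.exists_min_image {d ∈ D | d j < c}
    (fun d => d j' / (c - d j)) (hD.subset fun x hx => hx.1) hd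
  set s := d j' / (c - d j) with hs
  have hs0 : 0 < s := div_pos (hslope d hdD hdc) (by linarith)
  have hds : d j' = s * (c - d j) := by rw [hs, div_mul_cancel₀ _ (by linarith)]
  -- the function which is constant on the line through `a` with the least slope
  set g : κ → ℝ := fun i => if i = j then s else 1 with hg
  have hgj : g j = s := by simp [hg]
  have hgj' : g j' = 1 := by simp [hg, hj']
  have hgpos : ∀ i, 0 < g i := by
    intro i
    rcases hall i with rfl | rfl
    · rw [hgj]; exact hs0
    · rw [hgj']; exact one_pos
  have hge : ∀ x ∈ D, s * c ≤ g ⬝ᵥ x := by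
    intro x hx
    rw [dotProduct_eq_of_two hj' hall, hgj, hgj', one_mul]
    rcases lt_or_ge (x j) c with hxc | hxc
    · have h1 : s ≤ x j' / (c - x j) := hdmin x ⟨hx, hxc⟩
      rw [le_div_iff₀ (by linarith)] at h1
      linarith
    · nlinarith [hnn x hx j']
  have hge' : ∀ x ∈ orthantHull D Set.univ, s * c ≤ g ⬝ᵥ x := by
    rintro x ⟨y, hy, h1, h2⟩
    exact (le_dotProduct_of_mem_convexHull hge hy).trans
      (dotProduct_le_of_up (fun i _ => (hgpos i).le) h1 h2)
  have hag : g ⬝ᵥ Pi.single j c = s * c := by rw [dotProduct_single, hgj]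
  have hdg : g ⬝ᵥ d = s * c := by
    rw [dotProduct_eq_of_two hj' hall, hgj, hgj', hds]; ring
  have haE : Pi.single j c ∈ minFace (orthantHull D Set.univ) g :=
    ⟨ha1.1, fun y hy => hag.trans_le (hge' y hy)⟩
  have hdE : d ∈ minFace (orthantHull D Set.univ) g :=
    ⟨subset_orthantHull D _ hdD, fun y hy => hdg.trans_le (hge' y hy)⟩
  refine ⟨_, ⟨isFace_iff.2 ⟨⟨_, haE⟩, g, rfl⟩, isBounded_minFace_of_pos hD fun i _ => hgpos i, ?_⟩,
    haE⟩
  have hle := dim_minFace_le_one hκ (orthantHull D Set.univ) (h := g)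
    fun h0 => (hgpos j).ne' (congrFun h0 j)
  refine le_antisymm hle (Nat.one_le_iff_ne_zero.2 fun h0 => ?_)
  obtain ⟨b, hb⟩ := exists_eq_singleton_of_dim_eq_zero ⟨_, haE⟩ h0
  rw [hb] at haE hdE
  have : d = Pi.single j c := hdE.trans haE.symm
  rw [this] at hdc
  simp at hdc

/-- If there is a bounded edge, then every contributing vertex is on a bounded edge. -/
lemma exists_adjacent_edge_of_edge (hκ : Fintype.card κ = 2) {D : Set (κ → ℝ)}
    (hD : D.Finite) (hnn : ∀ a ∈ D, ∀ i, 0 ≤ a i) {m : ℕ} {j : κ} {c : ℝ}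
    (ha : Contributes (orthantHull D Set.univ) m {Pi.single j c}) {E₀ : Set (κ → ℝ)}
    (hE₀ : IsBoundedEdge (orthantHull D Set.univ) E₀) :
    ∃ E, IsBoundedEdge (orthantHull D Set.univ) E ∧ Pi.single j c ∈ E := by
  refine exists_adjacent_edge hκ hD hnn ha ?_
  by_contra! hcon
  obtain ⟨j', hj', hall⟩ := exists_other hκ j
  obtain ⟨h, hpos, rfl⟩ := exists_pos_of_isBoundedEdge hD hE₀
  have haP : Pi.single j c ∈ orthantHull D Set.univ := by
    obtain ⟨-, g, hg⟩ := isFace_iff.1 ha.isFace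
    exact (hg ▸ rfl : Pi.single j c ∈ minFace (orthantHull D Set.univ) g).1
  have hsub : ∀ x ∈ minFace (orthantHull D Set.univ) h, x = Pi.single j c := by
    intro x hx
    have h1 := hx.2 _ haP
    have h2 := le_apply_of_mem_orthantHull hcon hx.1
    have h3 := le_apply_of_mem_orthantHull (fun d hd => hnn d hd j') hx.1
    rw [dotProduct_eq_of_two hj' hall h x, dotProduct_single] at h1
    have h4 := mul_le_mul_of_nonneg_left h2 (hpos j).le
    have h5 := mul_nonneg (hpos j').le h3
    have h6 : h j' * x j' = 0 := by linarith
    have h7 : h j * x j = h j * c := by linarith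
    refine eq_of_two hall ?_ ?_
    · rw [Pi.single_eq_same]
      exact mul_left_cancel₀ (hpos j).ne' h7
    · rw [Pi.single_eq_of_ne hj']
      exact (mul_eq_zero.1 h6).resolve_left (hpos j').ne'
  have hd := hE₀.2.2
  obtain ⟨x, hx⟩ := hE₀.1.1
  rw [Set.Subsingleton.eq_singleton_of_mem (fun y hy z hz => (hsub y hy).trans (hsub z hz).symm) hx,
    dim_singleton] at hd
  exact zero_ne_one hd

lemma eq_of_mem_axes_aux {P : Set (κ → ℝ)} {j j' : κ} (hj' : j' ≠ j) (hall : ∀ i, i = j ∨ i = j')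
    (hnn : ∀ x ∈ P, ∀ i, 0 ≤ x i) {c : ℝ} {h h' : κ → ℝ} (hpos : ∀ i, 0 < h i)
    (hpos' : 0 < h' j) (ha : Pi.single j c ∈ minFace P h) (hd : dim (minFace P h') = 1)
    (hle : h' j * h j' ≤ h' j' * h j) : minFace P h' = minFace P h := by
  have key : ∀ x ∈ minFace P h', (h' j' * h j - h' j * h j') * x j' = 0 ∧ h ⬝ᵥ x = h j * c := by
    intro x hx
    have h1 := ha.2 x hx.1
    have h2 := hx.2 _ ha.1
    have h3 := hnn x hx.1 j'
    rw [dotProduct_single] at h1 h2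
    rw [dotProduct_eq_of_two hj' hall h x] at h1 ⊢
    rw [dotProduct_eq_of_two hj' hall h' x] at h2
    have h4 := mul_le_mul_of_nonneg_left h1 hpos'.le
    have h5 := mul_le_mul_of_nonneg_left h2 (hpos j).le
    have h6 := mul_nonneg (sub_nonneg.2 hle) h3
    have h7 : (h' j' * h j - h' j * h j') * x j' = 0 := by linarith
    exact ⟨h7, mul_left_cancel₀ hpos'.ne' (by linarith)⟩
  rcases hle.eq_or_lt with heq | hlt
  · -- the two functions are proportional
    have hsm : h' = (h' j / h j) • h := by
      refine eq_of_two hall ?_ ?_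
      · simp [(hpos j).ne']
      · rw [Pi.smul_apply, smul_eq_mul, div_mul_eq_mul_div, heq, mul_div_cancel_right₀ _ (hpos j).ne']
    have hr : 0 < h' j / h j := div_pos hpos' (hpos j)
    rw [hsm]
    ext x
    simp only [minFace, Set.mem_ofPred_eq, smul_dotProduct, smul_eq_mul, mul_le_mul_iff_right₀ hr]
  · have hsub : (minFace P h').Subsingleton := by
      have hx0 : ∀ x ∈ minFace P h', x = Pi.single j c := by
        intro x hx
        obtain ⟨h1, h2⟩ := key x hx
        have h3 := (mul_eq_zero.1 h1).resolve_left (sub_pos.2 hlt).ne'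
        rw [dotProduct_eq_of_two hj' hall, h3, mul_zero, add_zero] at h2
        refine eq_of_two hall ?_ ?_
        · rw [Pi.single_eq_same]
          exact mul_left_cancel₀ (hpos j).ne' h2
        · rw [Pi.single_eq_of_ne hj', h3]
      exact fun x hx y hy => (hx0 x hx).trans (hx0 y hy).symm
    rcases hsub.eq_empty_or_singleton with h0 | ⟨x, h0⟩
    · rw [h0, dim, vectorSpan_empty, finrank_bot] at hd
      exact absurd hd zero_ne_one
    · rw [h0, dim_singleton] at hd
      exact absurd hd zero_ne_one

/-- A contributing vertex which is not the only contributing face is on a bounded edge. -/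
lemma exists_adjacent_edge_of_contributes (hκ : Fintype.card κ = 2) {D : Set (κ → ℝ)}
    (hD : D.Finite) (hlat : ∀ a ∈ D, ∃ z : κ → ℕ, a = fun i => (z i : ℝ)) {m : ℕ} {a : κ → ℝ}
    (ha : Contributes (orthantHull D Set.univ) m {a}) {F : Set (κ → ℝ)}
    (hF : Contributes (orthantHull D Set.univ) m F) (hFa : F ≠ {a}) :
    ∃ E, IsBoundedEdge (orthantHull D Set.univ) E ∧ a ∈ E := by
  have hnn : ∀ a ∈ D, ∀ i, 0 ≤ a i := fun a ha i => by
    obtain ⟨z, rfl⟩ := hlat a ha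
    exact Nat.cast_nonneg _
  obtain ⟨j, c, hc, -, rfl⟩ := ha.exists_axis hD hlat
  have h1 := hF.dim_le_one hκ
  rcases Nat.le_one_iff_eq_zero_or_eq_one.1 h1 with h0 | h1
  · obtain ⟨b, rfl⟩ := exists_eq_singleton_of_dim_eq_zero hF.isFace.1 h0
    obtain ⟨j', c', hc', -, rfl⟩ := hF.exists_axis hD hlat
    have hj : j' ≠ j := by
      rintro rfl
      exact hFa (by rw [eq_of_same_axis hD ha hF])
    refine exists_adjacent_edge hκ hD hnn ha ?_
    by_contra! hcon
    have hP : Pi.single j' (c' : ℝ) ∈ orthantHull D Set.univ := hF.isFace.2.subset rfl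
    have h2 := le_apply_of_mem_orthantHull hcon hP
    rw [Pi.single_eq_of_ne hj.symm] at h2
    exact absurd h2 (not_le.2 (by exact_mod_cast hc))
  · exact exists_adjacent_edge_of_edge hκ hD hnn ha (hF.isBoundedEdge hD h1)

omit [DecidableEq κ] in
lemma IsBoundedEdge.exists_isLatticeSegment {D : Set (κ → ℝ)} (hD : D.Finite)
    (hlat : ∀ a ∈ D, IsLatticePoint a) {E : Set (κ → ℝ)}
    (hE : IsBoundedEdge (orthantHull D Set.univ) E) : ∃ z e L, IsLatticeSegment E z e L := by
  obtain ⟨h, hpos, rfl⟩ := exists_pos_of_isBoundedEdge hD hE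
  have hdim := hE.2.2
  rw [minFace_orthantHull_of_pos hD fun i _ => hpos i] at hdim ⊢
  exact TropicalMonodromy.exists_isLatticeSegment (hD.subset fun a ha => ha.1)
    (fun a ha => hlat a ha.1) hdim

/-- An edge which connects two coordinate axes is the only bounded edge. -/
lemma eq_of_mem_axes {D : Set (κ → ℝ)} (hD : D.Finite) {j j' : κ} (hj' : j' ≠ j)
    (hall : ∀ i, i = j ∨ i = j') (hnn : ∀ a ∈ D, ∀ i, 0 ≤ a i) {c c' : ℝ} {E E' : Set (κ → ℝ)}
    (hE : IsBoundedEdge (orthantHull D Set.univ) E)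
    (hE' : IsBoundedEdge (orthantHull D Set.univ) E')
    (ha : Pi.single j c ∈ E) (ha' : Pi.single j' c' ∈ E) : E' = E := by
  obtain ⟨h, hpos, rfl⟩ := exists_pos_of_isBoundedEdge hD hE
  obtain ⟨h', hpos', rfl⟩ := exists_pos_of_isBoundedEdge hD hE'
  have hnn' : ∀ x ∈ orthantHull D Set.univ, ∀ i, 0 ≤ x i := fun x hx i =>
    le_apply_of_mem_orthantHull (fun d hd => hnn d hd i) hx
  rcases le_total (h' j * h j') (h' j' * h j) with hle | hle
  · exact eq_of_mem_axes_aux hj' hall hnn' hpos (hpos' j) ha hE'.2.2 hle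
  · exact eq_of_mem_axes_aux hj'.symm (fun i => (hall i).symm) hnn' hpos (hpos' j') ha' hE'.2.2 hle

/-- The configurations of contributing faces of a Newton polygon, for which the total lattice length
of the contributing edges is the number of the contributing vertices. -/
theorem classification_of_sum_eq_zero (hκ : Fintype.card κ = 2) {D : Set (κ → ℝ)}
    (hD : D.Finite) (hlat : ∀ a ∈ D, ∃ z : κ → ℕ, a = fun i => (z i : ℝ)) {m : ℕ}
    (hfin : {B | Contributes (orthantHull D Set.univ) m B}.Finite)
    (hsum : ∑ B ∈ hfin.toFinset, (if dim B = 0 then -1 else latticeVolume B) = 0) :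
    (∀ B, ¬ Contributes (orthantHull D Set.univ) m B) ∨
    (∃ E z e, IsLatticeSegment E z e 2 ∧ IsBoundedEdge (orthantHull D Set.univ) E ∧
      (∀ E', IsBoundedEdge (orthantHull D Set.univ) E' → E' = E) ∧
      ∀ F, Contributes (orthantHull D Set.univ) m F ↔ F = {intToReal κ z} ∨
        F = {intToReal κ z + ((2 : ℕ) : ℝ) • intToReal κ e} ∨ F = E) ∨
    (∃ E z e, IsLatticeSegment E z e 1 ∧
      ∀ F, Contributes (orthantHull D Set.univ) m F ↔ F = {intToReal κ z} ∨ F = E) ∨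
    ∃ E₁ z₁ e₁ E₂ z₂ e₂, IsLatticeSegment E₁ z₁ e₁ 1 ∧ IsLatticeSegment E₂ z₂ e₂ 1 ∧ E₁ ≠ E₂ ∧
      intToReal κ z₁ ≠ intToReal κ z₂ ∧
      ∀ F, Contributes (orthantHull D Set.univ) m F ↔ F = {intToReal κ z₁} ∨
        F = {intToReal κ z₂} ∨ F = E₁ ∨ F = E₂ := by
  classical
  have hnn : ∀ a ∈ D, ∀ i, 0 ≤ a i := fun a ha i => by
    obtain ⟨z, rfl⟩ := hlat a ha
    exact Nat.cast_nonneg _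
  have hlat' : ∀ a ∈ D, IsLatticePoint a := fun a ha => by
    obtain ⟨z, rfl⟩ := hlat a ha
    exact ⟨fun i => z i, fun i => by simp⟩
  set P := orthantHull D Set.univ with hP
  set V := hfin.toFinset.filter fun B => dim B = 0 with hV
  set Es := hfin.toFinset.filter fun B => ¬ dim B = 0 with hEs
  have hVmem : ∀ B, B ∈ V ↔ Contributes P m B ∧ dim B = 0 := by simp [hV]
  have hEmem : ∀ B, B ∈ Es ↔ Contributes P m B ∧ dim B = 1 := by
    intro B
    simp only [hEs, Finset.mem_filter, Set.Finite.mem_toFinset, Set.mem_ofPred_eq]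
    refine and_congr_right fun hB => ?_
    have := hB.dim_le_one hκ
    omega
  have hedge : ∀ B ∈ Es, IsBoundedEdge P B := fun B hB =>
    ((hEmem B).1 hB).1.isBoundedEdge hD ((hEmem B).1 hB).2
  have hvert : ∀ B, Contributes P m B → dim B = 0 → ∃ a, B = {a} := fun B hB h0 =>
    exists_eq_singleton_of_dim_eq_zero hB.isFace.1 h0
  have hseg : ∀ B, B ∈ Es → ∃ z e L, IsLatticeSegment B z e L := fun B hB =>
    (hedge B hB).exists_isLatticeSegment hD hlat'
  choose! zf ef ℓ hℓ using hseg
  have hcount : V.card = ∑ B ∈ Es, ℓ B := by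
    rw [← Finset.sum_filter_add_sum_filter_not hfin.toFinset (fun B => dim B = 0)] at hsum
    have h1 : ∑ B ∈ V, (if dim B = 0 then -1 else latticeVolume B) = -(V.card : ℝ) := by
      rw [Finset.sum_congr rfl fun B hB => if_pos ((hVmem B).1 hB).2]
      simp
    have h2 : ∑ B ∈ Es, (if dim B = 0 then -1 else latticeVolume B) = ∑ B ∈ Es, (ℓ B : ℝ) :=
      Finset.sum_congr rfl fun B hB => by
        rw [if_neg (Finset.mem_filter.1 hB).2, (hℓ B hB).dim_latticeVolume.2]
    rw [h1, h2] at hsum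
    have : (V.card : ℝ) = ((∑ B ∈ Es, ℓ B : ℕ) : ℝ) := by
      push_cast
      linarith
    exact_mod_cast this
  have hone : ∀ B ∈ Es, 1 ≤ ℓ B := fun B hB => (hℓ B hB).pos
  have hcard : Es.card ≤ ∑ B ∈ Es, ℓ B := by
    rw [Finset.card_eq_sum_ones]
    exact Finset.sum_le_sum hone
  have hlen : ∀ {E z e L}, E ∈ Es → IsLatticeSegment E z e L → L = ℓ E := by
    intro E z e L hE hH
    have := hH.dim_latticeVolume.2.symm.trans (hℓ E hE).dim_latticeVolume.2
    exact_mod_cast this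
  have hall : ∀ F, Contributes P m F ↔ F ∈ V ∨ F ∈ Es := by
    intro F
    rw [hVmem, hEmem]
    refine ⟨fun hF => ?_, fun h => h.elim And.left And.left⟩
    have := hF.dim_le_one hκ
    rcases Nat.le_one_iff_eq_zero_or_eq_one.1 this with h | h
    · exact Or.inl ⟨hF, h⟩
    · exact Or.inr ⟨hF, h⟩
  -- the edge at a contributing vertex
  have hadj : ∀ a, Contributes P m {a} → (∃ F, Contributes P m F ∧ F ≠ {a}) →
      ∃ E z e, E ∈ Es ∧ IsLatticeSegment E z e (ℓ E) ∧ a = intToReal κ z := by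
    rintro a ha ⟨F, hF, hFa⟩
    obtain ⟨E, hE, haE⟩ := exists_adjacent_edge_of_contributes hκ hD hlat ha hF hFa
    have hEs' : E ∈ Es := (hEmem E).2 ⟨hE.contributes_of_mem hκ hD hlat ha haE, hE.2.2⟩
    obtain ⟨z, e, H, hz⟩ := (hℓ E hEs').exists_start_eq
      (fun x hx => hE.1.2.subset hx) ha.isFace haE
    exact ⟨E, z, e, hEs', H, hz⟩
  rcases V.eq_empty_or_nonempty with hV0 | ⟨B₁, hB₁⟩
  · left
    rw [hV0, Finset.card_empty] at hcount
    have hE0 : Es = ∅ := by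
      rw [← Finset.card_eq_zero]
      omega
    intro B hB
    rcases (hall B).1 hB with h | h
    · simp [hV0] at h
    · simp [hE0] at h
  right
  obtain ⟨hc₁, hd₁⟩ := (hVmem B₁).1 hB₁
  obtain ⟨a₁, rfl⟩ := hvert B₁ hc₁ hd₁
  by_cases hex : ∃ a₂, Contributes P m {a₂} ∧ a₂ ≠ a₁
  · obtain ⟨a₂, hc₂, hne⟩ := hex
    have hV2 : V = {{a₁}, {a₂}} := by
      ext F
      rw [hVmem, Finset.mem_insert, Finset.mem_singleton]
      constructor
      · rintro ⟨hF, h0⟩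
        obtain ⟨a, rfl⟩ := hvert F hF h0
        rcases hc₁.eq_or_eq hκ hD hlat hc₂ hne.symm hF with rfl | rfl
        · exact Or.inl rfl
        · exact Or.inr rfl
      · rintro (rfl | rfl)
        · exact ⟨hc₁, dim_singleton _⟩
        · exact ⟨hc₂, dim_singleton _⟩
    have hV2c : V.card = 2 := by
      rw [hV2, Finset.card_pair fun h => hne (Set.singleton_injective h).symm]
    obtain ⟨E₁, z₁, e₁, hE₁, H₁, rfl⟩ := hadj a₁ hc₁ ⟨{a₂}, hc₂, fun h =>
      hne (Set.singleton_injective h)⟩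
    obtain ⟨E₂, z₂, e₂, hE₂, H₂, rfl⟩ := hadj a₂ hc₂ ⟨_, hc₁, fun h =>
      hne (Set.singleton_injective h).symm⟩
    by_cases hEE : E₁ = E₂
    · left
      subst hEE
      have hm₁ : intToReal κ z₁ ∈ E₁ := by simpa using H₁.point_mem (Nat.zero_le _)
      have hm₂ : intToReal κ z₂ ∈ E₁ := by simpa using H₂.point_mem (Nat.zero_le _)
      have huniq : ∀ E', IsBoundedEdge P E' → E' = E₁ := by
        intro E' hE'
        obtain ⟨j₁, c₁, -, -, h₁⟩ := hc₁.exists_axis hD hlat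
        obtain ⟨j₂, c₂, -, -, h₂⟩ := hc₂.exists_axis hD hlat
        have hj : j₂ ≠ j₁ := by
          rintro rfl
          rw [h₁] at hc₁
          rw [h₂] at hc₂
          exact hne (by rw [h₁, h₂, eq_of_same_axis hD hc₁ hc₂])
        obtain ⟨j', hj', hjall⟩ := exists_other hκ j₁
        obtain rfl : j₂ = j' := (hjall j₂).resolve_left hj
        exact eq_of_mem_axes hD hj hjall hnn (hedge _ hE₁) hE' (h₁ ▸ hm₁) (h₂ ▸ hm₂)
      have hEs1 : Es = {E₁} :=
        Finset.eq_singleton_iff_unique_mem.2 ⟨hE₁, fun E' hE' => huniq E' (hedge E' hE')⟩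
      have hℓ2 : ℓ E₁ = 2 := by
        rw [hV2c, hEs1, Finset.sum_singleton] at hcount
        exact hcount.symm
      rw [hℓ2] at H₁
      have hz₂ := (H₁.eq_or_eq_of_isFace (fun x hx => (hedge _ hE₁).1.2.subset hx) hc₂.isFace
        hm₂).resolve_left hne
      refine ⟨E₁, z₁, e₁, H₁, hedge _ hE₁, huniq, fun F => ?_⟩
      rw [hall, hV2, hEs1, ← hz₂]
      simp [or_assoc]
    · right; right
      have hpair : ({E₁, E₂} : Finset _) ⊆ Es := by
        simp [Finset.insert_subset_iff, hE₁, hE₂]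
      have hEs2 : {E₁, E₂} = Es := Finset.eq_of_subset_of_card_le hpair (by
        rw [Finset.card_pair hEE]; omega)
      have hsum2 : 2 = ℓ E₁ + ℓ E₂ := by
        rw [← Finset.sum_pair hEE, hEs2, ← hcount, hV2c]
      have h1 := hone _ hE₁
      have h2 := hone _ hE₂
      have h3 : ℓ E₁ = 1 := by omega
      have h4 : ℓ E₂ = 1 := by omega
      rw [h3] at H₁
      rw [h4] at H₂
      refine ⟨E₁, z₁, e₁, E₂, z₂, e₂, H₁, H₂, hEE, hne.symm, fun F => ?_⟩
      rw [hall, hV2, ← hEs2]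
      simp [or_assoc]
  · push Not at hex
    right; left
    have hV1 : V = {{a₁}} := by
      refine Finset.eq_singleton_iff_unique_mem.2 ⟨hB₁, fun F hF => ?_⟩
      obtain ⟨hF, h0⟩ := (hVmem F).1 hF
      obtain ⟨a, rfl⟩ := hvert F hF h0
      rw [hex a hF]
    rw [hV1, Finset.card_singleton] at hcount
    have hEne : Es.Nonempty := by
      rw [Finset.nonempty_iff_ne_empty]
      intro h
      rw [h, Finset.sum_empty] at hcount
      exact one_ne_zero hcount
    obtain ⟨E₀, hE₀⟩ := hEne
    obtain ⟨E, z, e, hE, H, rfl⟩ := hadj a₁ hc₁ ⟨E₀, ((hEmem E₀).1 hE₀).1, fun h => by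
      have := ((hEmem E₀).1 hE₀).2
      rw [h, dim_singleton] at this
      exact zero_ne_one this⟩
    have hEs1 : Es = {E} := Finset.eq_singleton_iff_unique_mem.2
      ⟨hE, fun E' hE' => Finset.card_le_one.1 (by omega) E' hE' E hE⟩
    rw [hEs1, Finset.sum_singleton] at hcount
    rw [← hcount] at H
    refine ⟨E, z, e, H, fun F => ?_⟩
    rw [hall, hV1, hEs1]
    simp

end VertexFaces

/-! ### Fibers over the faces of the projection -/

section FibersOverFaces

variable {ι : Type*} [Fintype ι] [DecidableEq ι]

/-- The lattice length of the face of the fiber of `N` over `b`, at which the linear function `v` is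
minimal; it is `0` if this face is a point. -/
noncomputable def fiberLength (N : Set (ι → ℝ)) (I : Finset ι) (b : {i // i ∉ I} → ℝ)
    (v : I → ℝ) : ℝ :=
  latticeLength (minFace (liftFace N I {b}) (extendZero I v))

omit [Fintype ι] in
lemma intToReal_extendCompl (I : Finset ι) (τ : {i // i ∉ I} → ℤ) :
    intToReal ι (extendCompl I τ) = extendCompl I (intToReal _ τ) := by
  ext i
  by_cases hi : i ∈ I
  · simp [extendCompl_of_mem _ hi]
  · simp [extendCompl_of_notMem _ hi]

omit [Fintype ι] in
lemma projAlong_extendCompl (I : Finset ι) (x : {i // i ∉ I} → ℝ) :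
    projAlong I (extendCompl I x) = x := by
  ext j
  simp [projAlong]

lemma intToReal_extendCompl_dotProduct {I : Finset ι} (τ : {i // i ∉ I} → ℤ) (x : ι → ℝ) :
    intToReal ι (extendCompl I τ) ⬝ᵥ x = intToReal _ τ ⬝ᵥ projAlong I x := by
  rw [intToReal_extendCompl, extendCompl_dotProduct]

/-- The property `p` holds for all positive linear functions outside a set of codimension greater
than `d`. -/
abbrev ForGeneric {κ : Type*} (d : ℕ) (p : (κ → ℝ) → Prop) : Prop :=
  ∃ S : Finset (Submodule ℝ (κ → ℝ)),
    (∀ W ∈ S, Module.finrank ℝ W + d < Module.finrank ℝ (κ → ℝ)) ∧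
    ∀ v : κ → ℝ, (∀ i, 0 < v i) → (∀ W ∈ S, v ∉ W) → p v

lemma ForGeneric.mono {κ : Type*} {d : ℕ} {p q : (κ → ℝ) → Prop} (hp : ForGeneric d p)
    (h : ∀ v, (∀ i, 0 < v i) → p v → q v) : ForGeneric d q := by
  obtain ⟨S, hS, hpS⟩ := hp
  exact ⟨S, hS, fun v hv hvS => h v hv (hpS v hv hvS)⟩

lemma ForGeneric.and {κ : Type*} {d : ℕ} {p q : (κ → ℝ) → Prop} (hp : ForGeneric d p)
    (hq : ForGeneric d q) : ForGeneric d fun v => p v ∧ q v := by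
  classical
  obtain ⟨S, hS, hpS⟩ := hp
  obtain ⟨T, hT, hqT⟩ := hq
  refine ⟨S ∪ T, fun W hW => (Finset.mem_union.1 hW).elim (hS W) (hT W), fun v hv hvS =>
    ⟨hpS v hv fun W hW => hvS W (Finset.mem_union_left _ hW),
      hqT v hv fun W hW => hvS W (Finset.mem_union_right _ hW)⟩⟩

lemma ForGeneric.forall_mem {κ α : Type*} {d : ℕ} {p : α → (κ → ℝ) → Prop} (T : Finset α)
    (h : ∀ a ∈ T, ForGeneric d (p a)) : ForGeneric d fun v => ∀ a ∈ T, p a v := by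
  classical
  induction T using Finset.induction_on with
  | empty => exact ⟨∅, by simp, by simp⟩
  | insert a T ha ih =>
    refine ((h a (Finset.mem_insert_self a T)).and
      (ih fun b hb => h b (Finset.mem_insert_of_mem hb))).mono fun v _ hv b hb => ?_
    rcases Finset.mem_insert.1 hb with rfl | hb
    · exact hv.1
    · exact hv.2 b hb

lemma ForGeneric.exists {κ : Type*} [Finite κ] {d : ℕ} {p : (κ → ℝ) → Prop}
    (hp : ForGeneric d p) : ∃ v, p v := by
  have := Fintype.ofFinite κ
  obtain ⟨S, hS, hpS⟩ := hp
  obtain ⟨v, hv, hvS⟩ := exists_mem_open_notMem S (fun W hW => ne_top_of_finrank_add_lt (hS W hW))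
    isOpen_pos ⟨fun _ => 1, fun _ => one_pos⟩
  exact ⟨v, hpS v hv hvS⟩

variable {C : Set (ι → ℝ)} {I : Finset ι}

/-- The generators over the end points of a bounded edge. -/
lemma exists_generator_of_minimal (hC : C.Finite) {h : {i // i ∉ I} → ℝ} (hpos : ∀ j, 0 < h j)
    {σ x : {i // i ∉ I} → ℝ}
    (hx : x ∈ minFace (projAlong I '' orthantHull C Set.univ) h)
    (hmin : ∀ y ∈ minFace (projAlong I '' orthantHull C Set.univ) h, σ ⬝ᵥ x ≤ σ ⬝ᵥ y) :
    ∃ a ∈ C, projAlong I a ∈ minFace (projAlong I '' orthantHull C Set.univ) h ∧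
      σ ⬝ᵥ projAlong I a = σ ⬝ᵥ x := by
  have hB : minFace (projAlong I '' orthantHull C Set.univ) h =
      convexHull ℝ (minFace (projAlong I '' C) h) := by
    rw [projAlong_image_newton]
    exact minFace_orthantHull_of_pos (hC.image _) fun j _ => hpos j
  have h1 : x ∈ convexHull ℝ {a ∈ minFace (projAlong I '' C) h | σ ⬝ᵥ a = σ ⬝ᵥ x} := by
    refine mem_convexHull_of_dotProduct_eq (fun a ha => hmin a ?_) (hB ▸ hx) rfl
    rw [hB]
    exact subset_convexHull ℝ _ ha
  obtain ⟨_, ha, hax⟩ := convexHull_nonempty_iff.1 ⟨x, h1⟩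
  obtain ⟨a, haC, rfl⟩ := ha.1
  refine ⟨a, haC, ?_, hax⟩
  rw [hB]
  exact subset_convexHull ℝ _ ha

/-- The polyhedron over a bounded edge of the projection. -/
lemma isEdgeSystem_of_isLatticeSegment (hC : C.Finite) (hlat : ∀ a ∈ C, IsLatticePoint a)
    {h : {i // i ∉ I} → ℝ} (hpos : ∀ j, 0 < h j) {z e τ : {i // i ∉ I} → ℤ} {L : ℕ}
    (H : IsLatticeSegment (minFace (projAlong I '' orthantHull C Set.univ) h) z e L)
    (hτ : τ ⬝ᵥ e = 1) :
    IsEdgeSystem {a ∈ C | projAlong I a ∈ minFace (projAlong I '' orthantHull C Set.univ) h} I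
      (extendCompl I (z - (τ ⬝ᵥ z) • e)) (extendCompl I e) (extendCompl I τ) (τ ⬝ᵥ z) L := by
  have hval : ∀ x ∈ minFace (projAlong I '' orthantHull C Set.univ) h, ∃ θ : ℝ, 0 ≤ θ ∧ θ ≤ L ∧
      x = intToReal _ z + θ • intToReal _ e ∧ intToReal _ τ ⬝ᵥ x = ((τ ⬝ᵥ z : ℤ) : ℝ) + θ := by
    intro x hx
    obtain ⟨θ, h0, h1, rfl⟩ := H.mem_iff.1 hx
    exact ⟨θ, h0, h1, rfl, dotProduct_add_smul_intToReal hτ z θ⟩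
  have hz := H.point_mem (Nat.zero_le L)
  have hw := H.point_mem le_rfl
  refine ⟨hC.subset fun a ha => ha.1, fun a ha => hlat a ha.1, H.pos,
    fun i hi => extendCompl_of_mem _ hi, fun i hi => extendCompl_of_mem _ hi, ?_, ?_, ?_, ?_, ?_⟩
  · have h1 : ((extendCompl I τ ⬝ᵥ extendCompl I e : ℤ) : ℝ) = ((τ ⬝ᵥ e : ℤ) : ℝ) := by
      rw [← intToReal_dotProduct, intToReal_extendCompl_dotProduct, intToReal_extendCompl,
        projAlong_extendCompl, intToReal_dotProduct]
    rw [hτ] at h1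
    exact_mod_cast h1
  · rintro a ⟨-, ha⟩ j hj
    obtain ⟨θ, -, -, hx, hxτ⟩ := hval _ ha
    rw [intToReal_extendCompl_dotProduct, hxτ, extendCompl_of_notMem _ hj,
      extendCompl_of_notMem _ hj]
    have := congrFun hx ⟨j, hj⟩
    simp only [projAlong, Pi.add_apply, Pi.smul_apply, intToReal_apply, smul_eq_mul] at this
    rw [this]
    simp only [Pi.sub_apply, Pi.smul_apply, smul_eq_mul]
    push_cast
    ring
  · rintro a ⟨-, ha⟩
    obtain ⟨θ, h0, h1, hx, hxτ⟩ := hval _ ha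
    rw [intToReal_extendCompl_dotProduct, hxτ]
    exact ⟨by linarith, by linarith⟩
  · obtain ⟨a, haC, haB, ha⟩ := exists_generator_of_minimal hC hpos (σ := intToReal _ τ) hz
      fun y hy => by
        obtain ⟨θ, h0, -, -, hyτ⟩ := hval y hy
        rw [hyτ, dotProduct_add_smul_intToReal hτ]
        simpa using h0
    refine ⟨a, ⟨haC, haB⟩, ?_⟩
    rw [intToReal_extendCompl_dotProduct, ha, dotProduct_add_smul_intToReal hτ]
    simp
  · obtain ⟨a, haC, haB, ha⟩ := exists_generator_of_minimal hC hpos (σ := -intToReal _ τ) hw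
      fun y hy => by
        obtain ⟨θ, -, h1, -, hyτ⟩ := hval y hy
        rw [neg_dotProduct, neg_dotProduct, hyτ, dotProduct_add_smul_intToReal hτ]
        linarith
    refine ⟨a, ⟨haC, haB⟩, ?_⟩
    rw [neg_dotProduct, neg_dotProduct, neg_inj] at ha
    rw [intToReal_extendCompl_dotProduct, ha, dotProduct_add_smul_intToReal hτ]

/-- The sections of the polyhedron over a bounded edge are fibers of the Newton polyhedron. -/
lemma edgeSection_eq_fiber (hC : C.Finite) (hne : C.Nonempty)
    {h : {i // i ∉ I} → ℝ} (hpos : ∀ j, 0 < h j) {z e τ : {i // i ∉ I} → ℤ} {L : ℕ}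
    (H : IsLatticeSegment (minFace (projAlong I '' orthantHull C Set.univ) h) z e L)
    (hτ : τ ⬝ᵥ e = 1) {k : ℕ} (hk : k ≤ L) :
    edgeSection {a ∈ C | projAlong I a ∈ minFace (projAlong I '' orthantHull C Set.univ) h} I
      (extendCompl I τ) ((τ ⬝ᵥ z : ℤ) + (k : ℕ)) =
    liftFace (orthantHull C Set.univ) I {intToReal _ z + (k : ℝ) • intToReal _ e} := by
  unfold edgeSection
  rw [← liftFace_eq_orthantHull hC hne hpos]
  ext x
  constructor
  · rintro ⟨⟨hxN, hxB⟩, hx⟩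
    refine ⟨hxN, ?_⟩
    obtain ⟨θ, -, -, hθ⟩ := H.mem_iff.1 hxB
    rw [intToReal_extendCompl_dotProduct, hθ, dotProduct_add_smul_intToReal hτ] at hx
    rw [Set.mem_singleton_iff, hθ, add_left_cancel hx]
  · rintro ⟨hxN, hx⟩
    rw [Set.mem_singleton_iff] at hx
    refine ⟨⟨hxN, hx ▸ H.point_mem hk⟩, ?_⟩
    rw [intToReal_extendCompl_dotProduct, hx, dotProduct_add_smul_intToReal hτ]

lemma dim_orthantHull_generators (hC : C.Finite) (hne : C.Nonempty)
    {h : {i // i ∉ I} → ℝ} (hpos : ∀ j, 0 < h j) :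
    dim (orthantHull
      {a ∈ C | projAlong I a ∈ minFace (projAlong I '' orthantHull C Set.univ) h} I) =
      I.card + dim (minFace (projAlong I '' orthantHull C Set.univ) h) ∧
    {a ∈ C | projAlong I a ∈ minFace (projAlong I '' orthantHull C Set.univ) h}.Nonempty := by
  have hBne : (minFace (projAlong I '' orthantHull C Set.univ) h).Nonempty := by
    rw [projAlong_image_newton]
    exact minFace_orthantHull_nonempty (hC.image _) (hne.image _) fun j _ => (hpos j).le
  have hproj : projAlong I '' liftFace (orthantHull C Set.univ) I
      (minFace (projAlong I '' orthantHull C Set.univ) h) =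
      minFace (projAlong I '' orthantHull C Set.univ) h := projAlong_image_liftFace fun x hx => hx.1
  rw [← hproj] at hBne
  have hΓne := Set.image_nonempty.1 hBne
  rw [liftFace_eq_orthantHull hC hne hpos] at hΓne hproj
  have hDne := nonempty_of_orthantHull hΓne
  refine ⟨?_, hDne⟩
  rw [dim_orthantHull hDne, hproj]

/-- The codimension `0` weight of a bounded edge is its lattice length. -/
lemma exists_generic_edge_zero (hC : C.Finite) (hne : C.Nonempty)
    (hlat : ∀ a ∈ C, IsLatticePoint a)
    {h : {i // i ∉ I} → ℝ} (hpos : ∀ j, 0 < h j) {z e : {i // i ∉ I} → ℤ} {L : ℕ}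
    (H : IsLatticeSegment (minFace (projAlong I '' orthantHull C Set.univ) h) z e L) :
    ForGeneric 0 fun v : I → ℝ =>
        faceWeight I (liftFace (orthantHull C Set.univ) I
          (minFace (projAlong I '' orthantHull C Set.univ) h)) 1 v = L := by
  obtain ⟨τ, hτ⟩ := H.primitive
  have hsys := isEdgeSystem_of_isLatticeSegment hC hlat hpos H hτ
  obtain ⟨hdim, hDne⟩ := dim_orthantHull_generators hC hne hpos
  rw [H.dim_latticeVolume.1] at hdim
  obtain ⟨S, hS, hgen⟩ := exists_generic_subspaces (I := I) (hC.subset fun a ha => ha.1) hDne 2 0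
    (by rw [hdim]; omega)
  refine ⟨S, hS, fun v hv hvS => ?_⟩
  beta_reduce
  rw [liftFace_eq_orthantHull hC hne hpos, faceWeight]
  exact hsys.weightAt_zero hv (hgen v hvS)

/-- The codimension `1` weight of a bounded edge is, up to the sign, the sum of the lattice lengths
of faces of the fibers over its lattice points, the interior ones being counted twice. -/
lemma exists_generic_edge_one (hC : C.Finite) (hne : C.Nonempty)
    (hlat : ∀ a ∈ C, IsLatticePoint a)
    {h : {i // i ∉ I} → ℝ} (hpos : ∀ j, 0 < h j) {z e : {i // i ∉ I} → ℤ} {L : ℕ}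
    (H : IsLatticeSegment (minFace (projAlong I '' orthantHull C Set.univ) h) z e L) :
    ForGeneric 1 fun v : I → ℝ =>
        faceWeight I (liftFace (orthantHull C Set.univ) I
          (minFace (projAlong I '' orthantHull C Set.univ) h)) 2 v =
          -∑ k ∈ Finset.range L,
            (fiberLength (orthantHull C Set.univ) I
              (intToReal _ z + (k : ℝ) • intToReal _ e) v +
            fiberLength (orthantHull C Set.univ) I
              (intToReal _ z + ((k + 1 : ℕ) : ℝ) • intToReal _ e) v) ∧
        ∀ k ≤ L,
          0 ≤ fiberLength (orthantHull C Set.univ) I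
            (intToReal _ z + (k : ℝ) • intToReal _ e) v ∧
          (fiberLength (orthantHull C Set.univ) I
            (intToReal _ z + (k : ℝ) • intToReal _ e) v = 0 →
          (minFace (liftFace (orthantHull C Set.univ) I
            {intToReal _ z + (k : ℝ) • intToReal _ e}) (extendZero I v)).Subsingleton) := by
  obtain ⟨τ, hτ⟩ := H.primitive
  have hsys := isEdgeSystem_of_isLatticeSegment hC hlat hpos H hτ
  obtain ⟨hdim, hDne⟩ := dim_orthantHull_generators hC hne hpos
  rw [H.dim_latticeVolume.1] at hdim
  obtain ⟨S, hS, hgen⟩ := exists_generic_subspaces (I := I) (hC.subset fun a ha => ha.1) hDne 3 1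
    (by rw [hdim]; omega)
  refine ⟨S, hS, fun v hv hvS => ⟨?_, fun k hk => ?_⟩⟩
  · rw [liftFace_eq_orthantHull hC hne hpos, faceWeight, hsys.weightAt_one hv (hgen v hvS)]
    congr 1
    refine Finset.sum_congr rfl fun k hk => ?_
    rw [Finset.mem_range] at hk
    rw [edgeSection_eq_fiber hC hne hpos H hτ hk.le, edgeSection_eq_fiber hC hne hpos H hτ hk]
    rfl
  · have := hsys.latticeLength_section hv (hgen v hvS) hk
    rwa [edgeSection_eq_fiber hC hne hpos H hτ hk] at this

omit [Fintype ι] [DecidableEq ι] in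
lemma hasTrivialFiber_of_least {b : {i // i ∉ I} → ℝ} {x₀ : ι → ℝ}
    (hx₀ : x₀ ∈ liftFace (orthantHull C Set.univ) I {b})
    (hmin : ∀ x ∈ liftFace (orthantHull C Set.univ) I {b}, ∀ i ∈ I, x₀ i ≤ x i) :
    HasTrivialFiber (orthantHull C Set.univ) I b := by
  refine ⟨x₀, ?_⟩
  ext x
  constructor
  · rintro ⟨hx, hxb⟩
    exact ⟨hxb, hmin x ⟨hx, hxb⟩⟩
  · rintro ⟨hxb, hx⟩
    refine ⟨orthantHull_up hx₀.1 (fun i _ => ?_) fun i hi => absurd (Set.mem_univ i) hi, hxb⟩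
    by_cases hi : i ∈ I
    · exact hx i hi
    · exact (congrFun (hx₀.2.trans hxb.symm) ⟨i, hi⟩).le

/-- If a generic positive linear function has only one minimal point on the fiber over a lattice
point of a bounded edge, then the fiber is trivial. -/
lemma hasTrivialFiber_of_generic (hC : C.Finite) (hne : C.Nonempty)
    (hlat : ∀ a ∈ C, IsLatticePoint a)
    {h : {i // i ∉ I} → ℝ} (hpos : ∀ j, 0 < h j) {z e : {i // i ∉ I} → ℤ} {L : ℕ}
    (H : IsLatticeSegment (minFace (projAlong I '' orthantHull C Set.univ) h) z e L) {k : ℕ}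
    (hk : k ≤ L)
    (huniq : ForGeneric 1 fun v : I → ℝ => (minFace (liftFace (orthantHull C Set.univ) I
      {intToReal _ z + (k : ℝ) • intToReal _ e}) (extendZero I v)).Subsingleton) :
    HasTrivialFiber (orthantHull C Set.univ) I (intToReal _ z + (k : ℝ) • intToReal _ e) := by
  obtain ⟨τ, hτ⟩ := H.primitive
  obtain ⟨S, hS, huniq⟩ := huniq
  have hsys := isEdgeSystem_of_isLatticeSegment hC hlat hpos H hτ
  have := hsys.exists_least_section hk S hS
  rw [edgeSection_eq_fiber hC hne hpos H hτ hk] at this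
  obtain ⟨x₀, hx₀, hmin⟩ := this huniq
  exact hasTrivialFiber_of_least hx₀ hmin

lemma fiberLength_eq_zero {N : Set (ι → ℝ)} {b : {i // i ∉ I} → ℝ} (hb : HasTrivialFiber N I b)
    {v : I → ℝ} (hv : ∀ i, 0 < v i) : fiberLength N I b v = 0 := by
  obtain ⟨c, hc⟩ := hb
  refine latticeLength_of_subsingleton fun x hx y hy => ?_
  have hfib : liftFace N I {b} = {x | projAlong I x = b ∧ ∀ i ∈ I, c i ≤ x i} := hc
  rw [hfib] at hx hy
  -- the only minimal point is the vertex of the shifted orthant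
  have key : ∀ x ∈ minFace {x | projAlong I x = b ∧ ∀ i ∈ I, c i ≤ x i} (extendZero I v),
      ∀ i ∈ I, x i = c i := by
    rintro x ⟨⟨hxb, hxc⟩, hmin⟩ i hi
    set w : ι → ℝ := fun i => if i ∈ I then c i else x i with hw
    have h1 := hmin w ⟨by ext j; simp [projAlong, hw, j.2, ← hxb],
      fun i hi => by simp [hw, hi]⟩
    have hle : ∀ i ∈ (I : Set ι), w i ≤ x i := fun i hi => by
      simpa [hw, Finset.mem_coe.1 hi] using hxc i hi
    have heq : ∀ i ∉ (I : Set ι), w i = x i := fun i hi => by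
      exact if_neg fun h => hi (Finset.mem_coe.2 h)
    have hv0 : ∀ i ∈ (I : Set ι), 0 ≤ extendZero I v i := fun i hi => by
      rw [extendZero_of_mem v (Finset.mem_coe.1 hi)]; exact (hv _).le
    have h2 := le_antisymm (dotProduct_le_of_up hv0 hle heq) h1
    have h3 := eq_of_dotProduct_eq_of_up hv0 hle heq h2 i fun h => by
      rw [extendZero_of_mem v hi] at h
      exact (hv _).ne' h.2
    rw [← h3]
    simp [hw, hi]
  ext i
  by_cases hi : i ∈ I
  · rw [key x hx i hi, key y hy i hi]
  · exact congrFun (hx.1.1.trans hy.1.1.symm) ⟨i, hi⟩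

/-- The codimension `0` weight of a vertex is `-1`. -/
lemma exists_generic_vertex_zero (hC : C.Finite) (hne : C.Nonempty)
    {h a : {i // i ∉ I} → ℝ} (hpos : ∀ j, 0 < h j)
    (ha : {a} = minFace (projAlong I '' orthantHull C Set.univ) h) :
    ForGeneric 0 fun v : I → ℝ =>
        faceWeight I (liftFace (orthantHull C Set.univ) I {a}) 0 v = -1 := by
  obtain ⟨hdim, hDne⟩ := dim_orthantHull_generators hC hne hpos
  have hoh := liftFace_eq_orthantHull hC hne hpos
  rw [← ha] at hdim hDne hoh
  rw [dim_singleton] at hdim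
  have hDfin : {x ∈ C | projAlong I x ∈ ({a} : Set _)}.Finite := hC.subset fun a ha => ha.1
  obtain ⟨S, hS, hgen⟩ := exists_generic_subspaces (I := I) hDfin hDne 1 0
    (by rw [hdim]; omega)
  refine ⟨S, hS, fun v hv hvS => ?_⟩
  beta_reduce
  have hpos' : ∀ i ∈ (I : Set ι), 0 < extendZero I v i := fun i hi => by
    rw [extendZero_of_mem v (Finset.mem_coe.1 hi)]; exact hv _
  rw [hoh]
  refine faceWeight_zero_of_parallel (b := extendCompl I a) hDfin hDne ?_ hv ?_
  · rintro x ⟨-, hx⟩ j hj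
    rw [extendCompl_of_notMem _ hj]
    exact congrFun hx ⟨j, hj⟩
  · exact hgen v hvS _ (fun i => extendZero_of_mem v i.2)
      (minFace_orthantHull_nonempty hDfin hDne fun i hi => (hpos' i hi).le)
      (isBounded_minFace_of_pos hDfin hpos')

/-- The codimension `1` weight of a vertex is the lattice length of a face of the fiber. -/
lemma faceWeight_one_vertex (hC : C.Finite) (hne : C.Nonempty)
    {h a : {i // i ∉ I} → ℝ} (hpos : ∀ j, 0 < h j)
    (ha : {a} = minFace (projAlong I '' orthantHull C Set.univ) h) {v : I → ℝ}
    (hv : ∀ i, 0 < v i) :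
    faceWeight I (liftFace (orthantHull C Set.univ) I {a}) 1 v =
      fiberLength (orthantHull C Set.univ) I a v := by
  obtain ⟨-, hDne⟩ := dim_orthantHull_generators hC hne hpos
  have hoh := liftFace_eq_orthantHull hC hne hpos
  rw [← ha] at hDne hoh
  rw [fiberLength, hoh]
  refine faceWeight_one_of_parallel (b := extendCompl I a) (hC.subset fun a ha => ha.1) hDne ?_ hv
  rintro x ⟨-, hx⟩ j hj
  rw [extendCompl_of_notMem _ hj]
  exact congrFun hx ⟨j, hj⟩

end FibersOverFaces

/-! ### The class of a configuration of contributing faces -/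

section Classes

variable {ι : Type*} [Fintype ι] [DecidableEq ι] {C : Set (ι → ℝ)} {I : Finset ι} {m : ℕ}

lemma Contributes.exists_pos_proj (hC : C.Finite) {B : Set ({i // i ∉ I} → ℝ)}
    (hB : Contributes (projAlong I '' orthantHull C Set.univ) m B) :
    ∃ h : {i // i ∉ I} → ℝ, (∀ j, 0 < h j) ∧
      B = minFace (projAlong I '' orthantHull C Set.univ) h := by
  rw [projAlong_image_newton] at hB ⊢
  exact hB.exists_pos (hC.image _)

/-- The class `Φ_{m,I}` vanishes in codimension `d` if and only if the weights of the contributing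
faces add up to zero at generic positive linear functions. -/
lemma isZeroFan_tropicalClass_iff (hC : C.Finite) (hne : C.Nonempty) (d : ℕ)
    (hfin : {B | Contributes (projAlong I '' orthantHull C Set.univ) m B}.Finite) :
    IsZeroFan d (tropicalClass (orthantHull C Set.univ) I m d) ↔
      ForGeneric d fun v : I → ℝ => ∑ B ∈ hfin.toFinset,
        faceWeight I (liftFace (orthantHull C Set.univ) I B) (d + dim B) v = 0 := by
  constructor
  · rintro ⟨S, hS, hz⟩
    refine ⟨S, hS, fun v hv hvS => ?_⟩
    beta_reduce
    rw [← weightAt_tropicalClass hC hne]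
    by_contra h
    obtain ⟨W, hW, hvW⟩ := hz v h
    exact hvS W hW hvW
  · rintro ⟨S, hS, hz⟩
    refine ⟨S, hS, fun v hvne => ?_⟩
    by_contra! hvS
    refine hvne ?_
    rw [weightAt_tropicalClass hC hne I m d hfin]
    by_cases hv : ∀ i, 0 < v i
    · exact hz v hv hvS
    · refine Finset.sum_eq_zero fun B hB => ?_
      have hB' : Contributes _ m B := hfin.mem_toFinset.1 hB
      obtain ⟨h, hpos, rfl⟩ := hB'.exists_pos_proj hC
      rw [liftFace_eq_orthantHull hC hne hpos]
      exact weightAt_eq_zero_of_not_pos (hC.subset fun a ha => ha.1)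
        (dim_orthantHull_generators hC hne hpos).2 _ hv

variable (hC : C.Finite) (hne : C.Nonempty) (hlat : ∀ a ∈ C, ∃ z : ι → ℕ, a = fun i => (z i : ℝ))
  (hκ : Fintype.card {i // i ∉ I} = 2)

include hlat

omit [Fintype ι] [DecidableEq ι] in
lemma isLatticePoint_of_nat : ∀ a ∈ C, IsLatticePoint a := fun a ha => by
  obtain ⟨z, rfl⟩ := hlat a ha
  exact ⟨fun i => z i, fun i => by simp⟩

omit [Fintype ι] [DecidableEq ι] in
lemma exists_nat_proj : ∀ a ∈ projAlong I '' C, ∃ z : {i // i ∉ I} → ℕ, a = fun i => (z i : ℝ) := by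
  rintro _ ⟨a, ha, rfl⟩
  obtain ⟨z, rfl⟩ := hlat a ha
  exact ⟨fun j => z j, rfl⟩

include hC

lemma exists_isLatticeSegment_proj {B : Set ({i // i ∉ I} → ℝ)}
    (hB : IsBoundedEdge (projAlong I '' orthantHull C Set.univ) B) :
    ∃ z e L, IsLatticeSegment B z e L := by
  rw [projAlong_image_newton] at hB
  exact hB.exists_isLatticeSegment (hC.image _) (isLatticePoint_of_nat (exists_nat_proj hlat))

include hκ

omit hlat in
lemma Contributes.isBoundedEdge_proj {B : Set ({i // i ∉ I} → ℝ)}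
    (hB : Contributes (projAlong I '' orthantHull C Set.univ) m B) (hdim : dim B ≠ 0) :
    IsBoundedEdge (projAlong I '' orthantHull C Set.univ) B := by
  rw [projAlong_image_newton] at hB ⊢
  have := hB.dim_le_one hκ
  exact hB.isBoundedEdge (hC.image _) (by omega)

/-- A contributing face which is a segment is parametrized from a given end point. -/
lemma Contributes.exists_isLatticeSegment {B : Set ({i // i ∉ I} → ℝ)}
    (hB : Contributes (projAlong I '' orthantHull C Set.univ) m B) {a b : {i // i ∉ I} → ℝ}
    (hab : a ≠ b) (hseg : B = segment ℝ a b) :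
    ∃ z e L, IsLatticeSegment B z e L ∧ a = intToReal _ z ∧
      b = intToReal _ z + (L : ℝ) • intToReal _ e := by
  have hdim : dim B ≠ 0 := by
    intro h0
    obtain ⟨x, hx⟩ := exists_eq_singleton_of_dim_eq_zero (hseg ▸ ⟨a, left_mem_segment ℝ a b⟩) h0
    have h1 : a ∈ ({x} : Set _) := by rw [← hx, hseg]; exact left_mem_segment ℝ a b
    have h2 : b ∈ ({x} : Set _) := by rw [← hx, hseg]; exact right_mem_segment ℝ a b
    exact hab (h1.trans h2.symm)
  obtain ⟨z, e, L, H⟩ := exists_isLatticeSegment_proj hC hlat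
    (hB.isBoundedEdge_proj hC hκ hdim)
  obtain ⟨z', e', H', ha, hb⟩ := H.of_segment_eq hseg
  exact ⟨z', e', L, H', ha, hb⟩

include hne

lemma Contributes.forGeneric_zero {B : Set ({i // i ∉ I} → ℝ)}
    (hB : Contributes (projAlong I '' orthantHull C Set.univ) m B) :
    ForGeneric 0 fun v : I → ℝ =>
      faceWeight I (liftFace (orthantHull C Set.univ) I B) (0 + dim B) v =
        if dim B = 0 then -1 else latticeVolume B := by
  obtain ⟨h, hpos, hh⟩ := hB.exists_pos_proj hC
  split_ifs with h0
  · obtain ⟨a, rfl⟩ := exists_eq_singleton_of_dim_eq_zero (by obtain ⟨J, hV, -⟩ := hB; exact hV.face.1) h0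
    rw [h0]
    exact exists_generic_vertex_zero hC hne hpos hh
  · have hE := hB.isBoundedEdge_proj hC hκ h0
    obtain ⟨z, e, L, H⟩ := exists_isLatticeSegment_proj hC hlat hE
    rw [H.dim_latticeVolume.2, hE.2.2]
    subst hh
    exact exists_generic_edge_zero hC hne (isLatticePoint_of_nat hlat) hpos H

/-- The codimension `0` component of the class `Φ_{m,I}` vanishes if and only if the total lattice
length of the contributing edges is the number of the contributing vertices. -/
lemma isZeroFan_zero_iff
    (hfin : {B | Contributes (projAlong I '' orthantHull C Set.univ) m B}.Finite) :
    IsZeroFan 0 (tropicalClass (orthantHull C Set.univ) I m 0) ↔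
      ∑ B ∈ hfin.toFinset, (if dim B = 0 then -1 else latticeVolume B) = 0 := by
  rw [isZeroFan_tropicalClass_iff hC hne 0 hfin]
  have hgen := ForGeneric.forall_mem (d := 0) (p := fun B (v : I → ℝ) =>
      faceWeight I (liftFace (orthantHull C Set.univ) I B) (0 + dim B) v =
        if dim B = 0 then -1 else latticeVolume B) hfin.toFinset fun B hB =>
    Contributes.forGeneric_zero hC hne hlat hκ (hfin.mem_toFinset.1 hB)
  constructor
  · intro h
    obtain ⟨v, h1, h2⟩ := (h.and hgen).exists
    rw [← Finset.sum_congr rfl h2]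
    exact h1
  · intro h
    refine hgen.mono fun v _ hv => ?_
    rw [← h]
    exact Finset.sum_congr rfl hv

omit hκ in
/-- The fiber over a lattice point of a bounded edge is trivial if and only if the faces of the
fiber at generic positive linear functions are points. -/
lemma hasTrivialFiber_iff {E : Set ({i // i ∉ I} → ℝ)}
    (hE : Contributes (projAlong I '' orthantHull C Set.univ) m E) {z e : {i // i ∉ I} → ℤ} {L : ℕ}
    (H : IsLatticeSegment E z e L) {k : ℕ} (hk : k ≤ L) :
    HasTrivialFiber (orthantHull C Set.univ) I (intToReal _ z + (k : ℝ) • intToReal _ e) ↔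
      ForGeneric 1 fun v : I → ℝ => fiberLength (orthantHull C Set.univ) I
        (intToReal _ z + (k : ℝ) • intToReal _ e) v = 0 := by
  constructor
  · exact fun h => ⟨∅, by simp, fun v hv _ => fiberLength_eq_zero h hv⟩
  · intro h
    obtain ⟨g, hpos, rfl⟩ := hE.exists_pos_proj hC
    have hlat' := isLatticePoint_of_nat hlat
    refine hasTrivialFiber_of_generic hC hne hlat' hpos H hk ?_
    exact (h.and (exists_generic_edge_one hC hne hlat' hpos H)).mono
      fun v _ hv => (hv.2.2 k hk).2 hv.1

omit hκ in
/-- The codimension `1` weight of a contributing edge. -/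
lemma forGeneric_edge {E : Set ({i // i ∉ I} → ℝ)}
    (hE : Contributes (projAlong I '' orthantHull C Set.univ) m E) {z e : {i // i ∉ I} → ℤ} {L : ℕ}
    (H : IsLatticeSegment E z e L) :
    ForGeneric 1 fun v : I → ℝ =>
      faceWeight I (liftFace (orthantHull C Set.univ) I E) (1 + dim E) v =
        -∑ k ∈ Finset.range L,
            (fiberLength (orthantHull C Set.univ) I (intToReal _ z + (k : ℝ) • intToReal _ e) v +
            fiberLength (orthantHull C Set.univ) I
              (intToReal _ z + ((k + 1 : ℕ) : ℝ) • intToReal _ e) v) ∧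
      ∀ k ≤ L, 0 ≤ fiberLength (orthantHull C Set.univ) I
        (intToReal _ z + (k : ℝ) • intToReal _ e) v := by
  obtain ⟨g, hpos, hg⟩ := hE.exists_pos_proj hC
  rw [H.dim_latticeVolume.1]
  subst hg
  exact (exists_generic_edge_one hC hne (isLatticePoint_of_nat hlat) hpos H).mono
    fun v _ hv => ⟨hv.1, fun k hk => (hv.2 k hk).1⟩

omit hlat hκ in
lemma faceWeight_vertex {a : {i // i ∉ I} → ℝ}
    (ha : Contributes (projAlong I '' orthantHull C Set.univ) m {a}) {v : I → ℝ}
    (hv : ∀ i, 0 < v i) :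
    faceWeight I (liftFace (orthantHull C Set.univ) I {a}) (1 + dim {a}) v =
      fiberLength (orthantHull C Set.univ) I a v := by
  obtain ⟨g, hpos, hg⟩ := ha.exists_pos_proj hC
  rw [dim_singleton]
  exact faceWeight_one_vertex hC hne hpos hg hv

/-- One contributing vertex and one contributing edge. -/
lemma isZeroFan_of_vertex_edge {E : Set ({i // i ∉ I} → ℝ)} {z e : {i // i ∉ I} → ℤ}
    (H : IsLatticeSegment E z e 1)
    (hF : ∀ F, Contributes (projAlong I '' orthantHull C Set.univ) m F ↔
      F = {intToReal _ z} ∨ F = E) :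
    IsZeroFan 0 (tropicalClass (orthantHull C Set.univ) I m 0) ∧
    (IsZeroFan 1 (tropicalClass (orthantHull C Set.univ) I m 1) ↔
      HasTrivialFiber (orthantHull C Set.univ) I
        (intToReal _ z + ((1 : ℕ) : ℝ) • intToReal _ e)) := by
  classical
  have hfin : {B | Contributes (projAlong I '' orthantHull C Set.univ) m B}.Finite := by
    rw [projAlong_image_newton]; exact finite_contributes (hC.image _) m
  have hEz : ({intToReal _ z} : Set ({i // i ∉ I} → ℝ)) ≠ E := by
    intro h
    have := H.dim_latticeVolume.1
    rw [← h, dim_singleton] at this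
    exact zero_ne_one this
  have hset : hfin.toFinset = {{intToReal _ z}, E} := by
    ext F; simp [hF]
  have hz := (hF _).2 (Or.inl rfl)
  have hE := (hF E).2 (Or.inr rfl)
  refine ⟨?_, ?_⟩
  · rw [isZeroFan_zero_iff hC hne hlat hκ hfin, hset, Finset.sum_pair hEz, if_pos (dim_singleton _),
      H.dim_latticeVolume.1, H.dim_latticeVolume.2]
    norm_num
  · rw [isZeroFan_tropicalClass_iff hC hne 1 hfin, hset, hasTrivialFiber_iff hC hne hlat hE H
      le_rfl]
    have key : ForGeneric 1 fun v : I → ℝ => ∑ B ∈ {{intToReal _ z}, E},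
        faceWeight I (liftFace (orthantHull C Set.univ) I B) (1 + dim B) v =
        -fiberLength (orthantHull C Set.univ) I
          (intToReal _ z + ((1 : ℕ) : ℝ) • intToReal _ e) v := by
      refine (forGeneric_edge hC hne hlat hE H).mono fun v hv h => ?_
      rw [Finset.sum_pair hEz, faceWeight_vertex hC hne hz hv, h.1]
      simp
    exact ⟨fun h => (h.and key).mono fun v _ hv => by linarith [hv.1, hv.2],
      fun h => (h.and key).mono fun v _ hv => by linarith [hv.1, hv.2]⟩

/-- Two contributing vertices connected by a contributing edge. -/
lemma isZeroFan_of_long_edge {E : Set ({i // i ∉ I} → ℝ)} {z e : {i // i ∉ I} → ℤ}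
    (H : IsLatticeSegment E z e 2)
    (hF : ∀ F, Contributes (projAlong I '' orthantHull C Set.univ) m F ↔
      F = {intToReal _ z} ∨ F = {intToReal _ z + ((2 : ℕ) : ℝ) • intToReal _ e} ∨ F = E) :
    IsZeroFan 0 (tropicalClass (orthantHull C Set.univ) I m 0) ∧
    (IsZeroFan 1 (tropicalClass (orthantHull C Set.univ) I m 1) ↔
      HasTrivialFiber (orthantHull C Set.univ) I
        (intToReal _ z + ((1 : ℕ) : ℝ) • intToReal _ e)) := by
  classical
  have hfin : {B | Contributes (projAlong I '' orthantHull C Set.univ) m B}.Finite := by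
    rw [projAlong_image_newton]; exact finite_contributes (hC.image _) m
  have hne1 : ∀ a : {i // i ∉ I} → ℝ, ({a} : Set ({i // i ∉ I} → ℝ)) ≠ E := by
    intro a h
    have := H.dim_latticeVolume.1
    rw [← h, dim_singleton] at this
    exact zero_ne_one this
  have hne2 : ({intToReal _ z} : Set ({i // i ∉ I} → ℝ)) ≠
      {intToReal _ z + ((2 : ℕ) : ℝ) • intToReal _ e} := by
    intro h
    have := H.injective (θ := 0) (θ' := ((2 : ℕ) : ℝ)) (by
      rw [zero_smul, add_zero]; exact Set.singleton_injective h)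
    norm_num at this
  have hset : hfin.toFinset =
      {{intToReal _ z}, {intToReal _ z + ((2 : ℕ) : ℝ) • intToReal _ e}, E} := by
    ext F
    simp only [Set.Finite.mem_toFinset, Set.mem_ofPred_eq, hF, Finset.mem_insert,
      Finset.mem_singleton]
  have hsum : ∀ f : Set ({i // i ∉ I} → ℝ) → ℝ, ∑ B ∈ hfin.toFinset, f B =
      f {intToReal _ z} + (f {intToReal _ z + ((2 : ℕ) : ℝ) • intToReal _ e} + f E) := by
    intro f
    rw [hset, Finset.sum_insert (by simp [hne1, -Nat.cast_ofNat, hne2]), Finset.sum_pair (hne1 _)]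
  have hz := (hF _).2 (Or.inl rfl)
  have hw := (hF _).2 (Or.inr (Or.inl rfl))
  have hE := (hF E).2 (Or.inr (Or.inr rfl))
  refine ⟨?_, ?_⟩
  · rw [isZeroFan_zero_iff hC hne hlat hκ hfin, hsum, if_pos (dim_singleton _),
      if_pos (dim_singleton _), H.dim_latticeVolume.1, H.dim_latticeVolume.2]
    norm_num
  · rw [isZeroFan_tropicalClass_iff hC hne 1 hfin, hasTrivialFiber_iff hC hne hlat hE H
      one_le_two]
    have key : ForGeneric 1 fun v : I → ℝ => ∑ B ∈ hfin.toFinset,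
        faceWeight I (liftFace (orthantHull C Set.univ) I B) (1 + dim B) v =
        -2 * fiberLength (orthantHull C Set.univ) I
          (intToReal _ z + ((1 : ℕ) : ℝ) • intToReal _ e) v := by
      refine (forGeneric_edge hC hne hlat hE H).mono fun v hv h => ?_
      rw [hsum, faceWeight_vertex hC hne hz hv, faceWeight_vertex hC hne hw hv, h.1,
        Finset.sum_range_succ, Finset.sum_range_one, Nat.cast_zero, zero_smul, add_zero]
      ring
    exact ⟨fun h => (h.and key).mono fun v _ hv => by linarith [hv.1, hv.2],
      fun h => (h.and key).mono fun v _ hv => by rw [hv.2, hv.1, mul_zero]⟩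

/-- Two contributing vertices on different contributing edges. -/
lemma isZeroFan_of_two_edges {E₁ E₂ : Set ({i // i ∉ I} → ℝ)} {z₁ e₁ z₂ e₂ : {i // i ∉ I} → ℤ}
    (H₁ : IsLatticeSegment E₁ z₁ e₁ 1) (H₂ : IsLatticeSegment E₂ z₂ e₂ 1) (hEE : E₁ ≠ E₂)
    (hzz : intToReal _ z₁ ≠ intToReal _ z₂)
    (hF : ∀ F, Contributes (projAlong I '' orthantHull C Set.univ) m F ↔
      F = {intToReal _ z₁} ∨ F = {intToReal _ z₂} ∨ F = E₁ ∨ F = E₂) :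
    IsZeroFan 0 (tropicalClass (orthantHull C Set.univ) I m 0) ∧
    (IsZeroFan 1 (tropicalClass (orthantHull C Set.univ) I m 1) ↔
      HasTrivialFiber (orthantHull C Set.univ) I
        (intToReal _ z₁ + ((1 : ℕ) : ℝ) • intToReal _ e₁) ∧
      HasTrivialFiber (orthantHull C Set.univ) I
        (intToReal _ z₂ + ((1 : ℕ) : ℝ) • intToReal _ e₂)) := by
  classical
  have hfin : {B | Contributes (projAlong I '' orthantHull C Set.univ) m B}.Finite := by
    rw [projAlong_image_newton]; exact finite_contributes (hC.image _) m
  have hne1 : ∀ a : {i // i ∉ I} → ℝ, ({a} : Set ({i // i ∉ I} → ℝ)) ≠ E₁ := by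
    intro a h
    have := H₁.dim_latticeVolume.1
    rw [← h, dim_singleton] at this
    exact zero_ne_one this
  have hne2 : ∀ a : {i // i ∉ I} → ℝ, ({a} : Set ({i // i ∉ I} → ℝ)) ≠ E₂ := by
    intro a h
    have := H₂.dim_latticeVolume.1
    rw [← h, dim_singleton] at this
    exact zero_ne_one this
  have hset : hfin.toFinset = {{intToReal _ z₁}, {intToReal _ z₂}, E₁, E₂} := by
    ext F
    simp only [Set.Finite.mem_toFinset, Set.mem_ofPred_eq, hF, Finset.mem_insert,
      Finset.mem_singleton]
  have hsum : ∀ f : Set ({i // i ∉ I} → ℝ) → ℝ, ∑ B ∈ hfin.toFinset, f B =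
      f {intToReal _ z₁} + (f {intToReal _ z₂} + (f E₁ + f E₂)) := by
    intro f
    rw [hset, Finset.sum_insert (by simp [hne1, hne2, hzz]),
      Finset.sum_insert (by simp [hne1, hne2]), Finset.sum_pair hEE]
  have hz₁ := (hF _).2 (Or.inl rfl)
  have hz₂ := (hF _).2 (Or.inr (Or.inl rfl))
  have hE₁ := (hF E₁).2 (Or.inr (Or.inr (Or.inl rfl)))
  have hE₂ := (hF E₂).2 (Or.inr (Or.inr (Or.inr rfl)))
  refine ⟨?_, ?_⟩
  · rw [isZeroFan_zero_iff hC hne hlat hκ hfin, hsum, if_pos (dim_singleton _),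
      if_pos (dim_singleton _), H₁.dim_latticeVolume.1, H₁.dim_latticeVolume.2,
      H₂.dim_latticeVolume.1, H₂.dim_latticeVolume.2]
    norm_num
  · rw [isZeroFan_tropicalClass_iff hC hne 1 hfin, hasTrivialFiber_iff hC hne hlat hE₁ H₁ le_rfl,
      hasTrivialFiber_iff hC hne hlat hE₂ H₂ le_rfl]
    have key : ForGeneric 1 fun v : I → ℝ =>
        0 ≤ fiberLength (orthantHull C Set.univ) I
          (intToReal _ z₁ + ((1 : ℕ) : ℝ) • intToReal _ e₁) v ∧
        0 ≤ fiberLength (orthantHull C Set.univ) I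
          (intToReal _ z₂ + ((1 : ℕ) : ℝ) • intToReal _ e₂) v ∧
        ∑ B ∈ hfin.toFinset,
          faceWeight I (liftFace (orthantHull C Set.univ) I B) (1 + dim B) v =
        -fiberLength (orthantHull C Set.univ) I
          (intToReal _ z₁ + ((1 : ℕ) : ℝ) • intToReal _ e₁) v -
        fiberLength (orthantHull C Set.univ) I
          (intToReal _ z₂ + ((1 : ℕ) : ℝ) • intToReal _ e₂) v := by
      refine ((forGeneric_edge hC hne hlat hE₁ H₁).and
        (forGeneric_edge hC hne hlat hE₂ H₂)).mono fun v hv h => ⟨h.1.2 1 le_rfl,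
          h.2.2 1 le_rfl, ?_⟩
      rw [hsum, faceWeight_vertex hC hne hz₁ hv, faceWeight_vertex hC hne hz₂ hv, h.1.1, h.2.1,
        Finset.sum_range_one, Finset.sum_range_one, Nat.cast_zero, zero_smul, zero_smul, add_zero,
        add_zero]
      ring
    constructor
    · intro h
      have h' := h.and key
      exact ⟨h'.mono fun v _ hv => by linarith [hv.1, hv.2.1, hv.2.2.1, hv.2.2.2],
        h'.mono fun v _ hv => by linarith [hv.1, hv.2.1, hv.2.2.1, hv.2.2.2]⟩
    · rintro ⟨h1, h2⟩
      exact ((h1.and h2).and key).mono fun v _ hv => by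
        rw [hv.2.2.2, hv.1.1, hv.1.2]; ring

end Classes

/-! ### Eigenvalues and their denominators -/

section Eigenvalues

lemma newtonPolyhedron_eq {ι : Type*} [Fintype ι] (A : Finset (ι → ℕ)) :
    newtonPolyhedron A =
      orthantHull ((fun (a : ι → ℕ) (i : ι) => (a i : ℝ)) '' (A : Set (ι → ℕ))) Set.univ := by
  ext x
  simp [newtonPolyhedron, orthantHull]

/-- The denominator `m` is determined by the number `exp(2πik/m)`. -/
lemma isTropicalNearbyEigenvalue_iff {ι : Type*} [Fintype ι] [DecidableEq ι] {N : Set (ι → ℝ)}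
    {I : Finset ι} {d : ℕ} {k : ℤ} {m : ℕ} (hm : 0 < m) (hkm : IsCoprime k (m : ℤ))
    (hmN : ¬ IsTautologicalDenominator N m) :
    IsTropicalNearbyEigenvalue N I d
      (Complex.exp (2 * (Real.pi : ℂ) * Complex.I * (k : ℂ) / (m : ℂ))) ↔
    d ≤ I.card ∧ ¬ IsZeroFan d (tropicalClass N I m d) := by
  constructor
  · rintro ⟨k', m', hm', hkm', hs, -, hd, hz⟩
    have h1 := Complex.isPrimitiveRoot_exp_of_isCoprime k m hm.ne' hkm
    have h2 := Complex.isPrimitiveRoot_exp_of_isCoprime k' m' hm'.ne' hkm'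
    rw [← mul_div_assoc] at h1 h2
    rw [hs] at h1
    obtain rfl : m = m' := h1.unique h2
    exact ⟨hd, hz⟩
  · rintro ⟨hd, hz⟩
    exact ⟨k, m, hm, hkm, rfl, hmN, hd, hz⟩

lemma hasTrivialFiber_of_card_eq_zero {ι : Type*} {N : Set (ι → ℝ)} {I : Finset ι}
    (hI : I.card = 0) {b : {i // i ∉ I} → ℝ} (hb : b ∈ projAlong I '' N) :
    HasTrivialFiber N I b := by
  obtain ⟨c, hc, rfl⟩ := hb
  rw [Finset.card_eq_zero] at hI
  subst hI
  refine ⟨c, ?_⟩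
  ext x
  constructor
  · rintro ⟨-, h⟩
    exact ⟨h, fun i hi => absurd hi (Finset.notMem_empty i)⟩
  · rintro ⟨h, -⟩
    have : x = c := funext fun i => congrFun h ⟨i, Finset.notMem_empty i⟩
    exact ⟨this ▸ hc, h⟩

end Eigenvalues

end TropicalMonodromy

open TropicalMonodromy

theorem mainTheorem7 {n : ℕ} (A : Finset (Fin n → ℕ)) (hA : A.Nonempty)
    (N : Set (Fin n → ℝ)) (hN : N = TropicalMonodromy.newtonPolyhedron A)
    (I : Finset (Fin n)) (hI : Iᶜ.card = 2)
    (P : Set ({i // i ∉ I} → ℝ)) (hP : P = TropicalMonodromy.projAlong I '' N)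
    (k : ℤ) (m : ℕ) (hm : 0 < m) (hkm : IsCoprime k (m : ℤ))
    (s : ℂ) (hs : s = Complex.exp (2 * (Real.pi : ℂ) * Complex.I * (k : ℂ) / (m : ℂ)))
    (hmN : ¬ TropicalMonodromy.IsTautologicalDenominator N m) :
    (TropicalMonodromy.IsTropicalNearbyEigenvalue N I 0 s ∨
      TropicalMonodromy.IsTropicalNearbyEigenvalue N I 1 s) ↔
    ¬ (
      -- (1) no face contributes
      (∀ B, ¬ TropicalMonodromy.Contributes P m B) ∨
      -- (2) a unique bounded edge, with one interior lattice point
      (∃ (B : Set ({i // i ∉ I} → ℝ)) (a b p : {i // i ∉ I} → ℝ),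
        TropicalMonodromy.IsBoundedEdge P B ∧
        (∀ B', TropicalMonodromy.IsBoundedEdge P B' → B' = B) ∧
        a ≠ b ∧ B = segment ℝ a b ∧
        {x | x ∈ openSegment ℝ a b ∧ TropicalMonodromy.IsLatticePoint x} = {p} ∧
        TropicalMonodromy.Contributes P m {a} ∧ TropicalMonodromy.Contributes P m {b} ∧
        TropicalMonodromy.Contributes P m B ∧
        TropicalMonodromy.HasTrivialFiber N I p) ∨
      -- (3) exactly one vertex and its adjacent edge of lattice length 1 contribute
      (∃ (B : Set ({i // i ∉ I} → ℝ)) (a b : {i // i ∉ I} → ℝ),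
        a ≠ b ∧ B = segment ℝ a b ∧ TropicalMonodromy.latticeVolume B = 1 ∧
        (∀ F, TropicalMonodromy.Contributes P m F ↔ (F = {a} ∨ F = B)) ∧
        TropicalMonodromy.HasTrivialFiber N I b) ∨
      -- (4) exactly two vertices and their two distinct adjacent edges contribute
      (∃ (B₁ B₂ : Set ({i // i ∉ I} → ℝ)) (a₁ b₁ a₂ b₂ : {i // i ∉ I} → ℝ),
        B₁ ≠ B₂ ∧ a₁ ≠ a₂ ∧
        a₁ ≠ b₁ ∧ B₁ = segment ℝ a₁ b₁ ∧ TropicalMonodromy.latticeVolume B₁ = 1 ∧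
        a₂ ≠ b₂ ∧ B₂ = segment ℝ a₂ b₂ ∧ TropicalMonodromy.latticeVolume B₂ = 1 ∧
        (∀ F, TropicalMonodromy.Contributes P m F ↔ (F = {a₁} ∨ F = {a₂} ∨ F = B₁ ∨ F = B₂)) ∧
        TropicalMonodromy.HasTrivialFiber N I b₁ ∧
        TropicalMonodromy.HasTrivialFiber N I b₂)) := by

  classical
  subst hs hP
  set C : Set (Fin n → ℝ) := (fun (a : Fin n → ℕ) (i : Fin n) => (a i : ℝ)) '' (A : Set _) with hCdef
  have hNC : N = orthantHull C Set.univ := hN.trans (newtonPolyhedron_eq A)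
  clear hN
  subst hNC
  have hC : C.Finite := A.finite_toSet.image _
  have hne : C.Nonempty := (Finset.coe_nonempty.2 hA).image _
  have hlat : ∀ a ∈ C, ∃ z : Fin n → ℕ, a = fun i => (z i : ℝ) := by
    rintro _ ⟨z, -, rfl⟩
    exact ⟨z, rfl⟩
  have hκ : Fintype.card {i // i ∉ I} = 2 := by
    rw [← hI, Fintype.card_subtype, ← Finset.compl_filter]
    simp
  have hfin : {B | Contributes (projAlong I '' orthantHull C Set.univ) m B}.Finite := by
    rw [projAlong_image_newton]; exact finite_contributes (hC.image _) m
  have hsub : ∀ {E : Set ({i // i ∉ I} → ℝ)},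
      Contributes (projAlong I '' orthantHull C Set.univ) m E →
      E ⊆ projAlong I '' orthantHull C Set.univ := by
    intro E hE x hx
    obtain ⟨h, -, rfl⟩ := hE.exists_pos_proj hC
    exact hx.1
  rw [isTropicalNearbyEigenvalue_iff hm hkm hmN, isTropicalNearbyEigenvalue_iff hm hkm hmN,
    ← not_iff_not, not_not]
  constructor
  · intro hcon
    push Not at hcon
    obtain ⟨hz0, hz1⟩ := hcon
    replace hz0 := hz0 (Nat.zero_le _)
    -- for `I = ∅` there is no codimension `1`, and all the non-empty fibers are points
    have htriv : ∀ {E : Set ({i // i ∉ I} → ℝ)} {z e : {i // i ∉ I} → ℤ} {L : ℕ},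
        Contributes (projAlong I '' orthantHull C Set.univ) m E → IsLatticeSegment E z e L →
        1 ≤ L → (IsZeroFan 1 (tropicalClass (orthantHull C Set.univ) I m 1) →
          HasTrivialFiber (orthantHull C Set.univ) I
            (intToReal _ z + ((1 : ℕ) : ℝ) • intToReal _ e)) →
        HasTrivialFiber (orthantHull C Set.univ) I
          (intToReal _ z + ((1 : ℕ) : ℝ) • intToReal _ e) := by
      intro E z e L hE H hL h
      rcases Nat.eq_zero_or_pos I.card with h0 | h0
      · exact hasTrivialFiber_of_card_eq_zero h0 (hsub hE (H.point_mem hL))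
      · exact h (hz1 h0)
    rw [isZeroFan_zero_iff hC hne hlat hκ hfin] at hz0
    have hclass := classification_of_sum_eq_zero (m := m) hκ (hC.image (projAlong I))
      (exists_nat_proj hlat)
    rw [← projAlong_image_newton] at hclass
    rcases hclass hfin hz0 with h | ⟨E, z, e, H, hE, huniq, hF⟩ | ⟨E, z, e, H, hF⟩ |
      ⟨E₁, z₁, e₁, E₂, z₂, e₂, H₁, H₂, hEE, hzz, hF⟩
    · exact Or.inl h
    · right; left
      have hcE := (hF E).2 (Or.inr (Or.inr rfl))
      refine ⟨E, _, _, _, hE, huniq, fun h => ?_, H.eq, H.interior_of_length_two,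
        (hF _).2 (Or.inl rfl), (hF _).2 (Or.inr (Or.inl rfl)), hcE, ?_⟩
      · have := H.injective (θ := 0) (θ' := ((2 : ℕ) : ℝ)) (by rw [zero_smul, add_zero]; exact h)
        norm_num at this
      · have := htriv hcE H one_le_two
          (isZeroFan_of_long_edge hC hne hlat hκ H hF).2.1
        rwa [Nat.cast_one] at this
    · right; right; left
      refine ⟨E, _, _, fun h => ?_, H.eq, by simpa using H.dim_latticeVolume.2, hF,
        htriv ((hF E).2 (Or.inr rfl)) H le_rfl
          (isZeroFan_of_vertex_edge hC hne hlat hκ H hF).2.1⟩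
      have := H.injective (θ := 0) (θ' := ((1 : ℕ) : ℝ)) (by rw [zero_smul, add_zero]; exact h)
      norm_num at this
    · right; right; right
      have hz := (isZeroFan_of_two_edges hC hne hlat hκ H₁ H₂ hEE hzz hF).2.1
      refine ⟨E₁, E₂, _, _, _, _, hEE, hzz, fun h => ?_, H₁.eq,
        by simpa using H₁.dim_latticeVolume.2, fun h => ?_, H₂.eq,
        by simpa using H₂.dim_latticeVolume.2, hF,
        htriv ((hF E₁).2 (Or.inr (Or.inr (Or.inl rfl)))) H₁ le_rfl fun h => (hz h).1,
        htriv ((hF E₂).2 (Or.inr (Or.inr (Or.inr rfl)))) H₂ le_rfl fun h => (hz h).2⟩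
      · have := H₁.injective (θ := 0) (θ' := ((1 : ℕ) : ℝ)) (by rw [zero_smul, add_zero]; exact h)
        norm_num at this
      · have := H₂.injective (θ := 0) (θ' := ((1 : ℕ) : ℝ)) (by rw [zero_smul, add_zero]; exact h)
        norm_num at this
  · intro hcases
    have hsuff : IsZeroFan 0 (tropicalClass (orthantHull C Set.univ) I m 0) ∧
        IsZeroFan 1 (tropicalClass (orthantHull C Set.univ) I m 1) → ¬
        (0 ≤ I.card ∧ ¬ IsZeroFan 0 (tropicalClass (orthantHull C Set.univ) I m 0) ∨
        1 ≤ I.card ∧ ¬ IsZeroFan 1 (tropicalClass (orthantHull C Set.univ) I m 1)) := by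
      tauto
    apply hsuff
    have hlen : ∀ {E : Set ({i // i ∉ I} → ℝ)} {z e : {i // i ∉ I} → ℤ} {L : ℕ},
        IsLatticeSegment E z e L → latticeVolume E = 1 → L = 1 := by
      intro E z e L H h
      rw [H.dim_latticeVolume.2] at h
      exact_mod_cast h
    rcases hcases with h | ⟨B, a, b, p, hB, huniq, hab, hseg, hp, ha, hb, hBc, hpt⟩ |
      ⟨B, a, b, hab, hseg, hvol, hF, hbt⟩ |
      ⟨B₁, B₂, a₁, b₁, a₂, b₂, hBB, haa, hab₁, hseg₁, hvol₁, hab₂, hseg₂, hvol₂, hF, ht₁, ht₂⟩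
    · have hempty : hfin.toFinset = ∅ := by
        ext F; simp [h]
      refine ⟨?_, ?_⟩ <;> rw [isZeroFan_tropicalClass_iff hC hne _ hfin, hempty] <;>
        exact ⟨∅, by simp, by simp⟩
    · obtain ⟨z, e, L, H, rfl, rfl⟩ := hBc.exists_isLatticeSegment hC hlat hκ hab hseg
      obtain ⟨rfl, rfl⟩ := H.length_eq_two hp
      have hF : ∀ F, Contributes (projAlong I '' orthantHull C Set.univ) m F ↔
          F = {intToReal _ z} ∨ F = {intToReal _ z + ((2 : ℕ) : ℝ) • intToReal _ e} ∨ F = B := by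
        intro F
        constructor
        · intro hFc
          by_cases hd : dim F = 0
          · obtain ⟨c, rfl⟩ := exists_eq_singleton_of_dim_eq_zero
              (by obtain ⟨J, hV, -⟩ := hFc; exact hV.face.1) hd
            rw [projAlong_image_newton] at ha hb hFc
            rcases ha.eq_or_eq hκ (hC.image _) (exists_nat_proj hlat) hb hab hFc with rfl | rfl
            · exact Or.inl rfl
            · exact Or.inr (Or.inl rfl)
          · exact Or.inr (Or.inr (huniq F (hFc.isBoundedEdge_proj hC hκ hd)))
        · rintro (rfl | rfl | rfl)
          · exact ha
          · exact hb
          · exact hBc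
      obtain ⟨h0, h1⟩ := isZeroFan_of_long_edge hC hne hlat hκ H hF
      exact ⟨h0, h1.2 (by rwa [Nat.cast_one])⟩
    · obtain ⟨z, e, L, H, rfl, rfl⟩ :=
        ((hF B).2 (Or.inr rfl)).exists_isLatticeSegment hC hlat hκ hab hseg
      obtain rfl := hlen H hvol
      obtain ⟨h0, h1⟩ := isZeroFan_of_vertex_edge hC hne hlat hκ H hF
      exact ⟨h0, h1.2 hbt⟩
    · obtain ⟨z₁, e₁, L₁, H₁, rfl, rfl⟩ :=
        ((hF B₁).2 (Or.inr (Or.inr (Or.inl rfl)))).exists_isLatticeSegment hC hlat hκ hab₁ hseg₁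
      obtain ⟨z₂, e₂, L₂, H₂, rfl, rfl⟩ :=
        ((hF B₂).2 (Or.inr (Or.inr (Or.inr rfl)))).exists_isLatticeSegment hC hlat hκ hab₂ hseg₂
      obtain rfl := hlen H₁ hvol₁
      obtain rfl := hlen H₂ hvol₂
      obtain ⟨h0, h1⟩ := isZeroFan_of_two_edges hC hne hlat hκ H₁ H₂ hBB haa hF
      exact ⟨h0, h1.2 ⟨ht₁, ht₂⟩⟩
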